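/- A *BDI chain* with an $N$-site unit cell is a finite-range, $N$-periodic Hamiltonian $H=\frac i2\sum_{m,n\in\mathbb Z}h(m,n)\,\tilde\gamma_m\gamma_n$ with real couplings $h$, where $\gamma_n$ and $\tilde\gamma_n$ are the real and imaginary Majorana modes of site $n$. With $(T_\alpha)_{ab}=h(a,b+N\alpha)$ for $0\le a,b<N$, put $F(z)=\sum_\alpha T_\alpha z^\alpha$ and $f(z)=\det F(z)$. Let $\omega=N_z-N_p$, where $N_z$ is the number of zeros of $f$ strictly inside the unit disk (with multiplicity) and $N_p$ is the order of its pole at $0$, and let $c$ be half the number of zeros of $f$ on the unit circle (with multiplicity). The bulk is *described by a CFT* if every energy band that touches zero at some momentum does so linearly; this includes the gapped case $c=0$. For strictly translation-invariant chains ($N=1$) $H=\sum_\alpha t_\alpha H_\alpha$ with $H_\alpha=\frac i2\sum_n\tilde\gamma_n\gamma_{n+\alpha}$, it means that the zeros of $f$ on the unit circle are simple. Two chains are *connected* if, described with a common unit cell of arbitrary size, they are joined by a continuous path of BDI chains of uniformly bounded range along which the bulk is always described by a CFT with the same $c$; they are in the *same phase* if they are connected, possibly after stacking one or both of them with a decoupled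 trivial chain $H_0$. Stacking two chains means taking $T_\alpha$ block diagonal. Let $\mathcal C$ be the set of chains with a CFT bulk that are connected to a translation-invariant chain or to a stack of translation-invariant chains. **Theorem 2.** 1. Having a CFT bulk, $c$ and $\omega$ do not depend on the unit cell chosen to describe a given chain. Along a continuous path of BDI chains with a common unit cell and uniformly bounded range, for which $f$ never vanishes identically and the number of zeros of $f$ on the unit circle is constant, $\omega$ is constant. 2. The phases of chains in $\mathcal C$ are classified by the semigroup $\mathbb N\times\mathbb Z$, labeled by $c\in\frac12\mathbb N$ and $\omega\in\mathbb Z$: for $X\in\mathcal C$ one has $c\in\frac12\mathbb N$; every pair $(c,\omega)\in\frac12\mathbb N\times\mathbb Z$ occurs; $X,Y\in\mathcal C$ are in the same phase if and only if they have the same $c$ and $\omega$; and $\mathcal C$ is closed under stacking, under which $c$ and $\omega$ add. More precisely, every $X\in\mathcal C$ is, after stacking with a single trivial chain if need be, connected to $H_\omega$ stacked with $2c$ copies of $H_0+H_1$. Two translation-invariant chains with CFT bulk are connected (without adding a trivial chain) if and only if they have the same $c$ and $\omega$. 3. If chains and paths are required to be strictly translation invariant, there is an extra $\mathbb Z_2$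 invariant for $c=0$ and an extra $\mathbb Z_2\times\mathbb Z_2$ invariant for $c\neq0$: translation-invariant chains with CFT bulk and $c=0$ (respectively $c\ne0$) are connected by a translation-invariant path if and only if they have the same $c$, $\omega$ and extra invariant. All values of the extra invariant occur for every $\omega\in\mathbb Z$ (and every nonzero $c\in\frac12\mathbb N$), namely as the sign in $f(z)=\pm z^\omega$ for $c=0$, and as the two independent signs in $f(z)=\pm(z^{2c}\pm1)z^\omega$ for $c\neq0$. -/

import Mathlib

open Filter Topology

/-- A non-interacting chain in the BDI class with real and imaginary Majorana modes `γ n`, `γ' n` on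
the sites `n : ℤ`, i.e. the Hamiltonian `H = (i/2) ∑ m, ∑ n, hop m n • γ' m * γ n`.
Time reversal forbids all other quadratic terms and hermiticity makes the couplings real; `H` has a
finite range and a repeating unit cell of `cell` sites. -/
structure BDIChain where
  /-- number of sites in the unit cell that is used to describe the chain -/
  cell : ℕ
  cell_pos : 0 < cell
  /-- coupling between the imaginary Majorana mode on site `i` and the real one on site `j` -/
  hop : ℤ → ℤ → ℝ
  periodic : ∀ i j, hop (i + cell) (j + cell) = hop i j
  finite_range : ∃ R : ℤ, ∀ i j, R < |i - j| → hop i j = 0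

namespace BDIChain

/-- The matrix `T α` of couplings between a unit cell and the unit cell `α` steps further. -/
def T (X : BDIChain) (α : ℤ) : Matrix (Fin X.cell) (Fin X.cell) ℝ :=
  Matrix.of fun a b => X.hop (a : ℕ) ((b : ℕ) + X.cell * α)

/-- `F(z) = ∑ α, T α * z ^ α` (a finite sum). -/
noncomputable def F (X : BDIChain) (z : ℂ) : Matrix (Fin X.cell) (Fin X.cell) ℂ :=
  Matrix.of fun a b => ∑ᶠ α : ℤ, (X.T α a b : ℂ) * z ^ α

/-- The associated complex function `f(z) = det F(z)`. -/
noncomputable def f (X : BDIChain) (z : ℂ) : ℂ := (X.F z).det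

/-- The order of `f` at `z`: the multiplicity of a zero, minus the order of a pole. It does not
depend on the value that `f` takes at `z` itself (this matters only at `z = 0`). -/
noncomputable def order (X : BDIChain) (z : ℂ) : ℤ := (meromorphicOrderAt X.f z).untop₀

/-- Number of zeros of `f` strictly inside the unit disk, with multiplicity. -/
noncomputable def numZeros (X : BDIChain) : ℤ :=
  ∑ᶠ z ∈ Metric.ball (0 : ℂ) 1, max (X.order z) 0

/-- Order of the pole of `f` at the origin. -/
noncomputable def polarOrder (X : BDIChain) : ℤ := max (-X.order 0) 0

/-- The topological invariant `ω = N_z - N_p`. -/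
noncomputable def omega (X : BDIChain) : ℤ := X.numZeros - X.polarOrder

/-- The central charge: half the number of zeros of `f` on the unit circle, with multiplicity. -/
noncomputable def centralCharge (X : BDIChain) : ℚ :=
  ((∑ᶠ z ∈ Metric.sphere (0 : ℂ) 1, X.order z : ℤ) : ℚ) / 2

/-- The Bogoliubov-de Gennes Hamiltonian at momentum `k`, in the Nambu basis
`(c k, (c (-k))†)`, built from the hermitian and antihermitian parts of `F(e^{ik})`.
Its eigenvalues are the single-particle energies `± ε k`. -/
noncomputable def bloch (X : BDIChain) (k : ℝ) :
    Matrix (Fin X.cell ⊕ Fin X.cell) (Fin X.cell ⊕ Fin X.cell) ℂ :=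
  let G := X.F (Complex.exp (Complex.I * k))
  let GH := (1 / 2 : ℂ) • (G + G.conjTranspose)
  let GA := (1 / 2 : ℂ) • (G - G.conjTranspose)
  Matrix.fromBlocks GH GA (-GA) (-GH)

/-- The bulk is described by a CFT (possibly the trivial one, for a gapped chain): the dynamical
critical exponent is one, i.e. a band that touches zero energy at a momentum `k₀` does so linearly.
(It always vanishes at least linearly, since `bloch` depends smoothly on `k`; for a `k₀` where no
band vanishes the condition holds automatically.) -/
def IsCFT (X : BDIChain) : Prop :=
  ∀ k₀ : ℝ, ∃ C : ℝ, 0 < C ∧ ∀ᶠ k in 𝓝 k₀, ∀ ε ∈ spectrum ℂ (X.bloch k), C * |k - k₀| ≤ ‖ε‖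

/-- A path of local Hamiltonians: a common unit cell, a common range, continuous couplings. -/
def IsLocalPath (γ : unitInterval → BDIChain) : Prop :=
  (∀ s, (γ s).cell = (γ 0).cell) ∧
  (∃ R : ℤ, ∀ s i j, R < |i - j| → (γ s).hop i j = 0) ∧
  ∀ i j, Continuous fun s => (γ s).hop i j

/-- A path of local Hamiltonians without a bulk transition: the bulk is a CFT all along the path,
always with the same central charge. -/
def IsPhasePath (γ : unitInterval → BDIChain) : Prop :=
  IsLocalPath γ ∧ ∀ s, (γ s).IsCFT ∧ (γ s).centralCharge = (γ 0).centralCharge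

/-- `X` and `Y` are connected without a bulk transition, by a path with an arbitrary unit cell. -/
def Connected (X Y : BDIChain) : Prop :=
  ∃ γ, IsPhasePath γ ∧ (γ 0).hop = X.hop ∧ (γ 1).hop = Y.hop

/-- Strict translation invariance. -/
def TranslationInvariant (X : BDIChain) : Prop := ∀ i j, X.hop (i + 1) (j + 1) = X.hop i j

/-- `X` and `Y` are connected without a bulk transition, by a translation invariant path. -/
def TIConnected (X Y : BDIChain) : Prop :=
  ∃ γ, IsPhasePath γ ∧ (∀ s, (γ s).cell = 1) ∧ (γ 0).hop = X.hop ∧ (γ 1).hop = Y.hop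

theorem stack_range (N M R S i j : ℤ) (hN : 0 < N) (hM : 0 < M)
    (h : (N + M) * (|R| + |S| + N + M + 1) < |i - j|) :
    R < |(N * (i / (N + M)) + i % (N + M)) - (N * (j / (N + M)) + j % (N + M))| ∧
    S < |(M * (i / (N + M)) + i % (N + M) - N) - (M * (j / (N + M)) + j % (N + M) - N)| := by
  have hL : 0 < N + M := by omega
  have hi := Int.mul_ediv_add_emod i (N + M)
  have hj := Int.mul_ediv_add_emod j (N + M)
  have hi0 := Int.emod_nonneg i hL.ne'
  have hj0 := Int.emod_nonneg j hL.ne'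
  have hi1 := Int.emod_lt_of_pos i hL
  have hj1 := Int.emod_lt_of_pos j hL
  generalize i / (N + M) = a at *
  generalize j / (N + M) = b at *
  generalize i % (N + M) = r at *
  generalize j % (N + M) = s at *
  have hR := le_abs_self R
  have hS := le_abs_self S
  have hR0 := abs_nonneg R
  have hS0 := abs_nonneg S
  generalize |R| = R' at *
  generalize |S| = S' at *
  subst hi hj
  -- the two sites lie in cells that are far apart
  have key : ∀ a b r s : ℤ, 0 ≤ r → 0 ≤ s → r < N + M → s < N + M →
      (N + M) * (R' + S' + N + M + 1) < ((N + M) * a + r) - ((N + M) * b + s) →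
      R' + S' + N + M < a - b ∧ R' + S' < (N * a + r) - (N * b + s) ∧
      R' + S' < (M * a + r - N) - (M * b + s - N) := by
    intro a b r s h1 h2 h3 h4 h5
    have hab : R' + S' + N + M < a - b := by
      by_contra hc
      nlinarith
    refine ⟨hab, ?_, ?_⟩ <;> nlinarith
  rcases lt_abs.mp h with h | h
  · obtain ⟨-, h1, h2⟩ := key a b r s hi0 hj0 hi1 hj1 h
    exact ⟨lt_abs.mpr (Or.inl (by linarith)), lt_abs.mpr (Or.inl (by linarith))⟩
  · obtain ⟨-, h1, h2⟩ := key b a s r hj0 hi0 hj1 hi1 (by linarith)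
    exact ⟨lt_abs.mpr (Or.inr (by linarith)), lt_abs.mpr (Or.inr (by linarith))⟩

/-- Two decoupled chains described as one chain: a unit cell of the stack consists of a unit cell of
`X` followed by a unit cell of `Y`, so that `T α` is block diagonal. -/
def stack (X Y : BDIChain) : BDIChain where
  cell := X.cell + Y.cell
  cell_pos := Nat.add_pos_left X.cell_pos _
  hop i j :=
    let N : ℤ := X.cell
    let M : ℤ := Y.cell
    if i % (N + M) < N ∧ j % (N + M) < N then
      X.hop (N * (i / (N + M)) + i % (N + M)) (N * (j / (N + M)) + j % (N + M))
    else if N ≤ i % (N + M) ∧ N ≤ j % (N + M) then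
      Y.hop (M * (i / (N + M)) + i % (N + M) - N) (M * (j / (N + M)) + j % (N + M) - N)
    else 0
  periodic i j := by
    have hL : (X.cell : ℤ) + Y.cell ≠ 0 := by have := X.cell_pos; omega
    have e : ∀ (N q r : ℤ), N * (q + 1) + r = N * q + r + N := by intros; ring
    have e' : ∀ (M q r N : ℤ), M * q + r + M - N = M * q + r - N + M := by intros; ring
    simp only [Nat.cast_add, Int.add_emod_right, Int.add_ediv_of_dvd_right (dvd_refl _),
      Int.ediv_self hL, e, e', X.periodic, Y.periodic]
  finite_range := by
    obtain ⟨R, hR⟩ := X.finite_range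
    obtain ⟨S, hS⟩ := Y.finite_range
    refine ⟨(X.cell + Y.cell) * (|R| + |S| + X.cell + Y.cell + 1), fun i j h => ?_⟩
    obtain ⟨h1, h2⟩ := stack_range X.cell Y.cell R S i j (by exact_mod_cast X.cell_pos)
      (by exact_mod_cast Y.cell_pos) h
    simp only [hR _ _ h1, hS _ _ h2, ite_self]

/-- The translation invariant chain `∑ α, t α • H_α`, where `H_α = (i/2) ∑ n, γ' n * γ (n + α)`. -/
def ofCoeff (t : ℤ →₀ ℝ) : BDIChain where
  cell := 1
  cell_pos := one_pos
  hop i j := t (j - i)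
  periodic i j := by simp
  finite_range := by
    refine ⟨∑ α ∈ t.support, |α|, fun i j h => ?_⟩
    by_contra hne
    have hm : j - i ∈ t.support := Finsupp.mem_support_iff.mpr hne
    have := Finset.single_le_sum (f := fun α : ℤ => |α|) (fun α _ => abs_nonneg α) hm
    simp only [abs_sub_comm j i] at this
    omega

/-- The chain `H_α`. -/
noncomputable def alphaChain (α : ℤ) : BDIChain := ofCoeff (Finsupp.single α 1)

/-- The trivial chain `H_0`. -/
noncomputable def trivialChain : BDIChain := alphaChain 0

/-- The standard critical Majorana chain `H_0 + H_1`. -/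
noncomputable def majoranaChain : BDIChain := ofCoeff (Finsupp.single 0 1 + Finsupp.single 1 1)

/-- `H_ω` stacked with `n` copies of the standard critical Majorana chain. -/
noncomputable def standardStack (ω : ℤ) : ℕ → BDIChain
  | 0 => alphaChain ω
  | n + 1 => stack (standardStack ω n) majoranaChain

/-- The gapped translation invariant chain with `f(z) = σ * z ^ ω`, for a sign `σ`. -/
noncomputable def gappedCanonical (ω : ℤ) (σ : ℤˣ) : BDIChain :=
  ofCoeff (Finsupp.single ω ((σ : ℤ) : ℝ))

/-- The translation invariant chain with `f(z) = σ.1 * (z ^ n + σ.2) * z ^ ω`, for two signs. -/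
noncomputable def criticalCanonical (n : ℕ) (ω : ℤ) (σ : ℤˣ × ℤˣ) : BDIChain :=
  ofCoeff (Finsupp.single (n + ω) ((σ.1 : ℤ) : ℝ) +
    Finsupp.single ω (((σ.1 : ℤ) : ℝ) * ((σ.2 : ℤ) : ℝ)))

/-- A translation invariant chain, or a stack of several ones. -/
inductive IsStackOfTI : BDIChain → Prop
  | single (X : BDIChain) (h : X.TranslationInvariant) : IsStackOfTI X
  | stack (X Y : BDIChain) (hX : IsStackOfTI X) (hY : IsStackOfTI Y) : IsStackOfTI (stack X Y)

/-- The systems to be classified: the bulk is a CFT, and the system is obtained, within its phase and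
with an arbitrary unit cell, by deforming a translation invariant chain or a stack of such chains. -/
def InClass (X : BDIChain) : Prop := X.IsCFT ∧ ∃ S, IsStackOfTI S ∧ Connected S X

/-- `X'` is `X`, or `X` stacked with one decoupled trivial chain. -/
def UpToTrivial (X X' : BDIChain) : Prop := X' = X ∨ X' = stack X trivialChain

/-- `X` and `Y` are in the same phase: they are connected without a bulk transition, possibly after
adding a decoupled trivial chain to them. -/
def SamePhase (X Y : BDIChain) : Prop :=
  ∃ X' Y', UpToTrivial X X' ∧ UpToTrivial Y Y' ∧ Connected X' Y'

end BDIChain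

/-!
A chain with `N` sites per unit cell is the same as an `N × N` matrix `F` of real Laurent polynomials
(`lmat`, `ofMat`), and a path of chains of bounded range is such a matrix whose coefficients are
continuous functions of time (`IsLocalPath.exists_matrix`).

*The CFT condition.* In a rotated basis the Bogoliubov-de Gennes matrix is off-diagonal with blocks
`F` and its adjoint, so the energies are the singular values of `F(e ^ (i k))`. Hence the bulk is
described by a CFT iff the smallest singular value vanishes at most linearly in `k` (`isCFT_iff`).
In this form it is visible that the condition survives multiplication by invertible matrices of
Laurent polynomials (`LinearGap.mul_isUnit`), and for a diagonal `F` it says that the zeros of the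
entries on the unit circle are simple (`linearGap_diagonal`).

*The invariants.* A unit cell which is `k` times as large turns `F(z ^ k)` into a matrix conjugate to
the direct sum of the `F(y)` with `y ^ k = z ^ k` (`recellMat_mul_waves`), so `c`, `ω` and the CFT
condition do not depend on the unit cell. Along a path the zeros of `f` move continuously on the
Riemann sphere; if their number on the unit circle is constant, none of them can enter or leave the
circle, and `ω` is constant (`eventually_labels_eq`, `IsLocalPath.omega_eq`). Likewise a simple zero
at `1` stays there, since the zeros of a real function come in conjugate pairs
(`eventually_isRoot_one`); therefore the signs are constant in the translation invariant case
(`signs_pathAt`).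

*Translation invariant chains.* A scalar Laurent polynomial with simple zeros on the circle is
deformed by moving its other zeros to `0` and `∞` (`exists_move_roots`) and then the remaining ones
along the circle, keeping their order (`deform_normalForm_normalForm`). What is left are the number
of zeros on the circle, the index and two signs (`exists_deform`, `tiConnected_iff`).

*All chains with a CFT bulk.* Adding a multiple of one row or column to another one can be switched on
continuously without changing `f` or the CFT condition, and by the Euclidean algorithm such operations
diagonalize `F` (`exists_elemEquiv_diagonal_laurent`, `ElemEquiv.connected`). The diagonal
entries are deformed until their zeros on the circle are roots of unity. When the unit cell is
enlarged by the common order of these roots, all zeros on the circle move to `1`; diagonalizing again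
gives entries `± z ^ ω (z - 1) ^ n` with `n ≤ 1` (`IsCFT.exists_connected_basic`). By Whitehead's
lemma the powers of `z` are moved from one entry to another by elementary operations
(`ElemEquiv.diagonal_units`), the entries are permuted (`ElemEquiv.diagonal_perm`), and signs disappear
because they occur twice when the unit cell is doubled (`connected_sign_mul`). So two chains with a
CFT bulk are connected iff they have the same `c` and `ω` (`connected_iff`), even without adding
trivial chains, and all claims about phases follow from this.
-/

namespace BDIChain

open scoped LaurentPolynomial Polynomial

/-! ### Chains and matrices of Laurent polynomials -/

theorem ext_cell_hop {X Y : BDIChain} (h : X.cell = Y.cell) (h' : X.hop = Y.hop) : X = Y := by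
  cases X; cases Y; subst h; subst h'; rfl

/-- The value of a real Laurent polynomial at a nonzero complex number. -/
noncomputable def lval (z : ℂˣ) : ℝ[T;T⁻¹] →+* ℂ :=
  LaurentPolynomial.eval₂ (algebraMap ℝ ℂ) z

theorem lval_eq_sum (z : ℂˣ) (p : ℝ[T;T⁻¹]) :
    lval z p = p.coeff.sum fun α r => (r : ℂ) * (z : ℂ) ^ α := by
  induction p using LaurentPolynomial.induction_on' with
  | add p q hp hq =>
    rw [map_add, hp, hq, AddMonoidAlgebra.coeff_add, Finsupp.sum_add_index']
    · simp
    · intros; push_cast; ring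
  | C_mul_T n a =>
    rw [← LaurentPolynomial.single_eq_C_mul_T, AddMonoidAlgebra.coeff_single,
      Finsupp.sum_single_index (by simp), LaurentPolynomial.single_eq_C_mul_T]
    simp [lval]

theorem lval_eq_finsum (z : ℂˣ) (p : ℝ[T;T⁻¹]) :
    lval z p = ∑ᶠ α : ℤ, (p.coeff α : ℂ) * (z : ℂ) ^ α := by
  rw [lval_eq_sum, Finsupp.sum, finsum_eq_sum_of_support_subset]
  intro α hα
  simp only [Function.mem_support] at hα
  simp only [Finset.mem_coe, Finsupp.mem_support_iff]
  intro h
  simp [h] at hα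

section Chain

/-- The position inside the unit cell of a site of a chain whose unit cell has `N` sites. -/
def site {N : ℕ} (hN : 0 < N) (i : ℤ) : Fin N :=
  ⟨(i % N).toNat, by
    have h1 := Int.emod_nonneg i (b := (N : ℤ)) (by omega)
    have h2 := Int.emod_lt_of_pos i (b := (N : ℤ)) (by omega)
    omega⟩

theorem site_val {N : ℕ} (hN : 0 < N) (i : ℤ) : ((site hN i : ℕ) : ℤ) = i % N := by
  have h1 := Int.emod_nonneg i (b := (N : ℤ)) (by omega)
  simp [site, h1]

theorem site_add_mul {N : ℕ} (hN : 0 < N) (i k : ℤ) : site hN (i + N * k) = site hN i := by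
  ext
  have := site_val hN (i + N * k)
  rw [Int.add_mul_emod_self_left, ← site_val hN] at this
  exact_mod_cast this

theorem site_coe {N : ℕ} (hN : 0 < N) (a : Fin N) : site hN ((a : ℕ) : ℤ) = a := by
  ext
  have := site_val hN ((a : ℕ) : ℤ)
  rw [Int.emod_eq_of_lt (by positivity) (by exact_mod_cast a.2)] at this
  exact_mod_cast this

theorem eq_site_add_mul {N : ℕ} (hN : 0 < N) (i : ℤ) :
    i = ((site hN i : ℕ) : ℤ) + N * (i / N) := by
  rw [site_val, add_comm, Int.mul_ediv_add_emod]

/-- The degrees of the entries of a matrix of Laurent polynomials are bounded; this gives `ofMat` a finite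
range. -/
theorem exists_coeff_bound {ι : Type*} [Finite ι] {R : Type*} [Semiring R]
    (M : Matrix ι ι R[T;T⁻¹]) :
    ∃ B : ℕ, ∀ a b α, (B : ℤ) < |α| → (M a b).coeff α = 0 := by
  have h : ∀ p : R[T;T⁻¹], ∃ B : ℕ, ∀ α, (B : ℤ) < |α| → p.coeff α = 0 := by
    intro p
    refine ⟨∑ α ∈ p.coeff.support, α.natAbs, fun α h => ?_⟩
    by_contra hne
    have : α.natAbs ≤ ∑ α ∈ p.coeff.support, α.natAbs :=
      Finset.single_le_sum (f := fun α : ℤ => α.natAbs) (fun α _ => Nat.zero_le _)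
      (Finsupp.mem_support_iff.mpr hne)
    rw [Int.abs_eq_natAbs] at h
    omega
  choose B hB using h
  cases nonempty_fintype ι
  refine ⟨∑ ab : ι × ι, B (M ab.1 ab.2), fun a b α h => hB _ _ (lt_of_le_of_lt ?_ h)⟩
  exact_mod_cast Finset.single_le_sum (f := fun ab : ι × ι => B (M ab.1 ab.2))
    (fun _ _ => Nat.zero_le _) (Finset.mem_univ (a, b))

/-- Sites which are far apart lie in unit cells which are far apart. -/
theorem lt_abs_ediv_sub_ediv {N : ℕ} (hN : 0 < N) (B : ℕ) {i j : ℤ}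
    (h : (N : ℤ) * (B + 1) < |i - j|) : (B : ℤ) < |j / N - i / N| := by
  have hi := Int.mul_ediv_add_emod i N
  have hj := Int.mul_ediv_add_emod j N
  have hi0 := Int.emod_nonneg i (b := (N : ℤ)) (by omega)
  have hj0 := Int.emod_nonneg j (b := (N : ℤ)) (by omega)
  have hi1 := Int.emod_lt_of_pos i (b := (N : ℤ)) (by omega)
  have hj1 := Int.emod_lt_of_pos j (b := (N : ℤ)) (by omega)
  have hN' : (0 : ℤ) < N := by exact_mod_cast hN
  rcases lt_abs.mp h with h | h
  · refine lt_abs.mpr (Or.inr ?_)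
    by_contra hc
    nlinarith
  · refine lt_abs.mpr (Or.inl ?_)
    by_contra hc
    nlinarith

/-- The chain with `N` sites per unit cell whose couplings `T α` are the coefficients of a matrix of
Laurent polynomials. -/
def ofMat {N : ℕ} (hN : 0 < N) (M : Matrix (Fin N) (Fin N) ℝ[T;T⁻¹]) : BDIChain where
  cell := N
  cell_pos := hN
  hop i j := (M (site hN i) (site hN j)).coeff (j / N - i / N)
  periodic i j := by
    have hN' : (N : ℤ) ≠ 0 := by omega
    have h1 := site_add_mul hN i 1
    have h2 := site_add_mul hN j 1
    rw [mul_one] at h1 h2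
    rw [h1, h2, Int.add_ediv_of_dvd_right (dvd_refl _), Int.add_ediv_of_dvd_right (dvd_refl _)]
    congr 1
    ring
  finite_range := by
    obtain ⟨B, hB⟩ := exists_coeff_bound M
    exact ⟨N * (B + 1), fun i j h => hB _ _ _ (lt_abs_ediv_sub_ediv hN B h)⟩

theorem hop_eq_zero_of_range {X : BDIChain} {R : ℤ} (hR : ∀ i j, R < |i - j| → X.hop i j = 0)
    {a b : ℕ} (ha : a < X.cell) (hb : b < X.cell) {α : ℤ} (hα : |R| + X.cell < |α|) :
    X.hop a (b + X.cell * α) = 0 := by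
  refine hR _ _ ?_
  have hN : (1 : ℤ) ≤ X.cell := by exact_mod_cast X.cell_pos
  have ha : (a : ℤ) < X.cell := by exact_mod_cast ha
  have hb : (b : ℤ) < X.cell := by exact_mod_cast hb
  have hR := le_abs_self R
  have hR' := abs_nonneg R
  have ha0 : (0 : ℤ) ≤ (a : ℤ) := by positivity
  have hb0 : (0 : ℤ) ≤ (b : ℤ) := by positivity
  rcases lt_abs.mp hα with hc | hc
  · refine lt_abs.mpr (Or.inr ?_)
    nlinarith
  · refine lt_abs.mpr (Or.inl ?_)
    nlinarith

theorem T_finite (X : BDIChain) (a b : Fin X.cell) :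
    (Function.support fun α => X.T α a b).Finite := by
  obtain ⟨R, hR⟩ := X.finite_range
  refine (Set.finite_Icc (-(|R| + X.cell)) (|R| + X.cell)).subset fun α hα => ?_
  by_contra hc
  refine hα (hop_eq_zero_of_range hR a.2 b.2 ?_)
  rw [Set.mem_Icc, not_and_or, not_le, not_le] at hc
  rcases hc with hc | hc
  · exact lt_abs.mpr (Or.inr (by linarith))
  · exact lt_abs.mpr (Or.inl hc)

/-- The matrix of Laurent polynomials `∑ α, T α * z ^ α` of a chain. -/
noncomputable def lmat (X : BDIChain) : Matrix (Fin X.cell) (Fin X.cell) ℝ[T;T⁻¹] :=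
  Matrix.of fun a b => .ofCoeff (Finsupp.ofSupportFinite (fun α => X.T α a b) (X.T_finite a b))

theorem coeff_lmat (X : BDIChain) (a b : Fin X.cell) (α : ℤ) :
    (X.lmat a b).coeff α = X.hop (a : ℕ) ((b : ℕ) + X.cell * α) := rfl

theorem hop_add_mul (X : BDIChain) (i j k : ℤ) :
    X.hop (i + X.cell * k) (j + X.cell * k) = X.hop i j := by
  induction k using Int.induction_on with
  | zero => simp
  | succ k ih => rw [← ih, ← X.periodic (i + X.cell * k)]; congr 1 <;> ring
  | pred k ih => rw [← ih, ← X.periodic (i + X.cell * (-k - 1))]; congr 1 <;> ring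

theorem ofMat_lmat (X : BDIChain) : ofMat X.cell_pos X.lmat = X := by
  refine ext_cell_hop rfl ?_
  funext i j
  change X.hop _ _ = _
  conv_rhs => rw [eq_site_add_mul X.cell_pos i, eq_site_add_mul X.cell_pos j]
  rw [← X.hop_add_mul _ _ (i / X.cell)]
  congr 1
  ring

theorem lmat_ofMat {N : ℕ} (hN : 0 < N) (M : Matrix (Fin N) (Fin N) ℝ[T;T⁻¹]) :
    (ofMat hN M).lmat = M := by
  have hN' : (N : ℤ) ≠ 0 := by omega
  have key : ∀ (a b : Fin N) (α : ℤ), (M (site hN (a : ℕ)) (site hN ((b : ℕ) + (N : ℤ) * α))).coeff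
      (((b : ℕ) + (N : ℤ) * α) / N - ((a : ℕ) : ℤ) / N) = (M a b).coeff α := by
    intro a b α
    rw [site_add_mul, site_coe, site_coe, Int.add_mul_ediv_left _ _ hN',
      Int.ediv_eq_zero_of_lt (by positivity) (by exact_mod_cast b.2),
      Int.ediv_eq_zero_of_lt (by positivity) (by exact_mod_cast a.2)]
    simp
  funext a b
  ext α
  exact key a b α

theorem F_eq (X : BDIChain) (z : ℂˣ) : X.F z = (lval z).mapMatrix X.lmat := by
  ext a b
  rw [RingHom.mapMatrix_apply, Matrix.map_apply, lval_eq_finsum]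
  rfl

theorem f_eq (X : BDIChain) (z : ℂˣ) : X.f z = lval z X.lmat.det := by
  rw [f, F_eq, RingHom.map_det]

/-- The same chain, described with a unit cell that is `k` times as large. -/
def recell (X : BDIChain) (k : ℕ) (hk : 0 < k) : BDIChain where
  cell := k * X.cell
  cell_pos := Nat.mul_pos hk X.cell_pos
  hop := X.hop
  periodic i j := by
    have := X.hop_add_mul i j k
    push_cast
    rwa [mul_comm] at this
  finite_range := X.finite_range

end Chain

/-! ### Counting zeros: `ω` and `c` in terms of roots of polynomials -/

section Count

/-- The number of roots of a polynomial in the open unit disk, with multiplicity. -/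
noncomputable def inCount (P : ℂ[X]) : ℕ := (P.roots.filter (‖·‖ < 1)).card

/-- The number of roots of a polynomial on the unit circle, with multiplicity. -/
noncomputable def circCount (P : ℂ[X]) : ℕ := (P.roots.filter (‖·‖ = 1)).card

theorem inCount_mul {P Q : ℂ[X]} (hP : P ≠ 0) (hQ : Q ≠ 0) :
    inCount (P * Q) = inCount P + inCount Q := by
  rw [inCount, Polynomial.roots_mul (mul_ne_zero hP hQ), Multiset.filter_add, Multiset.card_add]
  rfl

theorem circCount_mul {P Q : ℂ[X]} (hP : P ≠ 0) (hQ : Q ≠ 0) :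
    circCount (P * Q) = circCount P + circCount Q := by
  rw [circCount, Polynomial.roots_mul (mul_ne_zero hP hQ), Multiset.filter_add, Multiset.card_add]
  rfl

@[simp] theorem inCount_C (a : ℂ) : inCount (.C a) = 0 := by simp [inCount]
@[simp] theorem circCount_C (a : ℂ) : circCount (.C a) = 0 := by simp [circCount]
@[simp] theorem circCount_zero : circCount 0 = 0 := by simp [circCount]

@[simp] theorem inCount_X_pow (n : ℕ) : inCount (.X ^ n) = n := by
  rw [inCount, Polynomial.roots_X_pow, Multiset.nsmul_singleton, Multiset.filter_eq_self.mpr]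
  · simp
  · intro a ha; simp [Multiset.eq_of_mem_replicate ha]

@[simp] theorem circCount_X_pow (n : ℕ) : circCount (.X ^ n) = 0 := by
  rw [circCount, Polynomial.roots_X_pow, Multiset.nsmul_singleton, Multiset.filter_eq_nil.mpr]
  · simp
  · intro a ha; simp [Multiset.eq_of_mem_replicate ha]

theorem sum_rootMultiplicity (P : ℂ[X]) (p : ℂ → Prop) [DecidablePred p] (t : Finset ℂ)
    (ht : ∀ a ∈ t, p a) (ht' : ∀ a ∈ P.roots, p a → a ∈ t) :
    ∑ a ∈ t, P.rootMultiplicity a = (P.roots.filter p).card := by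
  classical
  rw [← Multiset.sum_count_eq_card (s := t)]
  · refine Finset.sum_congr rfl fun a ha => ?_
    rw [Multiset.count_filter_of_pos (ht a ha), Polynomial.count_roots]
  · intro a ha
    rw [Multiset.mem_filter] at ha
    exact ht' a ha.1 ha.2

variable {X : BDIChain} {m : ℕ} {P : ℂ[X]}

/-- If `f` is a polynomial `P` divided by `z ^ m`, then its orders are the multiplicities of the zeros
of `P`, shifted by `m` at the origin. -/
theorem order_eq (hP : P ≠ 0) (h : ∀ z : ℂ, z ≠ 0 → X.f z = z ^ (-m : ℤ) * P.eval z) (w : ℂ) :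
    X.order w = P.rootMultiplicity w - if w = 0 then (m : ℤ) else 0 := by
  obtain ⟨Q, hQ, hQ'⟩ := Polynomial.exists_eq_pow_rootMultiplicity_mul_and_not_dvd P hP w
  set k := P.rootMultiplicity w
  have hQw : Q.eval w ≠ 0 := fun h => hQ' (Polynomial.dvd_iff_isRoot.mpr h)
  have hev : ∀ z, P.eval z = (z - w) ^ k * Q.eval z := fun z => by rw [hQ]; simp
  have key : ∀ (n : ℤ) (g : ℂ → ℂ), AnalyticAt ℂ g w → g w ≠ 0 →
      (∀ᶠ z in 𝓝[≠] w, X.f z = (z - w) ^ n • g z) → X.order w = n := by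
    intro n g hg hgw hfg
    have hmer : MeromorphicAt X.f w := by
      refine MeromorphicAt.congr ?_ (EventuallyEq.symm hfg)
      fun_prop
    rw [order, (meromorphicOrderAt_eq_int_iff hmer).mpr ⟨g, hg, hgw, hfg⟩]
    rfl
  have hQa : AnalyticAt ℂ (fun z => Q.eval z) w := Q.differentiable.analyticAt w
  by_cases hw : w = 0
  · subst hw
    rw [if_pos rfl]
    refine key _ _ hQa hQw ?_
    filter_upwards [self_mem_nhdsWithin] with z hz
    have hz : z ≠ 0 := hz
    rw [h z hz, hev, sub_zero, smul_eq_mul, sub_eq_neg_add, zpow_add₀ hz, zpow_natCast, mul_assoc]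
  · rw [if_neg hw, sub_zero]
    refine key _ (fun z => z ^ (-m : ℤ) * Q.eval z) ?_ ?_ ?_
    · exact (AnalyticAt.zpow analyticAt_id hw).mul hQa
    · exact mul_ne_zero (zpow_ne_zero _ hw) hQw
    · filter_upwards [(isOpen_ne.eventually_mem hw).filter_mono
        nhdsWithin_le_nhds] with z hz
      rw [h z hz, hev, smul_eq_mul, zpow_natCast]
      ring

theorem omega_eq_inCount (hP : P ≠ 0) (h : ∀ z : ℂ, z ≠ 0 → X.f z = z ^ (-m : ℤ) * P.eval z) :
    X.omega = inCount P - m := by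
  classical
  -- all points of the disk where the order of `f` can be nonzero
  set t : Finset ℂ := (insert 0 P.roots.toFinset).filter (‖·‖ < 1) with ht
  have h0 : (0 : ℂ) ∈ t := by simp [ht]
  have hnum : X.numZeros = ∑ z ∈ t, max (X.order z) 0 := by
    refine finsum_mem_eq_sum_of_inter_support_eq _ ?_
    ext z
    simp only [ht, Set.mem_inter_iff, mem_ball_zero_iff, Function.mem_support, Finset.coe_filter,
      Finset.mem_insert, Multiset.mem_toFinset, Set.mem_ofPred_eq, and_congr_left_iff,
      iff_and_self]
    intro hz hz1
    by_contra hc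
    rw [not_or, Polynomial.mem_roots hP, ← Polynomial.rootMultiplicity_pos hP] at hc
    apply hz
    rw [order_eq hP h, if_neg hc.1]
    have := hc.2
    simp only [not_lt, nonpos_iff_eq_zero] at this
    simp [this]
  have hcount : ∑ z ∈ t, P.rootMultiplicity z = inCount P :=
    sum_rootMultiplicity P _ t (fun a ha => (Finset.mem_filter.mp ha).2)
      fun a ha ha' => by simp [ht, ha', hP, (Polynomial.mem_roots'.mp ha).2.eq_zero]
  rw [omega, hnum, polarOrder, ← hcount, ← Finset.add_sum_erase _ _ h0,
    ← Finset.add_sum_erase _ (fun z => P.rootMultiplicity z) h0]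
  have hrest : ∑ z ∈ t.erase 0, max (X.order z) 0
      = ((∑ z ∈ t.erase 0, P.rootMultiplicity z : ℕ) : ℤ) := by
    push_cast
    refine Finset.sum_congr rfl fun z hz => ?_
    rw [order_eq hP h, if_neg (Finset.ne_of_mem_erase hz)]
    simp
  rw [hrest, order_eq hP h, if_pos rfl]
  push_cast
  omega

theorem centralCharge_eq_circCount (hP : P ≠ 0)
    (h : ∀ z : ℂ, z ≠ 0 → X.f z = z ^ (-m : ℤ) * P.eval z) :
    X.centralCharge = (circCount P : ℚ) / 2 := by
  classical
  set t : Finset ℂ := P.roots.toFinset.filter (‖·‖ = 1) with ht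
  have hne : ∀ z : ℂ, ‖z‖ = 1 → z ≠ 0 := by rintro z hz rfl; simp at hz
  have hnum : ∑ᶠ z ∈ Metric.sphere (0 : ℂ) 1, X.order z = ∑ z ∈ t, X.order z := by
    refine finsum_mem_eq_sum_of_inter_support_eq _ ?_
    ext z
    simp only [ht, Set.mem_inter_iff, mem_sphere_zero_iff_norm, Function.mem_support,
      Finset.coe_filter, Multiset.mem_toFinset, Set.mem_ofPred_eq, and_congr_left_iff,
      iff_and_self]
    intro hz hz1
    by_contra hc
    rw [Polynomial.mem_roots hP, ← Polynomial.rootMultiplicity_pos hP] at hc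
    apply hz
    rw [order_eq hP h, if_neg (hne z hz1)]
    simp only [not_lt, nonpos_iff_eq_zero] at hc
    simp [hc]
  have hcount : ∑ z ∈ t, P.rootMultiplicity z = circCount P :=
    sum_rootMultiplicity P _ t (fun a ha => (Finset.mem_filter.mp ha).2)
      fun a ha ha' => by simp [ht, ha', hP, (Polynomial.mem_roots'.mp ha).2.eq_zero]
  rw [centralCharge, hnum, ← hcount]
  congr 1
  push_cast
  refine Finset.sum_congr rfl fun z hz => ?_
  rw [order_eq hP h, if_neg (hne z (Finset.mem_filter.mp hz).2)]
  simp

theorem order_eq_zero (h : ∀ z : ℂ, z ≠ 0 → X.f z = 0) (w : ℂ) : X.order w = 0 := by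
  have hev : X.f =ᶠ[𝓝[≠] w] fun _ => 0 := by
    have hne : ∀ᶠ z : ℂ in 𝓝[≠] w, z ≠ 0 := by
      by_cases hw : w = 0
      · subst hw; exact self_mem_nhdsWithin
      · exact (isOpen_ne.eventually_mem hw).filter_mono nhdsWithin_le_nhds
    filter_upwards [hne] with z hz using h z hz
  rw [order, meromorphicOrderAt_congr hev, meromorphicOrderAt_const]
  simp

theorem omega_eq_zero (h : ∀ z : ℂ, z ≠ 0 → X.f z = 0) : X.omega = 0 := by
  simp [omega, numZeros, polarOrder, order_eq_zero h]

theorem centralCharge_eq_zero (h : ∀ z : ℂ, z ≠ 0 → X.f z = 0) : X.centralCharge = 0 := by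
  simp [centralCharge, order_eq_zero h]

end Count

/-! ### Laurent polynomials: index and zeros on the unit circle -/

section Laurent

/-- The exponent `m` in a representation `p = P / z ^ m` of a Laurent polynomial. -/
noncomputable def den (p : ℝ[T;T⁻¹]) : ℕ := p.exists_T_pow.choose

/-- The polynomial `P` in a representation `p = P / z ^ m` of a Laurent polynomial. -/
noncomputable def numer (p : ℝ[T;T⁻¹]) : ℝ[X] := p.exists_T_pow.choose_spec.choose

theorem toLaurent_numer (p : ℝ[T;T⁻¹]) :
    Polynomial.toLaurent (numer p) = p * LaurentPolynomial.T (den p) :=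
  p.exists_T_pow.choose_spec.choose_spec

/-- The number of zeros of a Laurent polynomial in the open unit disk minus the order of its pole at
the origin; it is `0` for the zero polynomial. -/
noncomputable def ind (p : ℝ[T;T⁻¹]) : ℤ :=
  if p = 0 then 0 else inCount ((numer p).map (algebraMap ℝ ℂ)) - den p

/-- The number of zeros of a Laurent polynomial on the unit circle. -/
noncomputable def circ (p : ℝ[T;T⁻¹]) : ℕ := circCount ((numer p).map (algebraMap ℝ ℂ))

theorem map_ne_zero_of_toLaurent {p : ℝ[T;T⁻¹]} {P : ℝ[X]} {m : ℕ} (hp : p ≠ 0)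
    (h : Polynomial.toLaurent P = p * LaurentPolynomial.T m) : P.map (algebraMap ℝ ℂ) ≠ 0 := by
  rw [Polynomial.map_ne_zero_iff (algebraMap ℝ ℂ).injective]
  rintro rfl
  rw [map_zero] at h
  exact hp ((LaurentPolynomial.isUnit_T m).mul_left_eq_zero.mp h.symm)

theorem map_numer_ne_zero {p : ℝ[T;T⁻¹]} (hp : p ≠ 0) : (numer p).map (algebraMap ℝ ℂ) ≠ 0 :=
  map_ne_zero_of_toLaurent hp (toLaurent_numer p)

/-- Two representations of a Laurent polynomial as a fraction differ by a power of `z`; therefore `ind`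
and `circ` can be computed from any representation. -/
theorem toLaurent_unique {p : ℝ[T;T⁻¹]} {P Q : ℝ[X]} {m n : ℕ}
    (h : Polynomial.toLaurent P = p * LaurentPolynomial.T m)
    (h' : Polynomial.toLaurent Q = p * LaurentPolynomial.T n) : P * .X ^ n = Q * .X ^ m := by
  apply Polynomial.toLaurent_injective
  rw [map_mul, map_mul, h, h', Polynomial.toLaurent_X_pow, Polynomial.toLaurent_X_pow]
  ring

theorem ind_eq {p : ℝ[T;T⁻¹]} {P : ℝ[X]} {m : ℕ} (hp : p ≠ 0)
    (h : Polynomial.toLaurent P = p * LaurentPolynomial.T m) :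
    ind p = inCount (P.map (algebraMap ℝ ℂ)) - m := by
  have hP := map_ne_zero_of_toLaurent hp h
  have := congrArg (fun P => inCount (P.map (algebraMap ℝ ℂ)))
    (toLaurent_unique h (toLaurent_numer p))
  simp only [Polynomial.map_mul, Polynomial.map_pow, Polynomial.map_X] at this
  rw [inCount_mul hP (by simp), inCount_mul (map_numer_ne_zero hp) (by simp), inCount_X_pow,
    inCount_X_pow] at this
  rw [ind, if_neg hp]
  omega

theorem circ_eq {p : ℝ[T;T⁻¹]} {P : ℝ[X]} {m : ℕ} (hp : p ≠ 0)
    (h : Polynomial.toLaurent P = p * LaurentPolynomial.T m) :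
    circ p = circCount (P.map (algebraMap ℝ ℂ)) := by
  have hP := map_ne_zero_of_toLaurent hp h
  have := congrArg (fun P => circCount (P.map (algebraMap ℝ ℂ)))
    (toLaurent_unique h (toLaurent_numer p))
  simp only [Polynomial.map_mul, Polynomial.map_pow, Polynomial.map_X] at this
  rw [circCount_mul hP (by simp), circCount_mul (map_numer_ne_zero hp) (by simp), circCount_X_pow,
    circCount_X_pow] at this
  rw [circ]
  omega

theorem toLaurent_numer_mul (p q : ℝ[T;T⁻¹]) :
    Polynomial.toLaurent (numer p * numer q)
      = p * q * LaurentPolynomial.T ((den p + den q : ℕ) : ℤ) := by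
  rw [map_mul, toLaurent_numer, toLaurent_numer, Nat.cast_add, LaurentPolynomial.T_add]
  ring

theorem ind_mul {p q : ℝ[T;T⁻¹]} (hp : p ≠ 0) (hq : q ≠ 0) : ind (p * q) = ind p + ind q := by
  rw [ind_eq (mul_ne_zero hp hq) (toLaurent_numer_mul p q), Polynomial.map_mul,
    inCount_mul (map_numer_ne_zero hp) (map_numer_ne_zero hq), ind, ind, if_neg hp, if_neg hq]
  push_cast
  ring

theorem circ_mul {p q : ℝ[T;T⁻¹]} (hp : p ≠ 0) (hq : q ≠ 0) : circ (p * q) = circ p + circ q := by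
  rw [circ_eq (mul_ne_zero hp hq) (toLaurent_numer_mul p q), Polynomial.map_mul,
    circCount_mul (map_numer_ne_zero hp) (map_numer_ne_zero hq)]
  rfl

theorem ind_toLaurent {P : ℝ[X]} (hP : P ≠ 0) :
    ind (Polynomial.toLaurent P) = inCount (P.map (algebraMap ℝ ℂ)) := by
  rw [ind_eq (m := 0) (P := P) (by simpa using hP) (by simp)]
  simp

theorem circ_toLaurent {P : ℝ[X]} (hP : P ≠ 0) :
    circ (Polynomial.toLaurent P) = circCount (P.map (algebraMap ℝ ℂ)) :=
  circ_eq (m := 0) (P := P) (by simpa using hP) (by simp)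

theorem ind_C {a : ℝ} (ha : a ≠ 0) : ind (LaurentPolynomial.C a) = 0 := by
  rw [← Polynomial.toLaurent_C, ind_toLaurent (by simpa using ha)]
  simp

theorem circ_C {a : ℝ} (ha : a ≠ 0) : circ (LaurentPolynomial.C a) = 0 := by
  rw [← Polynomial.toLaurent_C, circ_toLaurent (by simpa using ha)]
  simp

theorem ind_one : ind 1 = 0 := by simpa using ind_C one_ne_zero
theorem circ_one : circ 1 = 0 := by simpa using circ_C one_ne_zero

theorem T_ne_zero (n : ℤ) : (LaurentPolynomial.T n : ℝ[T;T⁻¹]) ≠ 0 :=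
  (LaurentPolynomial.isUnit_T n).ne_zero

theorem ind_T_nat (n : ℕ) : ind (LaurentPolynomial.T n) = n := by
  rw [← Polynomial.toLaurent_X_pow, ind_toLaurent (by simp)]
  simp

theorem ind_T (n : ℤ) : ind (LaurentPolynomial.T n) = n := by
  have h := ind_mul (T_ne_zero n) (T_ne_zero (-n))
  rw [← LaurentPolynomial.T_add, add_neg_cancel, LaurentPolynomial.T_zero, ind_one] at h
  obtain ⟨k, rfl | rfl⟩ := n.eq_nat_or_neg
  · exact ind_T_nat k
  · rw [neg_neg, ind_T_nat] at h
    omega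

theorem lval_mul_pow {p : ℝ[T;T⁻¹]} {P : ℝ[X]} {m : ℕ}
    (h : Polynomial.toLaurent P = p * LaurentPolynomial.T m) (z : ℂˣ) :
    lval z p * (z : ℂ) ^ m = (P.map (algebraMap ℝ ℂ)).eval (z : ℂ) := by
  have := congrArg (lval z) h
  rw [map_mul] at this
  simp only [lval, LaurentPolynomial.eval₂_toLaurent, LaurentPolynomial.eval₂_T, zpow_natCast,
    Units.val_pow_eq_pow_val] at this
  rw [Polynomial.eval_map, this]
  rfl

theorem f_eq_numer (X : BDIChain) (z : ℂ) (hz : z ≠ 0) :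
    X.f z = z ^ (-(den X.lmat.det) : ℤ) *
      ((numer X.lmat.det).map (algebraMap ℝ ℂ)).eval z := by
  have := lval_mul_pow (toLaurent_numer X.lmat.det) (Units.mk0 z hz)
  rw [← f_eq, Units.val_mk0] at this
  rw [← this, zpow_neg, zpow_natCast]
  field_simp

theorem f_eq_zero_of_det {X : BDIChain} (h : X.lmat.det = 0) (z : ℂ) (hz : z ≠ 0) : X.f z = 0 := by
  have := f_eq X (Units.mk0 z hz)
  rwa [h, map_zero] at this

theorem circ_zero : circ 0 = 0 := by
  have h := toLaurent_numer 0
  rw [zero_mul, Polynomial.toLaurent_eq_zero] at h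
  simp [circ, h]

theorem omega_eq (X : BDIChain) : X.omega = ind X.lmat.det := by
  by_cases h : X.lmat.det = 0
  · rw [omega_eq_zero (f_eq_zero_of_det h), ind, if_pos h]
  · rw [omega_eq_inCount (map_numer_ne_zero h) (f_eq_numer X), ind, if_neg h]

theorem centralCharge_eq (X : BDIChain) : X.centralCharge = (circ X.lmat.det : ℚ) / 2 := by
  by_cases h : X.lmat.det = 0
  · rw [centralCharge_eq_zero (f_eq_zero_of_det h), h, circ_zero]
    simp
  · rw [centralCharge_eq_circCount (map_numer_ne_zero h) (f_eq_numer X), circ]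

end Laurent

/-! ### The spectrum of the Bogoliubov-de Gennes matrix -/

section Spectral
open Matrix
open scoped ComplexOrder

variable {ι : Type*} [Fintype ι] [DecidableEq ι]

/-- The squared Euclidean norm of a vector. -/
noncomputable def nsq (v : ι → ℂ) : ℝ := ∑ i, ‖v i‖ ^ 2

theorem star_dotProduct_self {ι : Type*} [Fintype ι] (v : ι → ℂ) : star v ⬝ᵥ v = (nsq v : ℂ) := by
  simp only [dotProduct, nsq, Pi.star_apply, RCLike.star_def]
  push_cast
  exact Finset.sum_congr rfl fun i _ => Complex.conj_mul' (v i)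

theorem nsq_nonneg {ι : Type*} [Fintype ι] (v : ι → ℂ) : 0 ≤ nsq v :=
  Finset.sum_nonneg fun _ _ => by positivity

theorem nsq_eq_zero {ι : Type*} [Fintype ι] {v : ι → ℂ} : nsq v = 0 ↔ v = 0 := by
  rw [nsq, Finset.sum_eq_zero_iff_of_nonneg fun _ _ => by positivity, funext_iff]
  simp

theorem nsq_smul {ι : Type*} [Fintype ι] (c : ℂ) (v : ι → ℂ) : nsq (c • v) = ‖c‖ ^ 2 * nsq v := by
  simp [nsq, mul_pow, Finset.mul_sum]

theorem mem_spectrum_iff_exists_mulVec (H : Matrix ι ι ℂ) (ε : ℂ) :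
    ε ∈ spectrum ℂ H ↔ ∃ x : ι → ℂ, x ≠ 0 ∧ H *ᵥ x = ε • x := by
  rw [spectrum.mem_iff, isUnit_iff_isUnit_det, isUnit_iff_ne_zero, not_not,
    ← exists_mulVec_eq_zero_iff]
  refine exists_congr fun x => and_congr_right fun _ => ?_
  rw [sub_mulVec, sub_eq_zero, Algebra.algebraMap_eq_smul_one, smul_mulVec, one_mulVec, eq_comm]

/-- The Bogoliubov-de Gennes matrix built from the hermitian and antihermitian parts of `G`. -/
noncomputable def bdg (G : Matrix ι ι ℂ) : Matrix (ι ⊕ ι) (ι ⊕ ι) ℂ :=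
  fromBlocks ((1 / 2 : ℂ) • (G + Gᴴ)) ((1 / 2 : ℂ) • (G - Gᴴ))
    (-((1 / 2 : ℂ) • (G - Gᴴ))) (-((1 / 2 : ℂ) • (G + Gᴴ)))

/-- In the rotated basis `u = a + b`, `w = a - b` the matrix `bdg G` is off-diagonal, with blocks
`G` and `Gᴴ`. -/
theorem bdg_mulVec_iff {ι : Type*} [Fintype ι] (G : Matrix ι ι ℂ) (ε : ℂ) (a b : ι → ℂ) :
    bdg G *ᵥ Sum.elim a b = ε • Sum.elim a b ↔
      G *ᵥ (a + b) = ε • (a - b) ∧ Gᴴ *ᵥ (a - b) = ε • (a + b) := by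
  rw [bdg, fromBlocks_mulVec, Sum.elim_comp_inl, Sum.elim_comp_inr]
  have h : ε • Sum.elim a b = Sum.elim (ε • a) (ε • b) := by
    ext (i | i) <;> simp
  rw [h, Sum.elim_eq_iff]
  simp only [smul_mulVec, add_mulVec, sub_mulVec, neg_mulVec, mulVec_add, mulVec_sub,
    funext_iff, Pi.add_apply, Pi.sub_apply, Pi.smul_apply, Pi.neg_apply, smul_eq_mul]
  constructor
  · rintro ⟨h1, h2⟩
    exact ⟨fun i => by linear_combination h1 i - h2 i, fun i => by linear_combination h1 i + h2 i⟩
  · rintro ⟨h1, h2⟩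
    exact ⟨fun i => by linear_combination (h1 i + h2 i) / 2,
      fun i => by linear_combination (h2 i - h1 i) / 2⟩

/-- A lower bound for the singular values of `G` is a lower bound for the energies: for an eigenvector
the vectors `u = a + b` and `w = a - b` have the same norm unless the energy is zero. -/
theorem le_norm_of_mem_spectrum {G : Matrix ι ι ℂ} {c : ℝ} (hc : 0 < c)
    (h : ∀ v, c ^ 2 * nsq v ≤ nsq (G *ᵥ v)) {ε : ℂ} (hε : ε ∈ spectrum ℂ (bdg G)) : c ≤ ‖ε‖ := by
  obtain ⟨x, hx, hx'⟩ := (mem_spectrum_iff_exists_mulVec _ _).mp hε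
  obtain ⟨a, b, rfl⟩ : ∃ a b, x = Sum.elim a b := ⟨x ∘ Sum.inl, x ∘ Sum.inr, by simp⟩
  obtain ⟨h1, h2⟩ := (bdg_mulVec_iff G ε a b).mp hx'
  have hinj : ∀ v, G *ᵥ v = 0 → v = 0 := fun v hv => by
    have := h v
    rw [hv, nsq_eq_zero.mpr rfl] at this
    exact nsq_eq_zero.mp (le_antisymm (by nlinarith [sq_pos_of_pos hc]) (nsq_nonneg v))
  have hinj' : ∀ v, Gᴴ *ᵥ v = 0 → v = 0 := by
    have hdet : G.det ≠ 0 := fun h0 => by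
      obtain ⟨v, hv, hv'⟩ := exists_mulVec_eq_zero_iff.mpr h0
      exact hv (hinj v hv')
    intro v hv
    by_contra hne
    have := exists_mulVec_eq_zero_iff.mp ⟨v, hne, hv⟩
    rw [det_conjTranspose, star_eq_zero] at this
    exact hdet this
  have hab : ∀ u w : ι → ℂ, a + b = u → a - b = w → u = 0 → w = 0 → False := by
    rintro u w rfl rfl hu hw
    apply hx
    have ha : a = 0 := by
      ext i
      have e1 := congrFun hu i
      have e2 := congrFun hw i
      simp only [Pi.add_apply, Pi.sub_apply, Pi.zero_apply] at e1 e2 ⊢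
      linear_combination (e1 + e2) / 2
    subst ha
    have hb : b = 0 := by simpa using hu
    subst hb
    ext (i | i) <;> simp
  generalize hu : a + b = u at *
  generalize hw : a - b = w at *
  by_cases hε0 : ε = 0
  · subst hε0
    rw [zero_smul] at h1 h2
    exact (hab u w rfl rfl (hinj u h1) (hinj' w h2)).elim
  -- compare `⟪G u, w⟫ = ⟪u, Gᴴ w⟫`, where both sides are multiples of the energy
  have hnorm : nsq u = nsq w := by
    have e1 : star (G *ᵥ u) ⬝ᵥ w = star u ⬝ᵥ (Gᴴ *ᵥ w) := by
      rw [star_mulVec, dotProduct_mulVec]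
    rw [h1, h2, star_smul, smul_dotProduct, dotProduct_smul, star_dotProduct_self,
      star_dotProduct_self] at e1
    have e2 := congrArg norm e1
    simp only [smul_eq_mul, norm_mul, norm_star, Complex.norm_real, Real.norm_eq_abs,
      abs_of_nonneg (nsq_nonneg _)] at e2
    exact (mul_left_cancel₀ (norm_ne_zero_iff.mpr hε0) e2).symm
  have hu0 : 0 < nsq u := by
    refine lt_of_le_of_ne (nsq_nonneg u) fun h0 => ?_
    exact hab u w rfl rfl (nsq_eq_zero.mp h0.symm) (nsq_eq_zero.mp (hnorm ▸ h0.symm))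
  have := h u
  rw [h1, nsq_smul, ← hnorm] at this
  exact le_of_sq_le_sq (le_of_mul_le_mul_right this hu0) (norm_nonneg _)

/-- Conversely, the singular values of `G` are energies, so that a lower bound for the energies bounds
`G` from below. -/
theorem nsq_mulVec_ge {G : Matrix ι ι ℂ} {c : ℝ} (hc : 0 ≤ c)
    (h : ∀ ε ∈ spectrum ℂ (bdg G), c ≤ ‖ε‖) (v : ι → ℂ) : c ^ 2 * nsq v ≤ nsq (G *ᵥ v) := by
  -- an eigenvalue `μ` of `Gᴴ G - c²` gives the singular value `√(μ + c²)` of `G`, which is at least `c`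
  set B : Matrix ι ι ℂ := Gᴴ * G - ((c ^ 2 : ℝ) : ℂ) • 1 with hB
  have hherm : B.IsHermitian := by
    refine (isHermitian_conjTranspose_mul_self G).sub ?_
    rw [IsHermitian, conjTranspose_smul, conjTranspose_one]
    simp
  have hquad : ∀ x, star x ⬝ᵥ (B *ᵥ x) = ((nsq (G *ᵥ x) - c ^ 2 * nsq x : ℝ) : ℂ) := by
    intro x
    rw [hB, sub_mulVec, smul_mulVec, one_mulVec, dotProduct_sub, dotProduct_smul,
      star_dotProduct_self, ← mulVec_mulVec, dotProduct_mulVec, ← star_mulVec,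
      star_dotProduct_self]
    push_cast
    rw [smul_eq_mul]
  have hpsd : B.PosSemidef := by
    rw [hherm.posSemidef_iff_eigenvalues_nonneg]
    intro i
    set μ := hherm.eigenvalues i
    set x : ι → ℂ := ⇑(hherm.eigenvectorBasis i) with hx
    have hx0 : x ≠ 0 := by
      intro h0
      have := hherm.eigenvectorBasis.orthonormal.ne_zero i
      apply this
      ext j
      exact congrFun h0 j
    have hμ : B *ᵥ x = (μ : ℂ) • x := hherm.mulVec_eigenvectorBasis i
    have hA : Gᴴ *ᵥ (G *ᵥ x) = ((μ + c ^ 2 : ℝ) : ℂ) • x := by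
      rw [hB, sub_mulVec, smul_mulVec, one_mulVec, sub_eq_iff_eq_add, ← add_smul] at hμ
      rw [mulVec_mulVec, hμ]
      push_cast
      rfl
    have hxpos : 0 < nsq x := lt_of_le_of_ne (nsq_nonneg x) fun h0 => hx0 (nsq_eq_zero.mp h0.symm)
    have hG : nsq (G *ᵥ x) = (μ + c ^ 2) * nsq x := by
      have := star_dotProduct_self (G *ᵥ x)
      rw [star_mulVec, ← dotProduct_mulVec, hA, dotProduct_smul, star_dotProduct_self,
        smul_eq_mul] at this
      exact_mod_cast this.symm
    have hnn : 0 ≤ μ + c ^ 2 := by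
      have := nsq_nonneg (G *ᵥ x)
      rw [hG] at this
      exact nonneg_of_mul_nonneg_left this hxpos
    set σ := Real.sqrt (μ + c ^ 2) with hσ
    have hσ2 : σ ^ 2 = μ + c ^ 2 := Real.sq_sqrt hnn
    have hσ0 : 0 ≤ σ := Real.sqrt_nonneg _
    have hmem : (σ : ℂ) ∈ spectrum ℂ (bdg G) := by
      rw [mem_spectrum_iff_exists_mulVec]
      -- the left singular vector, or zero if the singular value vanishes
      obtain ⟨w, hw1, hw2⟩ : ∃ w, G *ᵥ x = (σ : ℂ) • w ∧ Gᴴ *ᵥ w = (σ : ℂ) • x := by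
        by_cases h0 : σ = 0
        · refine ⟨0, ?_, by simp [h0]⟩
          rw [smul_zero, ← nsq_eq_zero, hG, ← hσ2, h0]
          simp
        · have h0' : (σ : ℂ) ≠ 0 := by exact_mod_cast h0
          refine ⟨(σ : ℂ)⁻¹ • (G *ᵥ x), by rw [smul_smul, mul_inv_cancel₀ h0', one_smul], ?_⟩
          rw [mulVec_smul, hA, ← hσ2, smul_smul]
          congr 1
          push_cast
          field_simp
      refine ⟨Sum.elim ((1 / 2 : ℂ) • (x + w)) ((1 / 2 : ℂ) • (x - w)), ?_, ?_⟩
      · intro h0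
        apply hx0
        ext i
        have e1 := congrFun h0 (Sum.inl i)
        have e2 := congrFun h0 (Sum.inr i)
        simp only [Sum.elim_inl, Sum.elim_inr, Pi.smul_apply, Pi.add_apply, Pi.sub_apply,
          Pi.zero_apply, smul_eq_mul] at e1 e2 ⊢
        linear_combination e1 + e2
      · rw [bdg_mulVec_iff]
        have e1 : (1 / 2 : ℂ) • (x + w) + (1 / 2 : ℂ) • (x - w) = x := by
          ext i; simp only [Pi.smul_apply, Pi.add_apply, Pi.sub_apply, smul_eq_mul]; ring
        have e2 : (1 / 2 : ℂ) • (x + w) - (1 / 2 : ℂ) • (x - w) = w := by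
          ext i; simp only [Pi.smul_apply, Pi.add_apply, Pi.sub_apply, smul_eq_mul]; ring
        rw [e1, e2]
        exact ⟨hw1, hw2⟩
    have := h _ hmem
    rw [Complex.norm_real, Real.norm_eq_abs, abs_of_nonneg hσ0] at this
    change 0 ≤ μ
    nlinarith
  have := hpsd.dotProduct_mulVec_nonneg v
  rw [hquad] at this
  have := Complex.zero_le_real.mp this
  linarith

end Spectral

/-! ### The CFT condition as a bound on `F` -/

section LinearGap
open Matrix

/-- The smallest singular value of the matrix-valued function `G` vanishes at most linearly
everywhere. -/
def LinearGap {ι : Type*} [Fintype ι] (G : ℝ → Matrix ι ι ℂ) : Prop :=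
  ∀ k₀ : ℝ, ∃ C : ℝ, 0 < C ∧ ∀ᶠ k in 𝓝 k₀, ∀ v, C * |k - k₀| * ‖v‖ ≤ ‖G k *ᵥ v‖

theorem sq_norm_le_nsq {ι : Type*} [Fintype ι] (v : ι → ℂ) : ‖v‖ ^ 2 ≤ nsq v := by
  have h : ‖v‖ ≤ Real.sqrt (nsq v) := by
    refine (pi_norm_le_iff_of_nonneg (Real.sqrt_nonneg _)).mpr fun i => Real.le_sqrt_of_sq_le ?_
    exact Finset.single_le_sum (f := fun i => ‖v i‖ ^ 2) (fun _ _ => by positivity)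
      (Finset.mem_univ i)
  exact (Real.le_sqrt (norm_nonneg _) (nsq_nonneg v)).mp h

theorem nsq_le_card_mul {ι : Type*} [Fintype ι] (v : ι → ℂ) :
    nsq v ≤ Fintype.card ι * ‖v‖ ^ 2 := by
  rw [nsq, ← nsmul_eq_mul, ← Finset.card_univ, ← Finset.sum_const]
  exact Finset.sum_le_sum fun i _ => by gcongr; exact norm_le_pi_norm v i

/-- The nonzero complex number `e ^ (i k)`. -/
noncomputable def expU (k : ℝ) : ℂˣ := Units.mk0 (Complex.exp (Complex.I * k)) (Complex.exp_ne_zero _)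

theorem norm_expU (k : ℝ) : ‖(expU k : ℂ)‖ = 1 := by
  rw [expU, Units.val_mk0, mul_comm, Complex.norm_exp_ofReal_mul_I]

/-- The chain has a CFT bulk iff the singular values of `F(e ^ (i k))` vanish at most linearly. -/
theorem isCFT_iff (X : BDIChain) :
    X.IsCFT ↔ LinearGap fun k => (lval (expU k)).mapMatrix X.lmat := by
  have hb : ∀ k, X.bloch k = bdg ((lval (expU k)).mapMatrix X.lmat) := fun k => by
    rw [← F_eq]; rfl
  have hN : (0 : ℝ) < X.cell := by exact_mod_cast X.cell_pos
  have hcard : (Fintype.card (Fin X.cell) : ℝ) = X.cell := by simp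
  simp only [IsCFT, LinearGap, hb]
  refine forall_congr' fun k₀ => ⟨?_, ?_⟩
  · rintro ⟨C, hC, h⟩
    -- the factor `√N` compares the Euclidean norm with the supremum norm of `LinearGap`
    refine ⟨C / Real.sqrt X.cell, by positivity, ?_⟩
    filter_upwards [h] with k hk v
    have h1 := nsq_mulVec_ge (c := C * |k - k₀|) (by positivity) hk v
    have h2 := h1.trans (nsq_le_card_mul _)
    have h3 := sq_norm_le_nsq v
    rw [hcard] at h2
    refine le_of_sq_le_sq ?_ (norm_nonneg _)
    rw [mul_pow, mul_pow, div_pow, Real.sq_sqrt hN.le, div_mul_eq_mul_div, div_mul_eq_mul_div,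
      div_le_iff₀ hN]
    calc C ^ 2 * |k - k₀| ^ 2 * ‖v‖ ^ 2 ≤ (C * |k - k₀|) ^ 2 * nsq v := by
          rw [mul_pow]; gcongr
      _ ≤ _ := h2
      _ = _ := mul_comm _ _
  · rintro ⟨C, hC, h⟩
    refine ⟨C / Real.sqrt X.cell, by positivity, ?_⟩
    filter_upwards [h] with k hk ε hε
    rcases eq_or_ne k k₀ with rfl | hne
    · simp
    have hpos : 0 < |k - k₀| := abs_pos.mpr (sub_ne_zero.mpr hne)
    refine le_norm_of_mem_spectrum (by positivity) (fun v => ?_) hε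
    have h1 := hk v
    have h2 := nsq_le_card_mul v
    rw [hcard] at h2
    refine le_trans ?_ (sq_norm_le_nsq _)
    rw [mul_pow, div_pow, Real.sq_sqrt hN.le, div_mul_eq_mul_div, div_mul_eq_mul_div, div_le_iff₀ hN]
    calc C ^ 2 * |k - k₀| ^ 2 * nsq v ≤ C ^ 2 * |k - k₀| ^ 2 * (X.cell * ‖v‖ ^ 2) := by gcongr
      _ = (C * |k - k₀| * ‖v‖) ^ 2 * X.cell := by ring
      _ ≤ _ := by gcongr

end LinearGap

/-! ### Operations which preserve the gap condition -/

section GapLemmas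
open Matrix

theorem eventually_norm_mulVec_le {ι κ : Type*} [Fintype ι] [Fintype κ] {A : ℝ → Matrix ι κ ℂ}
    (hA : ∀ i j, Continuous fun k => A k i j) (k₀ : ℝ) :
    ∃ K : ℝ, 0 < K ∧ ∀ᶠ k in 𝓝 k₀, ∀ v, ‖A k *ᵥ v‖ ≤ K * ‖v‖ := by
  set s : ℝ → ℝ := fun k => ∑ i, ∑ j, ‖A k i j‖ with hs
  have hsc : Continuous s := by fun_prop
  have hs0 : ∀ k, 0 ≤ s k := fun k =>
    Finset.sum_nonneg fun i _ => Finset.sum_nonneg fun j _ => norm_nonneg _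
  refine ⟨s k₀ + 1, by linarith [hs0 k₀], ?_⟩
  filter_upwards [hsc.continuousAt.eventually_lt continuousAt_const (lt_add_one (s k₀))] with k hk v
  refine (pi_norm_le_iff_of_nonneg (by have := hs0 k; positivity)).mpr fun i => ?_
  calc ‖(A k *ᵥ v) i‖ ≤ ∑ j, ‖A k i j * v j‖ := norm_sum_le _ _
    _ ≤ ∑ j, ‖A k i j‖ * ‖v‖ := by
      refine Finset.sum_le_sum fun j _ => ?_
      rw [norm_mul]
      gcongr
      exact norm_le_pi_norm v j
    _ = (∑ j, ‖A k i j‖) * ‖v‖ := by rw [Finset.sum_mul]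
    _ ≤ s k * ‖v‖ := by
      gcongr
      exact Finset.single_le_sum (f := fun i => ∑ j, ‖A k i j‖)
        (fun i _ => Finset.sum_nonneg fun j _ => norm_nonneg _) (Finset.mem_univ i)
    _ ≤ _ := by gcongr

/-- The gap condition passes from `G` to `G'` if `G * B' = A * G'`, where `A` is locally bounded and
`B'` is locally bounded from below because it has the locally bounded left inverse `B`. -/
theorem LinearGap.of_intertwine {ι κ : Type*} [Fintype ι] [Fintype κ] [DecidableEq κ]
    {G : ℝ → Matrix ι ι ℂ} {G' : ℝ → Matrix κ κ ℂ} (hG : LinearGap G) {A B' : ℝ → Matrix ι κ ℂ}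
    {B : ℝ → Matrix κ ι ℂ} (hA : ∀ i j, Continuous fun k => A k i j)
    (hB : ∀ i j, Continuous fun k => B k i j) (h : ∀ k, G k * B' k = A k * G' k)
    (h1 : ∀ k, B k * B' k = 1) : LinearGap G' := by
  intro k₀
  obtain ⟨C, hC, hev⟩ := hG k₀
  obtain ⟨K, hK, hKev⟩ := eventually_norm_mulVec_le hA k₀
  obtain ⟨L, hL, hLev⟩ := eventually_norm_mulVec_le hB k₀
  refine ⟨C / (K * L), by positivity, ?_⟩
  filter_upwards [hev, hKev, hLev] with k hk hKk hLk v
  have e1 := hk (B' k *ᵥ v)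
  rw [mulVec_mulVec, h, ← mulVec_mulVec] at e1
  have e2 := hKk (G' k *ᵥ v)
  have e3 := hLk (B' k *ᵥ v)
  rw [mulVec_mulVec, h1, one_mulVec] at e3
  rw [div_mul_eq_mul_div, div_mul_eq_mul_div, div_le_iff₀ (by positivity)]
  calc C * |k - k₀| * ‖v‖ ≤ C * |k - k₀| * (L * ‖B' k *ᵥ v‖) := by gcongr
    _ = L * (C * |k - k₀| * ‖B' k *ᵥ v‖) := by ring
    _ ≤ L * (K * ‖G' k *ᵥ v‖) := mul_le_mul_of_nonneg_left (e1.trans e2) hL.le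
    _ = _ := by ring

theorem linearGap_blockDiagonal {ι o : Type*} [Fintype ι] [Fintype o] [DecidableEq o]
    (G : o → ℝ → Matrix ι ι ℂ) :
    LinearGap (fun k => blockDiagonal fun j => G j k) ↔ ∀ j, LinearGap (G j) := by
  have hmul : ∀ (k : ℝ) (v : ι × o → ℂ) (i : ι) (j : o),
      ((blockDiagonal fun j => G j k) *ᵥ v) (i, j) = (G j k *ᵥ fun i => v (i, j)) i := by
    intro k v i j
    simp only [mulVec, dotProduct, blockDiagonal_apply, Fintype.sum_prod_type, ite_mul, zero_mul]
    refine Finset.sum_congr rfl fun i' _ => ?_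
    rw [Finset.sum_eq_single j]
    · simp
    · intro b _ hb; simp [hb.symm]
    · simp
  constructor
  · intro h j k₀
    obtain ⟨C, hC, hev⟩ := h k₀
    refine ⟨C, hC, ?_⟩
    filter_upwards [hev] with k hk v
    set w : ι × o → ℂ := fun x => if x.2 = j then v x.1 else 0 with hw
    have e1 : ‖v‖ ≤ ‖w‖ := by
      refine (pi_norm_le_iff_of_nonneg (norm_nonneg _)).mpr fun i => ?_
      have := norm_le_pi_norm w (i, j)
      simpa [hw] using this
    have e2 : ‖(blockDiagonal fun j => G j k) *ᵥ w‖ ≤ ‖G j k *ᵥ v‖ := by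
      refine (pi_norm_le_iff_of_nonneg (norm_nonneg _)).mpr fun ⟨i, j'⟩ => ?_
      rw [hmul]
      by_cases hj : j' = j
      · subst hj
        simp only [hw, if_true]
        exact norm_le_pi_norm (G j' k *ᵥ v) i
      · simp only [hw, if_neg hj]
        have : (fun _ : ι => (0 : ℂ)) = 0 := rfl
        rw [this, mulVec_zero]
        simp
    exact (mul_le_mul_of_nonneg_left e1 (by positivity)).trans ((hk w).trans e2)
  · intro h k₀
    choose C hC hev using fun j => h j k₀
    obtain ⟨c, hc, hcC⟩ : ∃ c > 0, ∀ j, c ≤ C j := by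
      rcases isEmpty_or_nonempty o with ho | ho
      · exact ⟨1, one_pos, fun j => ho.elim j⟩
      · obtain ⟨j₀, hj₀⟩ := Finite.exists_min C
        exact ⟨C j₀, hC j₀, hj₀⟩
    refine ⟨c, hc, ?_⟩
    filter_upwards [eventually_all.mpr hev] with k hk v
    rw [← Real.norm_of_nonneg (mul_nonneg hc.le (abs_nonneg (k - k₀))), ← norm_smul]
    refine (pi_norm_le_iff_of_nonneg (norm_nonneg _)).mpr fun ⟨i, j⟩ => ?_
    rw [Pi.smul_apply, norm_smul, Real.norm_of_nonneg (mul_nonneg hc.le (abs_nonneg (k - k₀)))]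
    calc c * |k - k₀| * ‖v (i, j)‖ ≤ C j * |k - k₀| * ‖fun i => v (i, j)‖ := by
          have := (hC j).le
          gcongr
          · exact hcC j
          · exact norm_le_pi_norm (fun i => v (i, j)) i
      _ ≤ ‖G j k *ᵥ fun i => v (i, j)‖ := hk j _
      _ ≤ _ := by
        refine (pi_norm_le_iff_of_nonneg (norm_nonneg _)).mpr fun i => ?_
        rw [← hmul]
        exact norm_le_pi_norm ((blockDiagonal fun j => G j k) *ᵥ v) (i, j)

theorem linearGap_fromBlocks {ι κ : Type*} [Fintype ι] [Fintype κ] {G : ℝ → Matrix ι ι ℂ}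
    {H : ℝ → Matrix κ κ ℂ} (hG : LinearGap G) (hH : LinearGap H) :
    LinearGap fun k => fromBlocks (G k) 0 0 (H k) := by
  intro k₀
  obtain ⟨C, hC, hCev⟩ := hG k₀
  obtain ⟨D, hD, hDev⟩ := hH k₀
  have hm : 0 < min C D := lt_min hC hD
  refine ⟨min C D, hm, ?_⟩
  filter_upwards [hCev, hDev] with k hCk hDk v
  rw [fromBlocks_mulVec, zero_mulVec, zero_mulVec, add_zero, zero_add]
  rw [← Real.norm_of_nonneg (mul_nonneg hm.le (abs_nonneg (k - k₀))), ← norm_smul]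
  have hn : ∀ (x : ι → ℂ) (y : κ → ℂ), ‖x‖ ≤ ‖Sum.elim x y‖ ∧ ‖y‖ ≤ ‖Sum.elim x y‖ := fun x y =>
    ⟨(pi_norm_le_iff_of_nonneg (norm_nonneg _)).mpr fun i => norm_le_pi_norm (Sum.elim x y) (.inl i),
      (pi_norm_le_iff_of_nonneg (norm_nonneg _)).mpr fun i => norm_le_pi_norm (Sum.elim x y) (.inr i)⟩
  refine (pi_norm_le_iff_of_nonneg (norm_nonneg _)).mpr fun i => ?_
  rw [Pi.smul_apply, norm_smul, Real.norm_of_nonneg (mul_nonneg hm.le (abs_nonneg (k - k₀)))]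
  rcases i with i | i
  · calc min C D * |k - k₀| * ‖v (.inl i)‖ ≤ C * |k - k₀| * ‖v ∘ Sum.inl‖ := by
          gcongr
          · exact min_le_left _ _
          · exact norm_le_pi_norm (v ∘ Sum.inl) i
      _ ≤ _ := (hCk _).trans (hn _ _).1
  · calc min C D * |k - k₀| * ‖v (.inr i)‖ ≤ D * |k - k₀| * ‖v ∘ Sum.inr‖ := by
          gcongr
          · exact min_le_right _ _
          · exact norm_le_pi_norm (v ∘ Sum.inr) i
      _ ≤ _ := (hDk _).trans (hn _ _).2

theorem LinearGap.reindex {ι κ : Type*} [Fintype ι] [Fintype κ] {G : ℝ → Matrix ι ι ℂ}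
    (hG : LinearGap G) (e : ι ≃ κ) : LinearGap fun k => Matrix.reindex e e (G k) := by
  intro k₀
  obtain ⟨C, hC, hCev⟩ := hG k₀
  refine ⟨C, hC, ?_⟩
  filter_upwards [hCev] with k hk v
  have h1 := hk (v ∘ e)
  have h2 : G k *ᵥ (v ∘ e) = (Matrix.reindex e e (G k) *ᵥ v) ∘ e := by
    rw [Matrix.reindex_apply, submatrix_mulVec_equiv, Equiv.symm_symm]
    ext i; simp
  rw [h2] at h1
  have e1 : ∀ x : κ → ℂ, ‖x ∘ e‖ = ‖x‖ := fun x => by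
    refine le_antisymm ?_ ?_
    · exact (pi_norm_le_iff_of_nonneg (norm_nonneg _)).mpr fun i => norm_le_pi_norm x (e i)
    · refine (pi_norm_le_iff_of_nonneg (norm_nonneg _)).mpr fun i => ?_
      have := norm_le_pi_norm (x ∘ e) (e.symm i)
      simpa using this
  rwa [e1, e1] at h1

theorem continuous_lval_expU (p : ℝ[T;T⁻¹]) : Continuous fun k => lval (expU k) p := by
  simp only [lval_eq_sum, Finsupp.sum]
  refine continuous_finsetSum _ fun α _ => continuous_const.mul ?_
  refine Continuous.zpow₀ ?_ α fun k => Or.inl (expU k).ne_zero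
  simp only [expU, Units.val_mk0]
  fun_prop

/-- The matrix `F(e ^ (i k))` belonging to a matrix of Laurent polynomials. -/
noncomputable def symbol {ι : Type*} [Fintype ι] [DecidableEq ι] (M : Matrix ι ι ℝ[T;T⁻¹]) (k : ℝ) :
    Matrix ι ι ℂ :=
  (lval (expU k)).mapMatrix M

theorem symbol_mul {ι : Type*} [Fintype ι] [DecidableEq ι] (M M' : Matrix ι ι ℝ[T;T⁻¹]) (k : ℝ) :
    symbol (M * M') k = symbol M k * symbol M' k := map_mul _ _ _

theorem symbol_one {ι : Type*} [Fintype ι] [DecidableEq ι] (k : ℝ) :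
    symbol (1 : Matrix ι ι ℝ[T;T⁻¹]) k = 1 := map_one _

/-- The gap condition is preserved by multiplication with invertible matrices of Laurent polynomials. -/
theorem LinearGap.mul_isUnit {ι : Type*} [Fintype ι] [DecidableEq ι] {U M V : Matrix ι ι ℝ[T;T⁻¹]}
    (h : LinearGap (symbol M)) (hU : IsUnit U) (hV : IsUnit V) : LinearGap (symbol (U * M * V)) := by
  obtain ⟨U, rfl⟩ := hU
  obtain ⟨V, rfl⟩ := hV
  have hc : ∀ (M : Matrix ι ι ℝ[T;T⁻¹]) i j, Continuous fun k => symbol M k i j :=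
    fun M i j => continuous_lval_expU _
  refine h.of_intertwine (A := symbol (U⁻¹ : _ˣ).1) (B' := symbol V.1) (B := symbol (V⁻¹ : _ˣ).1)
    (hc _) (hc _) (fun k => ?_) (fun k => ?_)
  · rw [← symbol_mul, ← symbol_mul, ← mul_assoc, ← mul_assoc, Units.inv_mul, one_mul]
  · rw [← symbol_mul, Units.inv_mul, symbol_one]

end GapLemmas

/-! ### The gap condition for diagonal matrices -/

section Scalar

/-- All zeros of the Laurent polynomial on the unit circle are simple (and it does not vanish
identically). -/
def SimpleCirc (p : ℝ[T;T⁻¹]) : Prop :=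
  p ≠ 0 ∧ ∀ z : ℂ, ‖z‖ = 1 → ((numer p).map (algebraMap ℝ ℂ)).rootMultiplicity z ≤ 1

theorem rootMultiplicity_eq_of_toLaurent {p : ℝ[T;T⁻¹]} {P : ℝ[X]} {m : ℕ} (hp : p ≠ 0)
    (h : Polynomial.toLaurent P = p * LaurentPolynomial.T m) {z : ℂ} (hz : z ≠ 0) :
    (P.map (algebraMap ℝ ℂ)).rootMultiplicity z
      = ((numer p).map (algebraMap ℝ ℂ)).rootMultiplicity z := by
  have hP := map_ne_zero_of_toLaurent hp h
  have := congrArg (fun P => (P.map (algebraMap ℝ ℂ)).rootMultiplicity z)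
    (toLaurent_unique h (toLaurent_numer p))
  have hX : ∀ n : ℕ, (Polynomial.X ^ n : ℂ[X]).rootMultiplicity z = 0 := fun n =>
    Polynomial.rootMultiplicity_eq_zero (by simp [hz])
  simp only [Polynomial.map_mul, Polynomial.map_pow, Polynomial.map_X] at this
  rwa [Polynomial.rootMultiplicity_mul (mul_ne_zero hP (by simp)),
    Polynomial.rootMultiplicity_mul (mul_ne_zero (map_numer_ne_zero hp) (by simp)), hX, hX,
    add_zero, add_zero] at this

theorem simpleCirc_iff {p : ℝ[T;T⁻¹]} {P : ℝ[X]} {m : ℕ} (hp : p ≠ 0)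
    (h : Polynomial.toLaurent P = p * LaurentPolynomial.T m) :
    SimpleCirc p ↔ ∀ z : ℂ, ‖z‖ = 1 → (P.map (algebraMap ℝ ℂ)).rootMultiplicity z ≤ 1 := by
  refine ⟨fun h' z hz => ?_, fun h' => ⟨hp, fun z hz => ?_⟩⟩
  · rw [rootMultiplicity_eq_of_toLaurent hp h (by rintro rfl; simp at hz)]
    exact h'.2 z hz
  · rw [← rootMultiplicity_eq_of_toLaurent hp h (by rintro rfl; simp at hz)]
    exact h' z hz

theorem norm_expU_sub (k k₀ : ℝ) :
    ‖(expU k : ℂ) - expU k₀‖ = ‖Complex.exp (Complex.I * ((k - k₀ : ℝ) : ℂ)) - 1‖ := by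
  have : (expU k : ℂ) - expU k₀
      = (expU k₀ : ℂ) * (Complex.exp (Complex.I * ((k - k₀ : ℝ) : ℂ)) - 1) := by
    simp only [expU, Units.val_mk0, mul_sub, mul_one, ← Complex.exp_add]
    congr 2
    push_cast
    ring
  rw [this, norm_mul, norm_expU, one_mul]

theorem norm_expU_sub_le (k k₀ : ℝ) : ‖(expU k : ℂ) - expU k₀‖ ≤ |k - k₀| := by
  rw [norm_expU_sub]
  exact Real.norm_exp_I_mul_ofReal_sub_one_le

theorem le_norm_expU_sub {k k₀ : ℝ} (h : |k - k₀| ≤ 1) :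
    1 / 2 * |k - k₀| ≤ ‖(expU k : ℂ) - expU k₀‖ := by
  rw [norm_expU_sub, Complex.norm_exp_I_mul_ofReal_sub_one, norm_mul, Real.norm_eq_abs,
    Real.norm_eq_abs, abs_two]
  have hpi := Real.pi_gt_three
  have hpi' := Real.pi_le_four
  have h2 : |(k - k₀) / 2| = |k - k₀| / 2 := by rw [abs_div, abs_two]
  have := Real.mul_abs_le_abs_sin (x := (k - k₀) / 2) (by rw [h2]; linarith)
  rw [h2] at this
  have h3 : 2 / Real.pi * (|k - k₀| / 2) ≥ 1 / 2 * (|k - k₀| / 2) := by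
    have : (1 / 2 : ℝ) ≤ 2 / Real.pi := by
      rw [le_div_iff₀ Real.pi_pos]
      linarith
    gcongr
  linarith

theorem exists_expU_eq {z : ℂ} (hz : ‖z‖ = 1) : ∃ k : ℝ, (expU k : ℂ) = z := by
  refine ⟨z.arg, ?_⟩
  rw [expU, Units.val_mk0, mul_comm]
  conv_rhs => rw [← Complex.norm_mul_exp_arg_mul_I z, hz]
  simp

/-- A zero on the unit circle is simple iff the function vanishes linearly there. -/
theorem simpleCirc_iff_gap (p : ℝ[T;T⁻¹]) :
    SimpleCirc p ↔ ∀ k₀ : ℝ, ∃ C : ℝ, 0 < C ∧ ∀ᶠ k in 𝓝 k₀, C * |k - k₀| ≤ ‖lval (expU k) p‖ := by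
  set P := (numer p).map (algebraMap ℝ ℂ) with hP
  have hval : ∀ k, ‖lval (expU k) p‖ = ‖P.eval (expU k : ℂ)‖ := fun k => by
    rw [← lval_mul_pow (toLaurent_numer p), norm_mul, norm_pow, norm_expU, one_pow, mul_one]
  have hclose : ∀ k₀ : ℝ, ∀ᶠ k in 𝓝 k₀, |k - k₀| ≤ 1 := fun k₀ => by
    filter_upwards [Metric.closedBall_mem_nhds k₀ one_pos] with k hk
    simpa [Real.dist_eq] using hk
  have hcont : Continuous fun k => (expU k : ℂ) := by
    simp only [expU, Units.val_mk0]; fun_prop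
  by_cases hp : p = 0
  · subst hp
    refine iff_of_false (fun h => h.1 rfl) fun h => ?_
    obtain ⟨C, hC, hev⟩ := h 0
    have hev' : ∀ᶠ k in 𝓝[≠] (0 : ℝ), C * |k - 0| ≤ ‖lval (expU k) 0‖ := hev.filter_mono
      nhdsWithin_le_nhds
    obtain ⟨k, hk, hk'⟩ := (hev'.and self_mem_nhdsWithin).exists
    rw [map_zero, norm_zero, sub_zero] at hk
    have : 0 < |k| := abs_pos.mpr hk'
    nlinarith
  have hP0 : P ≠ 0 := map_numer_ne_zero hp
  -- near `k₀` the Laurent polynomial behaves like the power of the distance given by the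
  -- multiplicity of the zero
  have hfac : ∀ k₀ : ℝ, ∃ Q : ℂ[X], Q.eval (expU k₀ : ℂ) ≠ 0 ∧ ∀ k, ‖lval (expU k) p‖ =
      ‖(expU k : ℂ) - expU k₀‖ ^ (P.rootMultiplicity (expU k₀ : ℂ)) * ‖Q.eval (expU k : ℂ)‖ := by
    intro k₀
    obtain ⟨Q, hQ, hQ'⟩ :=
      Polynomial.exists_eq_pow_rootMultiplicity_mul_and_not_dvd P hP0 (expU k₀ : ℂ)
    refine ⟨Q, fun h => hQ' (Polynomial.dvd_iff_isRoot.mpr h), fun k => ?_⟩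
    have he : P.eval (expU k : ℂ) = ((expU k : ℂ) - expU k₀) ^ P.rootMultiplicity (expU k₀ : ℂ)
        * Q.eval (expU k : ℂ) := by
      conv_lhs => rw [hQ]
      simp
    rw [hval, he, norm_mul, norm_pow]
  constructor
  · intro h k₀
    obtain ⟨Q, hQ, hfac⟩ := hfac k₀
    set δ := ‖Q.eval (expU k₀ : ℂ)‖ with hδ
    have hδ0 : 0 < δ := norm_pos_iff.mpr hQ
    have hQc : ∀ᶠ k in 𝓝 k₀, δ / 2 < ‖Q.eval (expU k : ℂ)‖ := by
      have : Continuous fun k => ‖Q.eval (expU k : ℂ)‖ := (Q.continuous.comp hcont).norm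
      exact this.continuousAt.eventually (lt_mem_nhds (half_lt_self hδ0))
    refine ⟨δ / 4, by positivity, ?_⟩
    filter_upwards [hQc, hclose k₀] with k hk hk1
    rw [hfac]
    have hr := h.2 (expU k₀ : ℂ) (norm_expU k₀)
    have hlow : 1 / 2 * |k - k₀| ≤ ‖(expU k : ℂ) - expU k₀‖ ^ (P.rootMultiplicity (expU k₀ : ℂ)) := by
      interval_cases hr' : P.rootMultiplicity (expU k₀ : ℂ)
      · rw [pow_zero]; linarith
      · rw [pow_one]; exact le_norm_expU_sub hk1
    calc δ / 4 * |k - k₀| = (1 / 2 * |k - k₀|) * (δ / 2) := by ring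
      _ ≤ _ := by gcongr
  · intro h
    refine ⟨hp, fun z hz => ?_⟩
    obtain ⟨k₀, rfl⟩ := exists_expU_eq hz
    obtain ⟨C, hC, hev⟩ := h k₀
    obtain ⟨Q, hQ, hfac⟩ := hfac k₀
    by_contra hr
    set r := P.rootMultiplicity (expU k₀ : ℂ) with hr_def
    have hr : 2 ≤ r := by change ¬ r ≤ 1 at hr; omega
    set δ := ‖Q.eval (expU k₀ : ℂ)‖ with hδ
    have hQc : ∀ᶠ k in 𝓝 k₀, ‖Q.eval (expU k : ℂ)‖ < δ + 1 := by
      have : Continuous fun k => ‖Q.eval (expU k : ℂ)‖ := (Q.continuous.comp hcont).norm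
      exact this.continuousAt.eventually (gt_mem_nhds (lt_add_one δ))
    have hsmall : ∀ᶠ k in 𝓝 k₀, |k - k₀| * (δ + 1) < C := by
      have : Continuous fun k => |k - k₀| * (δ + 1) := by fun_prop
      exact this.continuousAt.eventually (gt_mem_nhds (by simpa using hC))
    have hall := ((hev.and (hQc.and (hsmall.and (hclose k₀)))).filter_mono
      (nhdsWithin_le_nhds (s := {k₀}ᶜ))).and self_mem_nhdsWithin
    obtain ⟨k, ⟨h1, h2, h3, h4⟩, hk⟩ := hall.exists
    have hpos : 0 < |k - k₀| := abs_pos.mpr (sub_ne_zero.mpr hk)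
    rw [hfac] at h1
    have h5 : ‖(expU k : ℂ) - expU k₀‖ ^ r ≤ |k - k₀| ^ 2 :=
      (pow_le_pow_left₀ (norm_nonneg _) (norm_expU_sub_le k k₀) r).trans
        (pow_le_pow_of_le_one hpos.le h4 hr)
    have h6 : C * |k - k₀| ≤ |k - k₀| ^ 2 * (δ + 1) :=
      h1.trans (mul_le_mul h5 h2.le (norm_nonneg _) (by positivity))
    nlinarith

theorem linearGap_diagonal {ι : Type*} [Fintype ι] [DecidableEq ι] (d : ι → ℝ[T;T⁻¹]) :
    LinearGap (symbol (Matrix.diagonal d)) ↔ ∀ i, SimpleCirc (d i) := by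
  have hmul : ∀ k (v : ι → ℂ) i,
      (Matrix.mulVec (symbol (Matrix.diagonal d) k) v) i = lval (expU k) (d i) * v i := by
    intro k v i
    have : symbol (Matrix.diagonal d) k = Matrix.diagonal fun i => lval (expU k) (d i) := by
      rw [symbol, RingHom.mapMatrix_apply, Matrix.diagonal_map (map_zero _)]
    rw [this, Matrix.mulVec_diagonal]
  simp only [simpleCirc_iff_gap]
  constructor
  · intro h i k₀
    obtain ⟨C, hC, hev⟩ := h k₀
    refine ⟨C, hC, ?_⟩
    filter_upwards [hev] with k hk
    have := hk (Pi.single i 1)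
    rw [Pi.norm_single, norm_one, mul_one] at this
    refine this.trans ((pi_norm_le_iff_of_nonneg (norm_nonneg _)).mpr fun j => ?_)
    rw [hmul]
    by_cases hj : j = i
    · subst hj; simp
    · rw [Pi.single_eq_of_ne hj]; simp
  · intro h k₀
    choose C hC hev using fun j => h j k₀
    obtain ⟨c, hc, hcC⟩ : ∃ c > 0, ∀ j, c ≤ C j := by
      rcases isEmpty_or_nonempty ι with ho | ho
      · exact ⟨1, one_pos, fun j => ho.elim j⟩
      · obtain ⟨j₀, hj₀⟩ := Finite.exists_min C
        exact ⟨C j₀, hC j₀, hj₀⟩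
    refine ⟨c, hc, ?_⟩
    filter_upwards [eventually_all.mpr hev] with k hk v
    rw [← Real.norm_of_nonneg (mul_nonneg hc.le (abs_nonneg (k - k₀))), ← norm_smul]
    refine (pi_norm_le_iff_of_nonneg (norm_nonneg _)).mpr fun i => ?_
    rw [Pi.smul_apply, norm_smul, Real.norm_of_nonneg (mul_nonneg hc.le (abs_nonneg (k - k₀)))]
    refine le_trans ?_ (norm_le_pi_norm _ i)
    rw [hmul, norm_mul]
    gcongr
    exact (mul_le_mul_of_nonneg_right (hcC i) (abs_nonneg _)).trans (hk i)

end Scalar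

/-! ### Counting roots by their modulus -/

section RootCount
open Polynomial

/-- The number of roots, with multiplicity, whose absolute value satisfies `p`. -/
noncomputable def rootCount (p : ℝ → Prop) [DecidablePred p] (P : ℂ[X]) : ℕ :=
  (P.roots.filter fun z => p ‖z‖).card

variable (p : ℝ → Prop) [DecidablePred p]

theorem rootCount_mul {P Q : ℂ[X]} (hP : P ≠ 0) (hQ : Q ≠ 0) :
    rootCount p (P * Q) = rootCount p P + rootCount p Q := by
  rw [rootCount, roots_mul (mul_ne_zero hP hQ), Multiset.filter_add, Multiset.card_add]
  rfl

theorem rootCount_prod {ι : Type*} (s : Finset ι) {P : ι → ℂ[X]} (hP : ∀ i ∈ s, P i ≠ 0) :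
    rootCount p (∏ i ∈ s, P i) = ∑ i ∈ s, rootCount p (P i) := by
  classical
  induction s using Finset.induction_on with
  | empty => simp [rootCount]
  | insert a s ha ih =>
    rw [Finset.prod_insert ha, Finset.sum_insert ha, rootCount_mul, ih]
    · exact fun i hi => hP i (Finset.mem_insert_of_mem hi)
    · exact hP a (Finset.mem_insert_self _ _)
    · exact Finset.prod_ne_zero_iff.mpr fun i hi => hP i (Finset.mem_insert_of_mem hi)

theorem rootCount_C (c : ℂ) : rootCount p (C c) = 0 := by simp [rootCount]

/-- The count of roots whose modulus satisfies `p` when all roots have the same modulus. -/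
theorem rootCount_of_forall {P : ℂ[X]} {r : ℝ} (h : ∀ z, P.IsRoot z → ‖z‖ = r) :
    rootCount p P = if p r then P.natDegree else 0 := by
  have hcard := (IsAlgClosed.splits P).natDegree_eq_card_roots
  split_ifs with hp
  · rw [rootCount, Multiset.filter_eq_self.mpr, hcard]
    intro z hz
    rwa [h z (mem_roots'.mp hz).2]
  · rw [rootCount, Multiset.filter_eq_nil.mpr, Multiset.card_zero]
    intro z hz
    rwa [h z (mem_roots'.mp hz).2]

theorem rootCount_X_sub_C (a : ℂ) : rootCount p (X - C a) = if p ‖a‖ then 1 else 0 := by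
  rw [rootCount_of_forall p (r := ‖a‖), natDegree_X_sub_C]
  intro z hz
  rw [root_X_sub_C] at hz
  rw [hz]

/-- Induction over the factorization of a nonzero complex polynomial into linear factors. -/
theorem induction_linear_factors {motive : ℂ[X] → Prop} (P : ℂ[X]) (hP : P ≠ 0)
    (hC : ∀ c, c ≠ 0 → motive (C c))
    (hX : ∀ a P, P ≠ 0 → motive P → motive ((X - C a) * P)) : motive P := by
  have h := (IsAlgClosed.splits P).eq_prod_roots
  rw [h]
  have hlc : P.leadingCoeff ≠ 0 := leadingCoeff_ne_zero.mpr hP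
  induction P.roots using Multiset.induction_on with
  | empty => simpa using hC _ hlc
  | cons a s ih =>
    rw [Multiset.map_cons, Multiset.prod_cons, mul_left_comm]
    refine hX a _ (mul_ne_zero (C_ne_zero.mpr hlc) ?_) ih
    refine Multiset.prod_ne_zero fun h0 => ?_
    obtain ⟨b, -, hb⟩ := Multiset.mem_map.mp h0
    exact X_sub_C_ne_zero b hb

/-- Taking `k`-th roots of the argument multiplies every count of zeros by `k`. -/
theorem rootCount_expand {k : ℕ} (hk : 0 < k) (hp : ∀ r, 0 ≤ r → (p (r ^ k) ↔ p r)) {P : ℂ[X]}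
    (hP : P ≠ 0) : rootCount p (expand ℂ k P) = k * rootCount p P := by
  refine induction_linear_factors
    (motive := fun P => rootCount p (expand ℂ k P) = k * rootCount p P) P hP ?_ ?_
  · intro c hc
    simp [rootCount_C]
  · intro a P hP ih
    have h1 : expand ℂ k (X - C a) ≠ 0 := (expand_ne_zero hk).mpr (X_sub_C_ne_zero a)
    rw [map_mul, rootCount_mul p h1 ((expand_ne_zero hk).mpr hP),
      rootCount_mul p (X_sub_C_ne_zero a) hP, ih, mul_add, rootCount_X_sub_C]
    congr 1
    obtain ⟨r, hr⟩ : ∃ r : ℝ, r = ‖a‖ ^ (1 / k : ℝ) := ⟨_, rfl⟩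
    have hr0 : 0 ≤ r := hr ▸ by positivity
    have hrk : r ^ k = ‖a‖ := by
      rw [hr, ← Real.rpow_natCast, ← Real.rpow_mul (norm_nonneg _)]
      field_simp
      simp
    rw [rootCount_of_forall p (r := r), natDegree_expand, natDegree_X_sub_C, ← hrk]
    · simp only [hp r hr0]
      split_ifs <;> simp
    · intro z hz
      rw [IsRoot, expand_eval, eval_sub, eval_X, eval_C, sub_eq_zero] at hz
      rw [← hz, norm_pow] at hrk
      exact ((pow_left_inj₀ hr0 (norm_nonneg z) hk.ne').mp hrk).symm

theorem rootCount_comp_C_mul_X {ζ : ℂ} (hζ : ‖ζ‖ = 1) {P : ℂ[X]} (hP : P ≠ 0) :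
    P.comp (C ζ * X) ≠ 0 ∧ rootCount p (P.comp (C ζ * X)) = rootCount p P := by
  have hζ0 : ζ ≠ 0 := by rintro rfl; simp at hζ
  refine induction_linear_factors (motive := fun P => P.comp (C ζ * X) ≠ 0 ∧
    rootCount p (P.comp (C ζ * X)) = rootCount p P) P hP ?_ ?_
  · intro c hc
    simp [hc]
  · intro a P hP ih
    have h1 : (X - C a).comp (C ζ * X) = C ζ * (X - C (ζ⁻¹ * a)) := by
      rw [sub_comp, X_comp, C_comp, mul_sub, ← C_mul, mul_inv_cancel_left₀ hζ0]
    have h2 : (X - C a).comp (C ζ * X) ≠ 0 := by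
      rw [h1]
      exact mul_ne_zero (C_ne_zero.mpr hζ0) (X_sub_C_ne_zero _)
    rw [mul_comp]
    refine ⟨mul_ne_zero h2 ih.1, ?_⟩
    rw [rootCount_mul p h2 ih.1, rootCount_mul p (X_sub_C_ne_zero a) hP, ih.2, h1,
      rootCount_mul p (C_ne_zero.mpr hζ0) (X_sub_C_ne_zero _), rootCount_C, rootCount_X_sub_C,
      rootCount_X_sub_C, norm_mul, norm_inv, hζ, inv_one, one_mul, zero_add]

end RootCount

section Momentum

theorem LinearGap.comp_affine {ι : Type*} [Fintype ι] {G : ℝ → Matrix ι ι ℂ} (h : LinearGap G)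
    {a : ℝ} (ha : a ≠ 0) (b : ℝ) : LinearGap fun k => G (a * k + b) := by
  intro k₀
  obtain ⟨C, hC, hev⟩ := h (a * k₀ + b)
  have ha' : 0 < |a| := abs_pos.mpr ha
  refine ⟨C * |a|, by positivity, ?_⟩
  have hcont : ContinuousAt (fun k : ℝ => a * k + b) k₀ := by fun_prop
  filter_upwards [hcont.eventually hev] with k hk v
  have := hk v
  rw [show a * k + b - (a * k₀ + b) = a * (k - k₀) by ring, abs_mul, ← mul_assoc] at this
  exact this

end Momentum

/-! ### Enlarging the unit cell -/

section Recell
open Matrix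
open scoped Kronecker

/-- A sum over all integers, sorted by residue classes. -/
theorem sum_finsum_add_mul {k : ℕ} (hk : 0 < k) {g : ℤ → ℂ} (hg : (Function.support g).Finite) :
    ∑ q : Fin k, ∑ᶠ α : ℤ, g ((q : ℕ) + k * α) = ∑ᶠ β, g β := by
  have : NeZero k := ⟨hk.ne'⟩
  set e : Fin k × ℤ ≃ ℤ := (Equiv.prodComm _ _).trans (Int.divModEquiv k).symm with he
  have hval : ∀ x : Fin k × ℤ, e x = ((x.1 : ℕ) : ℤ) + k * x.2 := by
    intro x
    simp only [he, Equiv.trans_apply, Equiv.prodComm_apply, Int.divModEquiv_symm_apply,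
      Prod.fst_swap, Prod.snd_swap]
    ring
  have hfin : (Function.support fun x : Fin k × ℤ => g (e x)).Finite :=
    hg.preimage e.injective.injOn
  rw [← finsum_comp_equiv e, finsum_curry _ hfin, finsum_eq_sum_of_fintype]
  simp only [hval]

/-- The nodes `z * ζ ^ j`, for the `k`-th roots of unity `ζ ^ j`. -/
noncomputable def node (k : ℕ) (z : ℂˣ) (j : Fin k) : ℂˣ := z * expU (2 * Real.pi * j / k)

theorem node_pow {k : ℕ} (hk : 0 < k) (z : ℂˣ) (j : Fin k) : node k z j ^ k = z ^ k := by
  have h : expU (2 * Real.pi * j / k) ^ k = 1 := by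
    ext
    rw [Units.val_pow_eq_pow_val, expU, Units.val_mk0, ← Complex.exp_nat_mul, Units.val_one]
    have hk' : (k : ℂ) ≠ 0 := by exact_mod_cast hk.ne'
    rw [Complex.exp_eq_one_iff]
    refine ⟨j, ?_⟩
    push_cast
    field_simp
  rw [node, mul_pow, h, mul_one]

theorem node_injective {k : ℕ} (hk : 0 < k) (z : ℂˣ) :
    Function.Injective fun j => (node k z j : ℂ) := by
  intro i j hij
  have h := mul_left_cancel (Units.ext hij : node k z i = node k z j)
  have h' := congrArg Units.val h
  simp only [expU, Units.val_mk0, Complex.exp_eq_exp_iff_exists_int] at h'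
  obtain ⟨n, hn⟩ := h'
  have hk' : (k : ℂ) ≠ 0 := by exact_mod_cast hk.ne'
  have hpi : (Real.pi : ℂ) ≠ 0 := by exact_mod_cast Real.pi_ne_zero
  have hI := Complex.I_ne_zero
  push_cast at hn
  have h2 : ((i : ℕ) : ℂ) = (j : ℕ) + n * k := by
    field_simp at hn
    linear_combination hn
  have h3 : ((i : ℕ) : ℤ) = (j : ℕ) + n * k := by exact_mod_cast h2
  have hi := i.2
  have hj := j.2
  have h4 : n = 0 := by
    by_contra hn0
    rcases lt_or_gt_of_ne hn0 with hlt | hgt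
    · nlinarith
    · nlinarith
  ext
  rw [h4] at h3
  omega

variable (X : BDIChain) {k : ℕ} (hk : 0 < k)

/-- The sites of the `k`-fold unit cell, labeled by the small cells inside it and their sites. -/
def cellEquiv : Fin k × Fin X.cell ≃ Fin (X.recell k hk).cell := finProdFinEquiv

theorem cellEquiv_val (x : Fin k × Fin X.cell) :
    ((X.cellEquiv hk x : ℕ) : ℤ) = (x.2 : ℕ) + X.cell * (x.1 : ℕ) := by
  exact_mod_cast finProdFinEquiv_apply_val x

/-- The matrix `F(w)` of the chain with a `k`-fold unit cell, its rows and columns labeled by the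
pairs of a small cell inside the large one and a site of the small cell. -/
noncomputable def recellMat (w : ℂˣ) : Matrix (Fin k × Fin X.cell) (Fin k × Fin X.cell) ℂ :=
  ((lval w).mapMatrix (X.recell k hk).lmat).submatrix (X.cellEquiv hk) (X.cellEquiv hk)

/-- The matrix whose columns are the plane waves with the momenta `node k z j`. -/
noncomputable def waves (k N : ℕ) (z : ℂˣ) : Matrix (Fin k × Fin N) (Fin k × Fin N) ℂ :=
  (vandermonde fun j => (node k z j : ℂ))ᵀ ⊗ₖ 1

/-- The block diagonal matrix of the `F(node k z j)`. -/
noncomputable def nodeBlocks (k : ℕ) (z : ℂˣ) : Matrix (Fin k × Fin X.cell) (Fin k × Fin X.cell) ℂ :=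
  Matrix.reindex (Equiv.prodComm _ _) (Equiv.prodComm _ _)
    (blockDiagonal fun j => (lval (node k z j)).mapMatrix X.lmat)

/-- A plane wave of momentum `y` with `y ^ k = w` is mapped by the enlarged matrix at `w` to a plane
wave, with amplitudes transformed by `F y`. -/
theorem recellMat_mul_waves (z : ℂˣ) :
    X.recellMat hk (z ^ k) * waves k X.cell z = waves k X.cell z * X.nodeBlocks k z := by
  ext ⟨p, a⟩ ⟨j, b⟩
  set y := node k z j with hy
  have hyk : y ^ k = z ^ k := node_pow hk z j
  have hR : (waves k X.cell z * X.nodeBlocks k z) (p, a) (j, b)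
      = (y : ℂ) ^ (p : ℕ) * lval y (X.lmat a b) := by
    rw [mul_apply, Fintype.sum_prod_type, Finset.sum_eq_single j, Finset.sum_eq_single a]
    · simp [waves, nodeBlocks, blockDiagonal_apply, vandermonde, hy]
    · intro c _ hc
      simp [waves, one_apply, Ne.symm hc]
    · simp
    · intro i _ hi
      refine Finset.sum_eq_zero fun c _ => ?_
      simp [nodeBlocks, blockDiagonal_apply, hi]
    · simp
  have hL : (X.recellMat hk (z ^ k) * waves k X.cell z) (p, a) (j, b)
      = ∑ q : Fin k, X.recellMat hk (z ^ k) (p, a) (q, b) * (y : ℂ) ^ (q : ℕ) := by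
    rw [mul_apply, Fintype.sum_prod_type]
    refine Finset.sum_congr rfl fun q _ => ?_
    rw [Finset.sum_eq_single b]
    · simp [waves, vandermonde, hy]
    · intro c _ hc
      simp [waves, one_apply, hc]
    · simp
  rw [hL, hR]
  set g : ℤ → ℂ := fun β => ((X.lmat a b).coeff (β - (p : ℕ)) : ℂ) * (y : ℂ) ^ β with hg
  have hgs : (Function.support g).Finite := by
    refine (((X.lmat a b).coeff.support.finite_toSet).preimage
      (f := fun β : ℤ => β - (p : ℕ)) (sub_left_injective.injOn)).subset ?_
    intro β hβ
    simp only [Set.mem_preimage, Finset.mem_coe, Finsupp.mem_support_iff]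
    intro h0
    exact hβ (by simp [hg, h0])
  have hsum := sum_finsum_add_mul hk hgs
  have hright : ∑ᶠ β, g β = (y : ℂ) ^ (p : ℕ) * lval y (X.lmat a b) := by
    rw [lval_eq_finsum, mul_finsum,
      ← finsum_comp_equiv (Equiv.addRight ((p : ℕ) : ℤ))]
    refine finsum_congr fun α => ?_
    simp only [hg, Equiv.coe_addRight, add_sub_cancel_right]
    rw [zpow_add₀ y.ne_zero, zpow_natCast]
    ring
  rw [← hright, ← hsum]
  refine Finset.sum_congr rfl fun q _ => ?_
  rw [recellMat, submatrix_apply, RingHom.mapMatrix_apply, map_apply, lval_eq_finsum,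
    finsum_mul]
  refine finsum_congr fun α => ?_
  have hpow : (((z ^ k : ℂˣ) : ℂ)) ^ α * (y : ℂ) ^ (q : ℕ) = (y : ℂ) ^ (((q : ℕ) : ℤ) + k * α) := by
    rw [zpow_add₀ y.ne_zero, zpow_natCast, _root_.zpow_mul, zpow_natCast, ← Units.val_pow_eq_pow_val y k, hyk,
      mul_comm]
  rw [mul_assoc, hpow]
  simp only [hg]
  congr 2
  rw [coeff_lmat, coeff_lmat]
  change X.hop _ (_ + ((k * X.cell : ℕ) : ℤ) * α) = _
  rw [← X.hop_add_mul (a : ℕ) _ (p : ℕ), cellEquiv_val, cellEquiv_val]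
  congr 1
  · push_cast; ring

/-- The plane waves are linearly independent, by the Vandermonde determinant. -/
theorem det_waves_ne_zero {k : ℕ} (hk : 0 < k) (N : ℕ) (z : ℂˣ) : (waves k N z).det ≠ 0 := by
  rw [waves, det_kronecker, det_one, one_pow, mul_one, det_transpose]
  exact pow_ne_zero _ (det_vandermonde_ne_zero_iff.mpr (node_injective hk z))

/-- Enlarging the unit cell by a factor `k` replaces `f(z)` by the product of `f` over the `k`-th roots. -/
theorem lval_det_recell (z : ℂˣ) :
    lval (z ^ k) (X.recell k hk).lmat.det = ∏ j, lval (node k z j) X.lmat.det := by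
  have h := congrArg det (X.recellMat_mul_waves hk z)
  rw [det_mul, det_mul, mul_comm] at h
  have h' := mul_left_cancel₀ (det_waves_ne_zero hk X.cell z) h
  rw [recellMat, det_submatrix_equiv_self, nodeBlocks, reindex_apply, det_submatrix_equiv_self,
    det_blockDiagonal] at h'
  simp only [← RingHom.map_det] at h'
  exact h'

/-- `lval_det_recell` as an identity of polynomials. -/
theorem expand_numer_recell :
    ∃ c : ℂ, c ≠ 0 ∧ Polynomial.expand ℂ k ((numer (X.recell k hk).lmat.det).map (algebraMap ℝ ℂ))
        * (.X ^ (k * den X.lmat.det) * .C c)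
      = (∏ j : Fin k, ((numer X.lmat.det).map (algebraMap ℝ ℂ)).comp
          (.C (expU (2 * Real.pi * j / k) : ℂ) * .X)) *
          .X ^ (k * den (X.recell k hk).lmat.det) := by
  refine ⟨∏ j : Fin k, (expU (2 * Real.pi * j / k) : ℂ) ^ den X.lmat.det,
    Finset.prod_ne_zero_iff.mpr fun j _ => pow_ne_zero _ (Units.ne_zero _), ?_⟩
  refine Polynomial.eq_of_infinite_eval_eq _ _ ((Set.finite_singleton (0 : ℂ)).infinite_compl.mono ?_)
  intro z hz
  have hz : z ≠ 0 := hz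
  set u : ℂˣ := Units.mk0 z hz with hu
  have huz : (u : ℂ) = z := rfl
  have h1 := lval_mul_pow (toLaurent_numer (X.recell k hk).lmat.det) (u ^ k)
  have h2 := fun j : Fin k => lval_mul_pow (toLaurent_numer X.lmat.det) (node k u j)
  rw [lval_det_recell, Units.val_pow_eq_pow_val, huz] at h1
  change Polynomial.eval z _ = Polynomial.eval z _
  simp only [Polynomial.eval_mul, Polynomial.expand_eval, Polynomial.eval_pow, Polynomial.eval_X,
    Polynomial.eval_C, Polynomial.eval_prod, Polynomial.eval_comp]
  have h3 : ∀ j : Fin k, (expU (2 * Real.pi * j / k) : ℂ) * z = (node k u j : ℂ) := fun j => by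
    rw [node, Units.val_mul, huz, mul_comm]
  simp only [h3, ← h1, ← h2]
  rw [Finset.prod_mul_distrib]
  have h4 : ∏ j : Fin k, (node k u j : ℂ) ^ den X.lmat.det =
      z ^ (k * den X.lmat.det) * ∏ j : Fin k, (expU (2 * Real.pi * j / k) : ℂ) ^ den X.lmat.det := by
    simp only [← h3, mul_pow, Finset.prod_mul_distrib, Finset.prod_const, Finset.card_univ,
      Fintype.card_fin]
    rw [← pow_mul, mul_comm k, mul_comm]
  rw [h4, ← pow_mul]
  ring

theorem numer_map_eq_zero_iff (p : ℝ[T;T⁻¹]) : (numer p).map (algebraMap ℝ ℂ) = 0 ↔ p = 0 := by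
  refine ⟨fun h => by_contra fun hp => map_numer_ne_zero hp h, ?_⟩
  rintro rfl
  have h := toLaurent_numer 0
  rw [zero_mul, Polynomial.toLaurent_eq_zero] at h
  rw [h, Polynomial.map_zero]

theorem det_recell_eq_zero_iff : (X.recell k hk).lmat.det = 0 ↔ X.lmat.det = 0 := by
  obtain ⟨c, hc, h⟩ := X.expand_numer_recell hk
  have hX : ∀ n : ℕ, (Polynomial.X ^ n : ℂ[X]) ≠ 0 := fun n => pow_ne_zero _ Polynomial.X_ne_zero
  rw [← numer_map_eq_zero_iff, ← numer_map_eq_zero_iff X.lmat.det]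
  constructor
  · intro h0
    rw [h0, map_zero, zero_mul] at h
    obtain ⟨j, -, hj⟩ := Finset.prod_eq_zero_iff.mp ((mul_eq_zero.mp h.symm).resolve_right (hX _))
    by_contra hne
    exact (rootCount_comp_C_mul_X (· = 1) (norm_expU (2 * Real.pi * j / k)) hne).1 hj
  · intro h0
    have hz : ∏ j : Fin k, ((numer X.lmat.det).map (algebraMap ℝ ℂ)).comp
        (.C (expU (2 * Real.pi * j / k) : ℂ) * .X) = 0 :=
      Finset.prod_eq_zero (Finset.mem_univ ⟨0, hk⟩) (by rw [h0, Polynomial.zero_comp])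
    rw [hz, zero_mul] at h
    have := (mul_eq_zero.mp h).resolve_right
      (mul_ne_zero (hX _) (Polynomial.C_ne_zero.mpr hc))
    exact (Polynomial.expand_eq_zero hk).mp this

theorem rootCount_recell (p : ℝ → Prop) [DecidablePred p] (hp : ∀ r, 0 ≤ r → (p (r ^ k) ↔ p r))
    (h0 : X.lmat.det ≠ 0) :
    k * rootCount p ((numer (X.recell k hk).lmat.det).map (algebraMap ℝ ℂ)) +
        rootCount p (.X ^ (k * den X.lmat.det)) =
      k * rootCount p ((numer X.lmat.det).map (algebraMap ℝ ℂ)) +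
        rootCount p (.X ^ (k * den (X.recell k hk).lmat.det)) := by
  have h0' := (X.det_recell_eq_zero_iff hk).not.mpr h0
  obtain ⟨c, hc, h⟩ := X.expand_numer_recell hk
  have h1 := congrArg (rootCount p) h
  have hcomp := fun j : Fin k => rootCount_comp_C_mul_X p (norm_expU (2 * Real.pi * j / k))
    (map_numer_ne_zero h0)
  have hexp := (Polynomial.expand_ne_zero hk).mpr (map_numer_ne_zero h0')
  have hC : (Polynomial.C c : ℂ[X]) ≠ 0 := Polynomial.C_ne_zero.mpr hc
  have hX : ∀ n : ℕ, (Polynomial.X ^ n : ℂ[X]) ≠ 0 := fun n => pow_ne_zero _ Polynomial.X_ne_zero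
  rw [rootCount_mul p hexp (mul_ne_zero (hX _) hC), rootCount_mul p (hX _) hC, rootCount_C,
    rootCount_expand p hk hp (map_numer_ne_zero h0'),
    rootCount_mul p (Finset.prod_ne_zero_iff.mpr fun j _ => (hcomp j).1) (hX _),
    rootCount_prod p _ fun j _ => (hcomp j).1] at h1
  simp only [(hcomp _).2, Finset.sum_const, Finset.card_univ, Fintype.card_fin, smul_eq_mul] at h1
  exact h1

theorem circ_recell : circ (X.recell k hk).lmat.det = circ X.lmat.det := by
  by_cases h0 : X.lmat.det = 0
  · rw [h0, (X.det_recell_eq_zero_iff hk).mpr h0]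
  have h := X.rootCount_recell hk (· = 1) (fun r hr => by
    rw [pow_eq_one_iff_of_nonneg hr hk.ne']) h0
  change k * circ _ + circCount _ = k * circ _ + circCount _ at h
  rw [circCount_X_pow, circCount_X_pow] at h
  exact Nat.eq_of_mul_eq_mul_left hk h

theorem ind_recell : ind (X.recell k hk).lmat.det = ind X.lmat.det := by
  by_cases h0 : X.lmat.det = 0
  · rw [h0, (X.det_recell_eq_zero_iff hk).mpr h0]
  have h0' := (X.det_recell_eq_zero_iff hk).not.mpr h0
  have h := X.rootCount_recell hk (· < 1) (fun r hr => pow_lt_one_iff_of_nonneg hr hk.ne') h0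
  change k * inCount _ + inCount _ = k * inCount _ + inCount _ at h
  rw [inCount_X_pow, inCount_X_pow, ← mul_add, ← mul_add] at h
  have := Nat.eq_of_mul_eq_mul_left hk h
  rw [ind, ind, if_neg h0, if_neg h0']
  omega

/-- The CFT condition does not depend on the unit cell: conjugation with the matrix of plane waves turns
the enlarged matrix into a direct sum of copies of `F` with shifted momenta. -/
theorem isCFT_recell : (X.recell k hk).IsCFT ↔ X.IsCFT := by
  have hk0 : (k : ℝ) ≠ 0 := by exact_mod_cast hk.ne'
  have hexp : ∀ (x : ℝ), expU x ^ k = expU (k * x) := fun x => by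
    ext
    simp only [expU, Units.val_pow_eq_pow_val, Units.val_mk0]
    rw [← Complex.exp_nat_mul]
    congr 1
    push_cast
    ring
  have hnode : ∀ x j, node k (expU x) j = expU (x + 2 * Real.pi * j / k) := fun x j => by
    ext
    simp only [node, expU, Units.val_mul, Units.val_mk0]
    rw [← Complex.exp_add]
    congr 1
    push_cast
    ring
  have hnc : ∀ j : Fin k, Continuous fun x => (node k (expU x) j : ℂ) := fun j => by
    simp only [hnode]
    simp only [expU, Units.val_mk0]
    fun_prop
  have hWc : Continuous fun x => waves k X.cell (expU x) := by
    refine continuous_matrix fun i j => ?_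
    simp only [waves, kroneckerMap_apply, transpose_apply, vandermonde_apply]
    exact ((hnc j.1).pow _).mul continuous_const
  have hWi : Continuous fun x => (waves k X.cell (expU x))⁻¹ := by
    have : (fun x => (waves k X.cell (expU x))⁻¹) = fun x =>
        (waves k X.cell (expU x)).det⁻¹ • (waves k X.cell (expU x)).adjugate := by
      funext x
      rw [inv_def, Ring.inverse_eq_inv']
    rw [this]
    exact (hWc.matrix_det.inv₀ fun x => det_waves_ne_zero hk _ _).smul hWc.matrix_adjugate
  have hent : ∀ {A : ℝ → Matrix (Fin k × Fin X.cell) (Fin k × Fin X.cell) ℂ}, Continuous A →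
      ∀ i j, Continuous fun x => A x i j := fun hA i j => (hA.matrix_elem i j)
  have hWW : ∀ x, (waves k X.cell (expU x))⁻¹ * waves k X.cell (expU x) = 1 := fun x =>
    nonsing_inv_mul _ (det_waves_ne_zero hk _ _).isUnit
  have hWW' : ∀ x, waves k X.cell (expU x) * (waves k X.cell (expU x))⁻¹ = 1 := fun x =>
    mul_nonsing_inv _ (det_waves_ne_zero hk _ _).isUnit
  have hmul := fun x => X.recellMat_mul_waves hk (expU x)
  rw [isCFT_iff, isCFT_iff]
  have step1 : LinearGap (fun x => (lval (expU x)).mapMatrix (X.recell k hk).lmat) ↔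
      LinearGap fun x => X.recellMat hk (expU x ^ k) := by
    constructor
    · intro h
      have := (h.comp_affine hk0 0).reindex (X.cellEquiv hk).symm
      simp only [hexp]
      simp only [add_zero] at this
      exact this
    · intro h
      have := (h.comp_affine (inv_ne_zero hk0) 0).reindex (X.cellEquiv hk)
      simp only [hexp, add_zero, mul_inv_cancel_left₀ hk0, recellMat, reindex_apply,
        submatrix_submatrix, Equiv.self_comp_symm, submatrix_id_id] at this
      exact this
  have step2 : LinearGap (fun x => X.recellMat hk (expU x ^ k)) ↔
      LinearGap fun x => X.nodeBlocks k (expU x) := by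
    constructor
    · intro h
      exact h.of_intertwine (hent hWc) (hent hWi) hmul hWW
    · intro h
      refine h.of_intertwine (A := fun x => (waves k X.cell (expU x))⁻¹)
        (B' := fun x => (waves k X.cell (expU x))⁻¹) (B := fun x => waves k X.cell (expU x))
        (hent hWi) (hent hWc) (fun x => ?_) hWW'
      have h2 := congrArg (fun M => (waves k X.cell (expU x))⁻¹ * M * (waves k X.cell (expU x))⁻¹)
        (hmul x)
      simp only [mul_assoc, hWW', mul_one] at h2
      rw [← mul_assoc _ _ (_ * _), hWW, one_mul] at h2
      exact h2.symm
  have step3 : LinearGap (fun x => X.nodeBlocks k (expU x)) ↔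
      ∀ j : Fin k, LinearGap fun x => (lval (node k (expU x) j)).mapMatrix X.lmat := by
    rw [← linearGap_blockDiagonal]
    constructor
    · intro h
      have := h.reindex (Equiv.prodComm _ _)
      simp only [nodeBlocks, reindex_apply, submatrix_submatrix] at this
      exact this
    · intro h
      exact h.reindex (Equiv.prodComm _ _)
  rw [step1, step2, step3]
  simp only [hnode]
  constructor
  · intro h
    have := (h ⟨0, hk⟩).comp_affine one_ne_zero 0
    simpa using this
  · intro h j
    have := h.comp_affine one_ne_zero (2 * Real.pi * j / k)
    simpa using this

end Recell

/-! ### Continuity of roots -/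

section Roots
open Polynomial

/-- The linear polynomial `a * X - b` belonging to a point `(a, b)` of `ℂ × ℂ`; for `a = 0` its root
is the point at infinity. -/
noncomputable def linFactor (x : ℂ × ℂ) : ℂ[X] := C x.1 * X - C x.2

theorem eval_linFactor (x : ℂ × ℂ) (z : ℂ) : (linFactor x).eval z = x.1 * z - x.2 := by
  simp [linFactor]

theorem linFactor_ne_zero {x : ℂ × ℂ} (hx : ‖x‖ = 1) : linFactor x ≠ 0 := by
  intro h
  have h0 := congrArg (Polynomial.eval 0) h
  have h1 := congrArg (Polynomial.eval 1) h
  rw [eval_linFactor, eval_zero] at h0 h1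
  have h2 : x.2 = 0 := by simpa using h0
  have h3 : x.1 = 0 := by simpa [h2] using h1
  rw [Prod.norm_def, h2, h3] at hx
  simp at hx

/-- A polynomial of degree at most `D` has `D` zeros on the Riemann sphere. -/
theorem exists_linear_factors (D : ℕ) (P : ℂ[X]) (hP : P ≠ 0) (hD : P.natDegree ≤ D) :
    ∃ (κ : ℂ) (x : Fin D → ℂ × ℂ), κ ≠ 0 ∧ (∀ j, ‖x j‖ = 1) ∧ P = C κ * ∏ j, linFactor (x j) := by
  induction D generalizing P with
  | zero =>
    obtain ⟨c, hc⟩ := natDegree_eq_zero.mp (Nat.le_zero.mp hD)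
    refine ⟨c, Fin.elim0, ?_, fun j => j.elim0, by simp [hc]⟩
    rintro rfl
    exact hP (by simp [← hc])
  | succ D ih =>
    by_cases hd : P.natDegree ≤ D
    · obtain ⟨κ, x, hκ, hx, h⟩ := ih P hP hd
      -- the missing degree is accounted for by a zero at infinity, with linear factor `-1`
      refine ⟨-κ, Fin.cons (0, 1) x, neg_ne_zero.mpr hκ, ?_, ?_⟩
      · refine Fin.cases ?_ ?_
        · simp [Prod.norm_def]
        · simpa using hx
      · rw [Fin.prod_univ_succ]
        simp only [Fin.cons_zero, Fin.cons_succ]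
        rw [h]
        simp [linFactor]
    · have hdeg : P.degree ≠ 0 := by
        intro h0
        have := natDegree_eq_zero_iff_degree_le_zero.mpr h0.le
        omega
      obtain ⟨r, hr⟩ := IsAlgClosed.exists_root P hdeg
      obtain ⟨Q, rfl⟩ := dvd_iff_isRoot.mpr hr
      have hQ : Q ≠ 0 := right_ne_zero_of_mul hP
      rw [natDegree_mul (X_sub_C_ne_zero r) hQ, natDegree_X_sub_C] at hD
      obtain ⟨κ, x, hκ, hx, h⟩ := ih Q hQ (by omega)
      set n : ℝ := ‖((1 : ℂ), r)‖ with hn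
      have hn1 : 0 < n := norm_pos_iff.mpr (by simp)
      have hn1' : (n : ℂ) ≠ 0 := by exact_mod_cast hn1.ne'
      refine ⟨n * κ, Fin.cons ((n : ℂ)⁻¹ • ((1 : ℂ), r)) x, mul_ne_zero hn1' hκ, ?_, ?_⟩
      · refine Fin.cases ?_ ?_
        · rw [Fin.cons_zero, norm_smul, norm_inv, Complex.norm_real, Real.norm_of_nonneg hn1.le,
            ← hn, inv_mul_cancel₀ hn1.ne']
        · simpa using hx
      · rw [Fin.prod_univ_succ]
        simp only [Fin.cons_zero, Fin.cons_succ]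
        have : X - C r = C (n : ℂ) * linFactor ((n : ℂ)⁻¹ • ((1 : ℂ), r)) := by
          simp only [linFactor, Prod.smul_fst, Prod.smul_snd, smul_eq_mul, mul_one]
          rw [mul_sub, ← mul_assoc, ← C_mul, ← C_mul, mul_inv_cancel₀ hn1',
            mul_inv_cancel_left₀ hn1', C_1, one_mul]
        rw [this]
        nth_rw 1 [h]
        rw [C_mul]
        ring

theorem rootCount_linFactor (p : ℝ → Prop) [DecidablePred p] (x : ℂ × ℂ) :
    rootCount p (linFactor x) = if x.1 ≠ 0 ∧ p (‖x.2‖ / ‖x.1‖) then 1 else 0 := by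
  by_cases h0 : x.1 = 0
  · rw [if_neg (by simp [h0])]
    have : linFactor x = C (-x.2) := by simp [linFactor, h0]
    rw [this, rootCount_C]
  · have : linFactor x = C x.1 * (X - C (x.2 / x.1)) := by
      rw [linFactor, mul_sub, ← C_mul, mul_div_cancel₀ _ h0]
    rw [this, rootCount_mul p (C_ne_zero.mpr h0) (X_sub_C_ne_zero _), rootCount_C,
      rootCount_X_sub_C, zero_add, norm_div]
    simp [h0]

theorem rootCount_prod_linFactor (p : ℝ → Prop) [DecidablePred p] {D : ℕ} {κ : ℂ} (hκ : κ ≠ 0)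
    {x : Fin D → ℂ × ℂ} (hx : ∀ j, ‖x j‖ = 1) :
    rootCount p (C κ * ∏ j, linFactor (x j)) =
      (Finset.univ.filter fun j => (x j).1 ≠ 0 ∧ p (‖(x j).2‖ / ‖(x j).1‖)).card := by
  classical
  rw [rootCount_mul p (C_ne_zero.mpr hκ)
    (Finset.prod_ne_zero_iff.mpr fun j _ => linFactor_ne_zero (hx j)), rootCount_C, zero_add,
    rootCount_prod p _ fun j _ => linFactor_ne_zero (hx j), Finset.card_filter]
  exact Finset.sum_congr rfl fun j _ => rootCount_linFactor p (x j)

theorem inCount_prod_linFactor {D : ℕ} {κ : ℂ} (hκ : κ ≠ 0)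
    {x : Fin D → ℂ × ℂ} (hx : ∀ j, ‖x j‖ = 1) :
    inCount (C κ * ∏ j, linFactor (x j)) =
      (Finset.univ.filter fun j => ‖(x j).2‖ < ‖(x j).1‖).card := by
  refine (rootCount_prod_linFactor (· < 1) hκ hx).trans ?_
  congr 1
  refine Finset.filter_congr fun j _ => ?_
  by_cases h0 : (x j).1 = 0
  · simp [h0]
  · simp only [ne_eq, h0, not_false_eq_true, true_and]
    exact div_lt_one (norm_pos_iff.mpr h0)

theorem circCount_prod_linFactor {D : ℕ} {κ : ℂ} (hκ : κ ≠ 0)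
    {x : Fin D → ℂ × ℂ} (hx : ∀ j, ‖x j‖ = 1) :
    circCount (C κ * ∏ j, linFactor (x j)) =
      (Finset.univ.filter fun j => ‖(x j).2‖ = ‖(x j).1‖).card := by
  refine (rootCount_prod_linFactor (· = 1) hκ hx).trans ?_
  congr 1
  refine Finset.filter_congr fun j _ => ?_
  by_cases h0 : (x j).1 = 0
  · have := hx j
    rw [Prod.norm_def, h0, norm_zero, max_eq_right (norm_nonneg _)] at this
    simp [h0, this]
  · simp only [ne_eq, h0, not_false_eq_true, true_and]
    exact div_eq_one_iff_eq (norm_ne_zero_iff.mpr h0)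

variable {ι : Type*} {U : Ultrafilter ι} {P : ι → ℂ[X]} {Q : ℂ[X]} {D : ℕ}

/-- Continuity of the roots: the roots of a convergent family of polynomials of bounded degree, with
the point at infinity as a root of the missing degree, can be labeled such that they converge. -/
theorem exists_tendsto_linear_factors (hP : ∀ i, P i ≠ 0) (hD : ∀ i, (P i).natDegree ≤ D)
    (hQ : Q ≠ 0) (hlim : ∀ z, Tendsto (fun i => (P i).eval z) U (𝓝 (Q.eval z))) :
    ∃ (κ : ι → ℂ) (x : ι → Fin D → ℂ × ℂ) (κ' : ℂ) (x' : Fin D → ℂ × ℂ),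
      (∀ i, κ i ≠ 0) ∧ (∀ i j, ‖x i j‖ = 1) ∧ (∀ i, P i = C (κ i) * ∏ j, linFactor (x i j)) ∧
      κ' ≠ 0 ∧ (∀ j, ‖x' j‖ = 1) ∧ Q = C κ' * ∏ j, linFactor (x' j) ∧
      ∀ j, Tendsto (fun i => x i j) U (𝓝 (x' j)) := by
  choose κ x hκ hx hPx using fun i => exists_linear_factors D (P i) (hP i) (hD i)
  -- the unit sphere of `ℂ × ℂ` is compact, so the labeled zeros converge along the ultrafilter
  have hcpt : ∀ j, ∃ y : ℂ × ℂ, ‖y‖ = 1 ∧ Tendsto (fun i => x i j) U (𝓝 y) := by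
    intro j
    obtain ⟨y, hy, hle⟩ := (isCompact_sphere (0 : ℂ × ℂ) 1).ultrafilter_le_nhds
      (U.map fun i => x i j) (by
        rw [le_principal_iff]
        exact Filter.mem_map.mpr (Filter.univ_mem' fun i => by simp [hx i j]))
    exact ⟨y, by simpa using hy, hle⟩
  choose x' hx' hxlim using hcpt
  have hprod : ∀ z, Tendsto (fun i => ∏ j, (linFactor (x i j)).eval z) U
      (𝓝 (∏ j, (linFactor (x' j)).eval z)) := by
    intro z
    refine tendsto_finsetProd _ fun j _ => ?_
    simp only [eval_linFactor]
    exact (((continuous_fst.tendsto _).comp (hxlim j)).mul_const z).sub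
      ((continuous_snd.tendsto _).comp (hxlim j))
  have hne : ∏ j, linFactor (x' j) ≠ 0 :=
    Finset.prod_ne_zero_iff.mpr fun j _ => linFactor_ne_zero (hx' j)
  -- the leading constants converge because the products of the factors do, at a point where the limit is
  -- not zero
  obtain ⟨z₀, hz₀⟩ : ∃ z, (∏ j, linFactor (x' j)).eval z ≠ 0 := by
    by_contra! h
    exact hne (Polynomial.funext fun z => by rw [h z, eval_zero])
  rw [eval_prod] at hz₀
  have hev : ∀ i z, (P i).eval z = κ i * ∏ j, (linFactor (x i j)).eval z := fun i z => by
    rw [hPx i, eval_mul, eval_C, eval_prod]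
  have hκlim : Tendsto κ U (𝓝 (Q.eval z₀ / ∏ j, (linFactor (x' j)).eval z₀)) := by
    refine ((hlim z₀).div (hprod z₀) hz₀).congr' ?_
    filter_upwards [(hprod z₀).eventually_ne hz₀] with i hi
    rw [Pi.div_apply, hev, mul_div_cancel_right₀ _ hi]
  set κ' := Q.eval z₀ / ∏ j, (linFactor (x' j)).eval z₀
  have hQeq : Q = C κ' * ∏ j, linFactor (x' j) := by
    refine Polynomial.funext fun z => ?_
    rw [eval_mul, eval_C, eval_prod]
    refine tendsto_nhds_unique (hlim z) ?_
    simp only [hev]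
    exact hκlim.mul (hprod z)
  refine ⟨κ, x, κ', x', hκ, hx, hPx, ?_, hx', hQeq, hxlim⟩
  intro h0
  rw [h0, C_0, zero_mul] at hQeq
  exact hQ hQeq

/-- If moreover the number of roots on the unit circle does not change in the limit, then no root
moves onto the circle or away from it: the labels of the roots inside, on and outside the circle
stay the same. -/
theorem eventually_labels_eq {κ : ι → ℂ} {x : ι → Fin D → ℂ × ℂ} {κ' : ℂ} {x' : Fin D → ℂ × ℂ}
    (hκ : ∀ i, κ i ≠ 0) (hx : ∀ i j, ‖x i j‖ = 1) (hκ' : κ' ≠ 0) (hx' : ∀ j, ‖x' j‖ = 1)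
    (hlim : ∀ j, Tendsto (fun i => x i j) U (𝓝 (x' j)))
    (hcirc : ∀ i, circCount (C (κ i) * ∏ j, linFactor (x i j))
      = circCount (C κ' * ∏ j, linFactor (x' j))) :
    ∀ᶠ i in (U : Filter ι), ∀ j, (‖(x i j).2‖ < ‖(x i j).1‖ ↔ ‖(x' j).2‖ < ‖(x' j).1‖) ∧
      (‖(x i j).2‖ = ‖(x i j).1‖ ↔ ‖(x' j).2‖ = ‖(x' j).1‖) := by
  have h1 : ∀ j, Tendsto (fun i => ‖(x i j).1‖) U (𝓝 ‖(x' j).1‖) := fun j =>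
    ((continuous_fst.norm).tendsto _).comp (hlim j)
  have h2 : ∀ j, Tendsto (fun i => ‖(x i j).2‖) U (𝓝 ‖(x' j).2‖) := fun j =>
    ((continuous_snd.norm).tendsto _).comp (hlim j)
  -- the conditions of being inside and of being outside are open
  have hin : ∀ᶠ i in (U : Filter ι), ∀ j, ‖(x' j).2‖ < ‖(x' j).1‖ → ‖(x i j).2‖ < ‖(x i j).1‖ := by
    rw [eventually_all]
    intro j
    by_cases h : ‖(x' j).2‖ < ‖(x' j).1‖
    · filter_upwards [(h2 j).eventually_lt (h1 j) h] with i hi using fun _ => hi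
    · exact Eventually.of_forall fun i hi => absurd hi h
  have hout : ∀ᶠ i in (U : Filter ι), ∀ j, ‖(x' j).1‖ < ‖(x' j).2‖ → ‖(x i j).1‖ < ‖(x i j).2‖ := by
    rw [eventually_all]
    intro j
    by_cases h : ‖(x' j).1‖ < ‖(x' j).2‖
    · filter_upwards [(h1 j).eventually_lt (h2 j) h] with i hi using fun _ => hi
    · exact Eventually.of_forall fun i hi => absurd hi h
  filter_upwards [hin, hout] with i hi ho
  -- hence zeros on the circle have limits on the circle, and counting gives the converse
  have hsub : (Finset.univ.filter fun j => ‖(x i j).2‖ = ‖(x i j).1‖) ⊆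
      Finset.univ.filter fun j => ‖(x' j).2‖ = ‖(x' j).1‖ := by
    intro j hj
    simp only [Finset.mem_filter, Finset.mem_univ, true_and] at hj ⊢
    rcases lt_trichotomy ‖(x' j).2‖ ‖(x' j).1‖ with h | h | h
    · exact absurd hj (hi j h).ne
    · exact h
    · exact absurd hj (ho j h).ne'
  have hcard := hcirc i
  rw [circCount_prod_linFactor (hκ i) (hx i), circCount_prod_linFactor hκ' hx'] at hcard
  have heq := Finset.eq_of_subset_of_card_le hsub hcard.ge
  have hcircle : ∀ j, ‖(x i j).2‖ = ‖(x i j).1‖ ↔ ‖(x' j).2‖ = ‖(x' j).1‖ := fun j => by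
    have := Finset.ext_iff.mp heq j
    simpa using this
  intro j
  refine ⟨⟨fun h => ?_, hi j⟩, hcircle j⟩
  rcases lt_trichotomy ‖(x' j).2‖ ‖(x' j).1‖ with h' | h' | h'
  · exact h'
  · exact absurd ((hcircle j).mpr h') h.ne
  · exact absurd h (ho j h').not_gt

/-- The number of zeros inside the unit disk is locally constant as long as the number of zeros on the
unit circle is constant. -/
theorem eventually_inCount_eq {ι : Type*} {l : Filter ι} {P : ι → ℂ[X]} (hP : ∀ i, P i ≠ 0)
    (hD : ∀ i, (P i).natDegree ≤ D) (hQ : Q ≠ 0)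
    (hlim : ∀ z, Tendsto (fun i => (P i).eval z) l (𝓝 (Q.eval z)))
    (hcirc : ∀ i, circCount (P i) = circCount Q) : ∀ᶠ i in l, inCount (P i) = inCount Q := by
  refine mem_iff_ultrafilter.mpr fun U hU => ?_
  obtain ⟨κ, x, κ', x', hκ, hx, hPx, hκ', hx', hQx, hxlim⟩ :=
    exists_tendsto_linear_factors hP hD hQ fun z => (hlim z).mono_left hU
  have := eventually_labels_eq hκ hx hκ' hx' hxlim fun i => by rw [← hPx, ← hQx, hcirc]
  filter_upwards [this] with i hi
  rw [hPx, hQx, inCount_prod_linFactor (hκ i) (hx i), inCount_prod_linFactor hκ' hx']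
  simp only [(hi _).1]

/-- At a simple zero `1` only one of the linear factors vanishes. -/
theorem rootMultiplicity_prod_linFactor {κ : ℂ} (hκ : κ ≠ 0) {x : Fin D → ℂ × ℂ}
    (hx : ∀ j, ‖x j‖ = 1) {j j' : Fin D} (hj : (x j).1 = (x j).2) (hj' : (x j').1 = (x j').2)
    (h : (C κ * ∏ j, linFactor (x j)).rootMultiplicity 1 ≤ 1) : j = j' := by
  classical
  by_contra hne
  have hdvd : ∀ i, (x i).1 = (x i).2 → (X - C 1) ∣ linFactor (x i) := fun i hi => by
    rw [dvd_iff_isRoot, IsRoot, eval_linFactor, hi, mul_one, sub_self]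
  have h2 : (X - C 1) ^ 2 ∣ C κ * ∏ j, linFactor (x j) := by
    refine Dvd.dvd.mul_left ?_ _
    rw [← Finset.mul_prod_erase _ _ (Finset.mem_univ j),
      ← Finset.mul_prod_erase _ _ (Finset.mem_erase.mpr ⟨Ne.symm hne, Finset.mem_univ j'⟩), sq,
      ← mul_assoc]
    exact (mul_dvd_mul (hdvd j hj) (hdvd j' hj')).mul_right _
  have hne0 : C κ * ∏ j, linFactor (x j) ≠ 0 := mul_ne_zero (C_ne_zero.mpr hκ)
    (Finset.prod_ne_zero_iff.mpr fun j _ => linFactor_ne_zero (hx j))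
  have := (le_rootMultiplicity_iff hne0).mpr h2
  omega

/-- A simple root of a real polynomial at `1` cannot move when the polynomial is deformed with a
constant number of roots on the unit circle: it would have to move along the circle, together with
its complex conjugate. -/
theorem eventually_isRoot_one {ι : Type*} {l : Filter ι} {P : ι → ℂ[X]} (hP : ∀ i, P i ≠ 0)
    (hD : ∀ i, (P i).natDegree ≤ D) (hQ : Q ≠ 0)
    (hlim : ∀ z, Tendsto (fun i => (P i).eval z) l (𝓝 (Q.eval z)))
    (hcirc : ∀ i, circCount (P i) = circCount Q)
    (hreal : ∀ i z, (P i).IsRoot z → (P i).IsRoot (starRingEnd ℂ z)) (h1 : Q.IsRoot 1)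
    (hsimple : Q.rootMultiplicity 1 ≤ 1) : ∀ᶠ i in l, (P i).IsRoot 1 := by
  refine mem_iff_ultrafilter.mpr fun U hU => ?_
  obtain ⟨κ, x, κ', x', hκ, hx, hPx, hκ', hx', hQx, hxlim⟩ :=
    exists_tendsto_linear_factors hP hD hQ fun z => (hlim z).mono_left hU
  have hlab := eventually_labels_eq hκ hx hκ' hx' hxlim fun i => by rw [← hPx, ← hQx, hcirc]
  have hroot : ∀ i z, (P i).IsRoot z ↔ ∃ j, (x i j).1 * z = (x i j).2 := by
    intro i z
    rw [IsRoot, hPx, eval_mul, eval_C, eval_prod, mul_eq_zero, or_iff_right (hκ i),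
      Finset.prod_eq_zero_iff]
    simp [eval_linFactor, sub_eq_zero]
  obtain ⟨j₀, hj₀⟩ : ∃ j, (x' j).1 = (x' j).2 := by
    rw [IsRoot, hQx, eval_mul, eval_C, eval_prod, mul_eq_zero, or_iff_right hκ',
      Finset.prod_eq_zero_iff] at h1
    obtain ⟨j, -, hj⟩ := h1
    exact ⟨j, by simpa [eval_linFactor, sub_eq_zero] using hj⟩
  rw [hQx] at hsimple
  have hne : ∀ᶠ i in (U : Filter ι), (x i j₀).1 ≠ 0 := by
    filter_upwards [hlab] with i hi h0
    have h2 := (hi j₀).2.mpr (by rw [hj₀])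
    rw [h0, norm_zero, norm_eq_zero] at h2
    have := hx i j₀
    rw [Prod.norm_def, h0, h2] at this
    simp at this
  set r : ι → ℂ := fun i => (x i j₀).2 / (x i j₀).1 with hr
  have hx0 : (x' j₀).1 ≠ 0 := by
    intro h0
    have := hx' j₀
    rw [Prod.norm_def, ← hj₀, h0] at this
    simp at this
  have hrlim : Tendsto r U (𝓝 1) := by
    have := ((continuous_snd.tendsto _).comp (hxlim j₀)).div
      ((continuous_fst.tendsto _).comp (hxlim j₀)) hx0
    rwa [← hj₀, div_self hx0] at this
  have hrnorm : ∀ᶠ i in (U : Filter ι), ‖r i‖ = 1 := by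
    filter_upwards [hlab, hne] with i hi hi0
    rw [hr]
    simp only
    rw [norm_div, (hi j₀).2.mpr (by rw [hj₀]), div_self (norm_ne_zero_iff.mpr hi0)]
  have hrroot : ∀ᶠ i in (U : Filter ι), (P i).IsRoot (r i) := by
    filter_upwards [hne] with i hi
    exact (hroot i _).mpr ⟨j₀, mul_div_cancel₀ _ hi⟩
  -- the conjugate root has a label, constant along the ultrafilter; in the limit it is the label of
  -- the simple root `1`
  have hconj : ∀ᶠ i in (U : Filter ι), ∃ j, (x i j).1 * starRingEnd ℂ (r i) = (x i j).2 := by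
    filter_upwards [hrroot] with i hi using (hroot i _).mp (hreal i _ hi)
  have hlabel : ∃ j, ∀ᶠ i in (U : Filter ι), (x i j).1 * starRingEnd ℂ (r i) = (x i j).2 :=
    Ultrafilter.eventually_exists_iff.mp hconj
  obtain ⟨j, hj⟩ := hlabel
  have hjlim : (x' j).1 = (x' j).2 := by
    have e1 : Tendsto (fun i => (x i j).1 * starRingEnd ℂ (r i)) U (𝓝 ((x' j).1 * starRingEnd ℂ 1)) :=
      ((continuous_fst.tendsto _).comp (hxlim j)).mul
        ((Complex.continuous_conj.tendsto _).comp hrlim)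
    have e2 : Tendsto (fun i => (x i j).2) U (𝓝 (x' j).2) :=
      (continuous_snd.tendsto _).comp (hxlim j)
    rw [map_one, mul_one] at e1
    exact tendsto_nhds_unique (e1.congr' hj) e2
  obtain rfl := rootMultiplicity_prod_linFactor hκ' hx' hj₀ hjlim hsimple
  -- so the zero near `1` coincides with its conjugate; being real, positive and of modulus `1`, it is `1`
  have hpos : ∀ᶠ i in (U : Filter ι), 0 < (r i).re := by
    have : Tendsto (fun i => (r i).re) U (𝓝 1) := (Complex.continuous_re.tendsto 1).comp hrlim
    exact this.eventually (lt_mem_nhds one_pos)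
  filter_upwards [hne, hrnorm, hrroot, hj, hpos] with i hi hn hroot' hji hp
  have hself : starRingEnd ℂ (r i) = r i := by
    rw [hr]
    simp only
    rw [eq_div_iff hi, mul_comm]
    exact hji
  have him : (r i).im = 0 := Complex.conj_eq_iff_im.mp hself
  have hre : r i = ((r i).re : ℂ) := Complex.ext (by simp) (by simp [him])
  have : (r i).re = 1 := by
    rw [hre, Complex.norm_real, Real.norm_of_nonneg hp.le] at hn
    exact hn
  rw [hre, this, Complex.ofReal_one] at hroot'
  exact hroot'

end Roots

/-! ### Paths of Laurent polynomials -/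

section Paths

/-- Evaluation of a continuous function at a time `s`. -/
def atTime (s : unitInterval) : C(unitInterval, ℝ) →+* ℝ where
  toFun f := f s
  map_one' := rfl
  map_mul' _ _ := rfl
  map_zero' := rfl
  map_add' _ _ := rfl

@[simp] theorem atTime_apply (s : unitInterval) (f : C(unitInterval, ℝ)) : atTime s f = f s := rfl

/-- The Laurent polynomial at time `s` of a path of Laurent polynomials. Such a path, with bounded
degrees and continuous coefficients, is a Laurent polynomial whose coefficients are continuous
functions of time. -/
noncomputable def pathAt (s : unitInterval) : C(unitInterval, ℝ)[T;T⁻¹] →+* ℝ[T;T⁻¹] :=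
  AddMonoidAlgebra.mapRingHom ℤ (atTime s)

theorem coeff_pathAt (s : unitInterval) (p : C(unitInterval, ℝ)[T;T⁻¹]) (α : ℤ) :
    (pathAt s p).coeff α = p.coeff α s :=
  AddMonoidAlgebra.coeff_mapRingHom _ _ _

@[simp] theorem pathAt_C (s : unitInterval) (f : C(unitInterval, ℝ)) :
    pathAt s (LaurentPolynomial.C f) = LaurentPolynomial.C (f s) := by
  rw [pathAt, ← LaurentPolynomial.single_eq_C, AddMonoidAlgebra.mapRingHom_single]
  rfl

@[simp] theorem pathAt_T (s : unitInterval) (n : ℤ) :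
    pathAt s (LaurentPolynomial.T n) = LaurentPolynomial.T n := by
  rw [pathAt, LaurentPolynomial.T, AddMonoidAlgebra.mapRingHom_single, map_one]
  rfl

theorem pathAt_toLaurent (s : unitInterval) (P : C(unitInterval, ℝ)[X]) :
    pathAt s (Polynomial.toLaurent P) = Polynomial.toLaurent (P.map (atTime s)) := by
  induction P using Polynomial.induction_on' with
  | add p q hp hq => rw [map_add, map_add, hp, hq, Polynomial.map_add, map_add]
  | monomial n a =>
    rw [← Polynomial.C_mul_X_pow_eq_monomial, map_mul, map_mul, Polynomial.toLaurent_C,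
      Polynomial.toLaurent_X_pow, pathAt_C, pathAt_T, Polynomial.map_mul, Polynomial.map_pow,
      Polynomial.map_C, Polynomial.map_X, map_mul, Polynomial.toLaurent_C,
      Polynomial.toLaurent_X_pow]
    rfl

theorem exists_path_numer (p : C(unitInterval, ℝ)[T;T⁻¹]) :
    ∃ (P : C(unitInterval, ℝ)[X]) (m : ℕ), ∀ s,
      Polynomial.toLaurent (P.map (atTime s)) = pathAt s p * LaurentPolynomial.T m := by
  obtain ⟨m, P, h⟩ := p.exists_T_pow
  refine ⟨P, m, fun s => ?_⟩
  rw [← pathAt_toLaurent, h, map_mul, pathAt_T]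

theorem continuous_eval_atTime (P : C(unitInterval, ℝ)[X]) (z : ℂ) :
    Continuous fun s => ((P.map (atTime s)).map (algebraMap ℝ ℂ)).eval z := by
  have : ∀ s, ((P.map (atTime s)).map (algebraMap ℝ ℂ)).eval z
      = ∑ i ∈ P.support, ((P.coeff i s : ℝ) : ℂ) * z ^ i := fun s => by
    rw [Polynomial.map_map, Polynomial.eval_map, Polynomial.eval₂_eq_sum]
    rfl
  simp only [this]
  exact continuous_finsetSum _ fun i _ =>
    (Complex.continuous_ofReal.comp (P.coeff i).continuous).mul continuous_const

theorem continuous_real_eval_atTime (P : C(unitInterval, ℝ)[X]) (x : ℝ) :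
    Continuous fun s => (P.map (atTime s)).eval x := by
  have : ∀ s, (P.map (atTime s)).eval x = ∑ i ∈ P.support, P.coeff i s * x ^ i := fun s => by
    rw [Polynomial.eval_map, Polynomial.eval₂_eq_sum]
    rfl
  simp only [this]
  exact continuous_finsetSum _ fun i _ => (P.coeff i).continuous.mul continuous_const

/-- The index is constant along a path of Laurent polynomials with a constant number of zeros on the
unit circle. -/
theorem ind_pathAt {p : C(unitInterval, ℝ)[T;T⁻¹]} (h0 : ∀ s, pathAt s p ≠ 0)
    (hc : ∀ s, circ (pathAt s p) = circ (pathAt 0 p)) (s : unitInterval) :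
    ind (pathAt s p) = ind (pathAt 0 p) := by
  obtain ⟨P, m, hP⟩ := exists_path_numer p
  have hloc : IsLocallyConstant fun s => inCount ((P.map (atTime s)).map (algebraMap ℝ ℂ)) := by
    rw [IsLocallyConstant.iff_eventually_eq]
    intro s₀
    refine eventually_inCount_eq (D := P.natDegree)
      (fun s => map_ne_zero_of_toLaurent (h0 s) (hP s))
      (fun s => Polynomial.natDegree_map_le.trans Polynomial.natDegree_map_le)
      (map_ne_zero_of_toLaurent (h0 s₀) (hP s₀))
      (fun z => (continuous_eval_atTime P z).tendsto s₀) (fun s => ?_)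
    rw [← circ_eq (h0 s) (hP s), ← circ_eq (h0 s₀) (hP s₀), hc s, hc s₀]
  rw [ind_eq (h0 s) (hP s), ind_eq (h0 0) (hP 0)]
  have : inCount ((P.map (atTime s)).map (algebraMap ℝ ℂ))
      = inCount ((P.map (atTime 0)).map (algebraMap ℝ ℂ)) := hloc.apply_eq_of_preconnectedSpace s 0
  rw [this]

end Paths

/-! ### Signs of real Laurent polynomials -/

section Signs

/-- The sign of a nonzero real number, as a unit. -/
noncomputable def unitSign (x : ℝ) : ℤˣ := if 0 < x then 1 else -1

theorem unitSign_mul_of_pos {x y : ℝ} (hx : 0 < x) : unitSign (x * y) = unitSign y := by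
  simp [unitSign, hx]

theorem unitSign_units (σ : ℤˣ) : unitSign ((σ : ℤ) : ℝ) = σ := by
  rcases Int.units_eq_one_or σ with rfl | rfl <;> simp [unitSign]

theorem unitSign_path {g : unitInterval → ℝ} (hg : Continuous g) (h0 : ∀ s, g s ≠ 0)
    (s : unitInterval) : unitSign (g s) = unitSign (g 0) := by
  have hloc : IsLocallyConstant fun s => unitSign (g s) := by
    rw [IsLocallyConstant.iff_eventually_eq]
    intro s₀
    rcases lt_or_gt_of_ne (h0 s₀) with h | h
    · filter_upwards [hg.continuousAt.eventually (gt_mem_nhds h)] with s hs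
      rw [unitSign, unitSign, if_neg hs.not_gt, if_neg h.not_gt]
    · filter_upwards [hg.continuousAt.eventually (lt_mem_nhds h)] with s hs
      rw [unitSign, unitSign, if_pos hs, if_pos h]
  exact hloc.apply_eq_of_preconnectedSpace s 0

/-- The two signs of a real polynomial with at most a simple zero at `1`: the sign of its value at
`1` and `1`, or, if it vanishes there, the sign of its derivative at `1` and `-1`. -/
noncomputable def polySigns (P : ℝ[X]) : ℤˣ × ℤˣ :=
  if P.eval 1 = 0 then (unitSign (P.derivative.eval 1), -1) else (unitSign (P.eval 1), 1)

theorem polySigns_mul_X_pow (P : ℝ[X]) (n : ℕ) : polySigns (P * .X ^ n) = polySigns P := by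
  by_cases h : P.eval 1 = 0
  · simp [polySigns, h]
  · simp [polySigns, h]

/-- The two signs of a real Laurent polynomial, see `polySigns`. -/
noncomputable def signs (p : ℝ[T;T⁻¹]) : ℤˣ × ℤˣ := polySigns (numer p)

theorem signs_eq {p : ℝ[T;T⁻¹]} {P : ℝ[X]} {m : ℕ}
    (h : Polynomial.toLaurent P = p * LaurentPolynomial.T m) : signs p = polySigns P := by
  have := congrArg polySigns (toLaurent_unique h (toLaurent_numer p))
  rw [polySigns_mul_X_pow, polySigns_mul_X_pow] at this
  exact this.symm

theorem isRoot_map_one_iff (P : ℝ[X]) : (P.map (algebraMap ℝ ℂ)).IsRoot 1 ↔ P.eval 1 = 0 := by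
  rw [Polynomial.IsRoot, ← map_one (algebraMap ℝ ℂ), Polynomial.eval_map_apply]
  exact map_eq_zero_iff _ (algebraMap ℝ ℂ).injective

theorem derivative_eval_one_ne_zero {P : ℝ[X]} (hP : P.map (algebraMap ℝ ℂ) ≠ 0)
    (h : (P.map (algebraMap ℝ ℂ)).rootMultiplicity 1 ≤ 1) (h1 : P.eval 1 = 0) :
    P.derivative.eval 1 ≠ 0 := by
  intro hd
  have := (Polynomial.one_lt_rootMultiplicity_iff_isRoot hP).mpr
    ⟨(isRoot_map_one_iff P).mpr h1, by
      rw [Polynomial.derivative_map]; exact (isRoot_map_one_iff _).mpr hd⟩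
  omega

/-- The signs are constant along a path of real Laurent polynomials which have simple zeros on the
unit circle, in constant number. -/
theorem signs_pathAt {p : C(unitInterval, ℝ)[T;T⁻¹]} (h0 : ∀ s, SimpleCirc (pathAt s p))
    (hc : ∀ s, circ (pathAt s p) = circ (pathAt 0 p)) (s : unitInterval) :
    signs (pathAt s p) = signs (pathAt 0 p) := by
  obtain ⟨P, m, hP⟩ := exists_path_numer p
  set Q : unitInterval → ℝ[X] := fun s => P.map (atTime s) with hQ
  have hne : ∀ s, (Q s).map (algebraMap ℝ ℂ) ≠ 0 := fun s =>
    map_ne_zero_of_toLaurent (h0 s).1 (hP s)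
  have hs1 : ∀ s, ((Q s).map (algebraMap ℝ ℂ)).rootMultiplicity 1 ≤ 1 := fun s =>
    (simpleCirc_iff (h0 s).1 (hP s)).mp (h0 s) 1 (by simp)
  have hcont : Continuous fun s => (Q s).eval 1 := continuous_real_eval_atTime P 1
  have hcont' : Continuous fun s => (Q s).derivative.eval 1 := by
    simp only [hQ, Polynomial.derivative_map]
    exact continuous_real_eval_atTime _ 1
  -- a zero at `1` is present at all times or never
  have hclopen : IsClopen {s | (Q s).eval 1 = 0} := by
    refine ⟨isClosed_eq hcont continuous_const, isOpen_iff_eventually.mpr fun s₀ hs₀ => ?_⟩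
    have := eventually_isRoot_one (D := P.natDegree) (l := 𝓝 s₀) hne
      (fun s => Polynomial.natDegree_map_le.trans Polynomial.natDegree_map_le) (hne s₀)
      (fun z => (continuous_eval_atTime P z).tendsto s₀) (fun s => ?_) (fun s z hz => ?_)
      ((isRoot_map_one_iff _).mpr hs₀) (hs1 s₀)
    · filter_upwards [this] with s hs using (isRoot_map_one_iff _).mp hs
    · rw [← circ_eq (h0 s).1 (hP s), ← circ_eq (h0 s₀).1 (hP s₀), hc s, hc s₀]
    · rw [Polynomial.IsRoot, Polynomial.eval_map_algebraMap] at hz ⊢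
      have := Polynomial.aeval_conj (Q s) z
      rw [hz, map_zero] at this
      exact this
  rw [signs_eq (hP s), signs_eq (hP 0)]
  change polySigns (Q s) = polySigns (Q 0)
  by_cases h : (Q 0).eval 1 = 0
  · have hall : ∀ s, (Q s).eval 1 = 0 := fun s => by
      have := Set.eq_univ_iff_forall.mp (hclopen.eq_univ ⟨0, h⟩) s
      exact this
    simp only [polySigns, hall, if_true]
    rw [unitSign_path hcont' fun s => derivative_eval_one_ne_zero (hne s) (hs1 s) (hall s)]
  · have hall : ∀ s, (Q s).eval 1 ≠ 0 := fun s hs => h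
      (Set.eq_univ_iff_forall.mp (hclopen.eq_univ ⟨s, hs⟩) 0)
    simp only [polySigns, hall, if_false]
    rw [unitSign_path hcont hall]

end Signs

/-! ### Paths of local Hamiltonians -/

section LocalPaths

/-- The matrix of Laurent polynomials at time `s`. -/
noncomputable def matAt {N : ℕ} (s : unitInterval)
    (M : Matrix (Fin N) (Fin N) C(unitInterval, ℝ)[T;T⁻¹]) : Matrix (Fin N) (Fin N) ℝ[T;T⁻¹] :=
  (pathAt s).mapMatrix M

theorem det_matAt {N : ℕ} (s : unitInterval)
    (M : Matrix (Fin N) (Fin N) C(unitInterval, ℝ)[T;T⁻¹]) : (matAt s M).det = pathAt s M.det :=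
  (RingHom.map_det _ _).symm

theorem isLocalPath_ofMat {N : ℕ} (hN : 0 < N)
    (M : Matrix (Fin N) (Fin N) C(unitInterval, ℝ)[T;T⁻¹]) :
    IsLocalPath fun s => ofMat hN (matAt s M) := by
  obtain ⟨B, hB⟩ := exists_coeff_bound M
  have hcoeff : ∀ s i j, (ofMat hN (matAt s M)).hop i j
      = (M (site hN i) (site hN j)).coeff (j / N - i / N) s := fun s i j => coeff_pathAt _ _ _
  refine ⟨fun s => rfl, ⟨N * (B + 1), fun s i j h => ?_⟩, fun i j => ?_⟩
  · rw [hcoeff, hB _ _ _ (lt_abs_ediv_sub_ediv hN B h)]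
    rfl
  · simp only [hcoeff]
    exact ((M (site hN i) (site hN j)).coeff (j / N - i / N)).continuous

/-- A path of local Hamiltonians is given by a matrix of Laurent polynomials whose coefficients are
continuous functions of time. -/
theorem IsLocalPath.exists_matrix {γ : unitInterval → BDIChain} (h : IsLocalPath γ) :
    ∃ M : Matrix (Fin (γ 0).cell) (Fin (γ 0).cell) C(unitInterval, ℝ)[T;T⁻¹],
      ∀ s, γ s = ofMat (γ 0).cell_pos (matAt s M) := by
  obtain ⟨hcell, ⟨R, hR⟩, hcont⟩ := h
  set N := (γ 0).cell with hN
  -- the common range bounds the degrees of the entries at all times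
  have hfin : ∀ a b : Fin N, (Function.support fun α : ℤ =>
      (⟨fun s => (γ s).hop (a : ℕ) ((b : ℕ) + N * α), hcont _ _⟩ : C(unitInterval, ℝ))).Finite := by
    intro a b
    refine (Set.finite_Icc (-(|R| + N)) (|R| + N)).subset fun α hα => ?_
    by_contra hc
    refine hα (ContinuousMap.ext fun s => ?_)
    have hlt : |R| + N < |α| := by
      rw [Set.mem_Icc, not_and_or, not_le, not_le] at hc
      rcases hc with hc | hc
      · exact lt_abs.mpr (Or.inr (by linarith))
      · exact lt_abs.mpr (Or.inl hc)
    have := hop_eq_zero_of_range (hR s) (a := a) (b := b) (by rw [hcell s]; exact a.2)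
      (by rw [hcell s]; exact b.2)
      (α := α) (by rw [hcell s]; exact hlt)
    rw [hcell s] at this
    exact this
  refine ⟨Matrix.of fun a b => .ofCoeff (Finsupp.ofSupportFinite _ (hfin a b)), fun s => ?_⟩
  refine ext_cell_hop (hcell s) ?_
  funext i j
  have hval : (ofMat (γ 0).cell_pos (matAt s (Matrix.of fun a b =>
      AddMonoidAlgebra.ofCoeff (Finsupp.ofSupportFinite _ (hfin a b))))).hop i j
      = (γ s).hop (site (γ 0).cell_pos i : ℕ)
        ((site (γ 0).cell_pos j : ℕ) + N * (j / N - i / N)) := coeff_pathAt _ _ _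
  rw [hval]
  conv_lhs => rw [eq_site_add_mul (γ 0).cell_pos i, eq_site_add_mul (γ 0).cell_pos j]
  have := (γ s).hop_add_mul (site (γ 0).cell_pos i : ℕ)
    ((site (γ 0).cell_pos j : ℕ) + N * (j / N - i / N)) (i / N)
  rw [hcell s] at this
  rw [← this]
  congr 1
  ring

/-- The index `ω` is constant along paths of local Hamiltonians on which the number of zeros on the
unit circle is finite and constant. -/
theorem IsLocalPath.omega_eq {γ : unitInterval → BDIChain} (h : IsLocalPath γ)
    (h0 : ∀ s, (γ s).lmat.det ≠ 0)
    (hc : ∀ s, (γ s).centralCharge = (γ 0).centralCharge) (s : unitInterval) :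
    (γ s).omega = (γ 0).omega := by
  obtain ⟨M, hM⟩ := h.exists_matrix
  have hdet : ∀ s, (ofMat (γ 0).cell_pos (matAt s M)).lmat.det = pathAt s M.det := fun s => by
    rw [lmat_ofMat]; exact det_matAt s M
  have homega : ∀ s, (γ s).omega = ind (pathAt s M.det) := fun s => by
    rw [hM s, BDIChain.omega_eq, hdet]
  have hcc : ∀ s, (γ s).centralCharge = (circ (pathAt s M.det) : ℚ) / 2 := fun s => by
    rw [hM s, centralCharge_eq, hdet]
  have hne : ∀ s, pathAt s M.det ≠ 0 := fun s h' => by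
    have := h0 s
    rw [hM s] at this
    exact this ((hdet s).trans h')
  rw [homega, homega]
  refine ind_pathAt hne (fun s => ?_) s
  have := hc s
  rw [hcc, hcc] at this
  have h2 : (circ (pathAt s M.det) : ℚ) = circ (pathAt 0 M.det) := by linarith
  exact_mod_cast h2

theorem det_ne_zero_of_f_ne_zero {X : BDIChain} (h : ∃ z : ℂ, ‖z‖ = 1 ∧ X.f z ≠ 0) :
    X.lmat.det ≠ 0 := by
  obtain ⟨z, hz, hf⟩ := h
  intro h0
  exact hf (f_eq_zero_of_det h0 z (by rintro rfl; simp at hz))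

theorem recell_comm_of_hop_eq {X Y : BDIChain} (h : X.hop = Y.hop) :
    X.recell Y.cell Y.cell_pos = Y.recell X.cell X.cell_pos :=
  ext_cell_hop (mul_comm _ _) h

/-- The CFT property and the invariants do not depend on the unit cell: compare both descriptions
with the one that has a common multiple as unit cell. -/
theorem invariants_of_hop_eq {X Y : BDIChain} (h : X.hop = Y.hop) :
    (X.IsCFT ↔ Y.IsCFT) ∧ X.centralCharge = Y.centralCharge ∧ X.omega = Y.omega := by
  have h' := recell_comm_of_hop_eq h
  refine ⟨?_, ?_, ?_⟩
  · rw [← X.isCFT_recell Y.cell_pos, h', isCFT_recell]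
  · rw [centralCharge_eq, centralCharge_eq, ← X.circ_recell Y.cell_pos, h', circ_recell]
  · rw [BDIChain.omega_eq, BDIChain.omega_eq, ← X.ind_recell Y.cell_pos, h', ind_recell]

end LocalPaths

/-! ### Connectedness is an equivalence relation with invariants -/

section Connected

theorem IsPhasePath.symm {γ : unitInterval → BDIChain} (h : IsPhasePath γ) :
    IsPhasePath fun s => γ (unitInterval.symm s) := by
  obtain ⟨⟨h1, ⟨R, hR⟩, h3⟩, h4⟩ := h
  refine ⟨⟨fun s => by rw [h1, h1 (unitInterval.symm 0)], ⟨R, fun s => hR _⟩, fun i j =>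
    (h3 i j).comp unitInterval.continuous_symm⟩, fun s => ⟨(h4 _).1, ?_⟩⟩
  rw [(h4 _).2, (h4 (unitInterval.symm 0)).2]

theorem IsPhasePath.recell {γ : unitInterval → BDIChain} (h : IsPhasePath γ) {k : ℕ} (hk : 0 < k) :
    IsPhasePath fun s => (γ s).recell k hk := by
  obtain ⟨⟨h1, h2, h3⟩, h4⟩ := h
  refine ⟨⟨fun s => ?_, h2, h3⟩, fun s => ⟨((γ s).isCFT_recell hk).mpr (h4 s).1, ?_⟩⟩
  · change k * (γ s).cell = k * (γ 0).cell
    rw [h1]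
  · have := (h4 s).2
    rwa [centralCharge_eq, centralCharge_eq, ← circ_recell _ hk, ← circ_recell (γ 0) hk,
      ← centralCharge_eq, ← centralCharge_eq] at this

/-- Concatenation of paths; the end points have to agree as chains with the same unit cell. -/
theorem IsPhasePath.trans {γ γ' : unitInterval → BDIChain} (h : IsPhasePath γ)
    (h' : IsPhasePath γ') (he : γ 1 = γ' 0) :
    ∃ δ, IsPhasePath δ ∧ δ 0 = γ 0 ∧ δ 1 = γ' 1 := by
  obtain ⟨⟨h1, ⟨R, hR⟩, h3⟩, h4⟩ := h
  obtain ⟨⟨h1', ⟨R', hR'⟩, h3'⟩, h4'⟩ := h'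
  set δ : unitInterval → BDIChain := fun s =>
    if hs : (s : ℝ) ≤ 1 / 2 then γ ⟨2 * s, (unitInterval.mul_pos_mem_iff zero_lt_two).2 ⟨s.2.1, hs⟩⟩
    else γ' ⟨2 * s - 1, unitInterval.two_mul_sub_one_mem_iff.2 ⟨(not_le.1 hs).le, s.2.2⟩⟩ with hδ
  have hδ0 : δ 0 = γ 0 := by
    simp only [hδ]
    rw [dif_pos (by norm_num)]
    congr 1
    ext
    simp
  have hδ1 : δ 1 = γ' 1 := by
    simp only [hδ]
    rw [dif_neg (by norm_num)]
    congr 1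
    ext
    norm_num
  have hcases : ∀ s, (∃ t, δ s = γ t) ∨ ∃ t, δ s = γ' t := fun s => by
    simp only [hδ]
    split_ifs
    · exact Or.inl ⟨_, rfl⟩
    · exact Or.inr ⟨_, rfl⟩
  have hcell : (γ' 0).cell = (γ 0).cell := by rw [← he, h1]
  have hcc : (γ' 0).centralCharge = (γ 0).centralCharge := by rw [← he, (h4 1).2]
  refine ⟨δ, ⟨⟨fun s => ?_, ⟨max R R', fun s i j hs => ?_⟩, fun i j => ?_⟩, fun s => ?_⟩, hδ0, hδ1⟩
  · rw [hδ0]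
    rcases hcases s with ⟨t, ht⟩ | ⟨t, ht⟩
    · rw [ht, h1]
    · rw [ht, h1', hcell]
  · rcases hcases s with ⟨t, ht⟩ | ⟨t, ht⟩
    · rw [ht, hR _ _ _ ((le_max_left _ _).trans_lt hs)]
    · rw [ht, hR' _ _ _ ((le_max_right _ _).trans_lt hs)]
  -- continuity of the couplings comes from the concatenation of paths in `ℝ`
  · set p : Path ((γ 0).hop i j) ((γ 1).hop i j) :=
      { toFun := fun s => (γ s).hop i j, continuous_toFun := h3 i j, source' := rfl, target' := rfl }
    set p' : Path ((γ 1).hop i j) ((γ' 1).hop i j) :=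
      { toFun := fun s => (γ' s).hop i j, continuous_toFun := h3' i j, source' := by rw [he],
        target' := rfl }
    have : (fun s => (δ s).hop i j) = p.trans p' := by
      funext s
      rw [Path.trans_apply]
      simp only [hδ]
      split_ifs <;> rfl
    rw [this]
    exact (p.trans p').continuous
  · rw [hδ0]
    rcases hcases s with ⟨t, ht⟩ | ⟨t, ht⟩
    · rw [ht]
      exact h4 t
    · rw [ht, ← hcc]
      exact h4' t

theorem Connected.of_hop_eq {X Y : BDIChain} (hX : X.IsCFT) (h : X.hop = Y.hop) : Connected X Y :=
  ⟨fun _ => X, ⟨⟨fun _ => rfl, X.finite_range.imp fun _ hR _ => hR, fun _ _ => continuous_const⟩,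
    fun _ => ⟨hX, rfl⟩⟩, rfl, h⟩

theorem Connected.symm {X Y : BDIChain} (h : Connected X Y) : Connected Y X := by
  obtain ⟨γ, hγ, h0, h1⟩ := h
  exact ⟨_, hγ.symm, by simpa using h1, by simpa using h0⟩

/-- Connectedness is transitive: both paths are described with a common multiple of the unit cells. -/
theorem Connected.trans {X Y Z : BDIChain} (h : Connected X Y) (h' : Connected Y Z) :
    Connected X Z := by
  obtain ⟨γ, hγ, h0, h1⟩ := h
  obtain ⟨γ', hγ', h0', h1'⟩ := h'
  have he : (γ 1).recell (γ' 0).cell (γ' 0).cell_pos = (γ' 0).recell (γ 0).cell (γ 0).cell_pos :=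
    ext_cell_hop (by
      change (γ' 0).cell * (γ 1).cell = (γ 0).cell * (γ' 0).cell
      rw [hγ.1.1 1, mul_comm]) (h1.trans h0'.symm)
  obtain ⟨δ, hδ, hδ0, hδ1⟩ := (hγ.recell (γ' 0).cell_pos).trans (hγ'.recell (γ 0).cell_pos) he
  exact ⟨δ, hδ, by rw [hδ0]; exact h0, by rw [hδ1]; exact h1'⟩

theorem TIConnected.symm {X Y : BDIChain} (h : TIConnected X Y) : TIConnected Y X := by
  obtain ⟨γ, hγ, hc, h0, h1⟩ := h
  exact ⟨_, hγ.symm, fun s => hc _, by simpa using h1, by simpa using h0⟩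

theorem TIConnected.trans {X Y Z : BDIChain} (h : TIConnected X Y) (h' : TIConnected Y Z) :
    TIConnected X Z := by
  obtain ⟨γ, hγ, hc, h0, h1⟩ := h
  obtain ⟨γ', hγ', hc', h0', h1'⟩ := h'
  obtain ⟨δ, hδ, hδ0, hδ1⟩ := hγ.trans hγ'
    (ext_cell_hop ((hc 1).trans (hc' 0).symm) (h1.trans h0'.symm))
  exact ⟨δ, hδ, fun s => by rw [hδ.1.1 s, hδ0, hc], by rw [hδ0]; exact h0, by rw [hδ1]; exact h1'⟩

theorem LinearGap.det_ne_zero {ι : Type*} [Fintype ι] [DecidableEq ι]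
    {M : Matrix ι ι ℝ[T;T⁻¹]} (h : LinearGap (symbol M)) : M.det ≠ 0 := by
  intro h0
  obtain ⟨C, hC, hev⟩ := h 0
  obtain ⟨k, hk, hk'⟩ := ((hev.filter_mono (nhdsWithin_le_nhds (s := {0}ᶜ))).and
    self_mem_nhdsWithin).exists
  have hdet : (symbol M k).det = 0 := by
    rw [symbol, ← RingHom.map_det, h0, map_zero]
  obtain ⟨v, hv, hv'⟩ := Matrix.exists_mulVec_eq_zero_iff.mpr hdet
  have := hk v
  rw [hv', norm_zero] at this
  have h1 : 0 < |k - 0| := abs_pos.mpr (by simpa using hk')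
  have h2 : 0 < ‖v‖ := norm_pos_iff.mpr hv
  have : 0 < C * |k - 0| * ‖v‖ := by positivity
  linarith

theorem IsCFT.det_ne_zero {X : BDIChain} (h : X.IsCFT) : X.lmat.det ≠ 0 :=
  LinearGap.det_ne_zero ((isCFT_iff X).mp h)

theorem IsPhasePath.omega_eq {γ : unitInterval → BDIChain} (h : IsPhasePath γ) (s : unitInterval) :
    (γ s).omega = (γ 0).omega :=
  h.1.omega_eq (fun s => (h.2 s).1.det_ne_zero) (fun s => (h.2 s).2) s

theorem Connected.invariants {X Y : BDIChain} (h : Connected X Y) :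
    X.IsCFT ∧ Y.IsCFT ∧ X.centralCharge = Y.centralCharge ∧ X.omega = Y.omega := by
  obtain ⟨γ, hγ, h0, h1⟩ := h
  obtain ⟨a0, b0, c0⟩ := invariants_of_hop_eq h0
  obtain ⟨a1, b1, c1⟩ := invariants_of_hop_eq h1
  exact ⟨a0.mp (hγ.2 0).1, a1.mp (hγ.2 1).1, by rw [← b0, ← b1, (hγ.2 1).2],
    by rw [← c0, ← c1, hγ.omega_eq 1]⟩

end Connected

/-! ### Elementary row and column operations -/

section Elementary
open Matrix

/-- `M'` is obtained from `M` by adding multiples of rows to other rows and multiples of columns to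
other columns. -/
inductive ElemEquiv {n R : Type*} [Fintype n] [DecidableEq n] [CommRing R] (M : Matrix n n R) :
    Matrix n n R → Prop
  | refl : ElemEquiv M M
  | left {M' : Matrix n n R} (h : ElemEquiv M M') (i j : n) (hij : i ≠ j) (c : R) :
      ElemEquiv M (transvection i j c * M')
  | right {M' : Matrix n n R} (h : ElemEquiv M M') (i j : n) (hij : i ≠ j) (c : R) :
      ElemEquiv M (M' * transvection i j c)

variable {n R : Type*} [Fintype n] [DecidableEq n] [CommRing R] {M M' M'' : Matrix n n R}

theorem ElemEquiv.trans (h : ElemEquiv M M') (h' : ElemEquiv M' M'') : ElemEquiv M M'' := by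
  induction h' with
  | refl => exact h
  | left _ i j hij c ih => exact ih.left i j hij c
  | right _ i j hij c ih => exact ih.right i j hij c

theorem transpose_transvection {n R : Type*} [DecidableEq n] [CommRing R] (i j : n) (c : R) :
    (transvection i j c)ᵀ = transvection j i c := by
  rw [transvection, transvection, transpose_add, transpose_one, transpose_single]

theorem ElemEquiv.transpose (h : ElemEquiv M M') : ElemEquiv Mᵀ M'ᵀ := by
  induction h with
  | refl => exact .refl
  | left _ i j hij c ih =>
    rw [transpose_mul, transpose_transvection]
    exact ih.right j i hij.symm c
  | right _ i j hij c ih =>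
    rw [transpose_mul, transpose_transvection]
    exact ih.left j i hij.symm c

theorem transvection_map {S : Type*} [CommRing S] (φ : R →+* S) (i j : n) (c : R) :
    φ.mapMatrix (transvection i j c) = transvection i j (φ c) := by
  rw [transvection, transvection, map_add, map_one]
  congr 1
  ext a b
  simp only [RingHom.mapMatrix_apply, map_apply, single_apply]
  split_ifs <;> simp

theorem ElemEquiv.map_smul {S : Type*} [CommRing S] (h : ElemEquiv M M') (φ : R →+* S) (c : S) :
    ElemEquiv (c • φ.mapMatrix M) (c • φ.mapMatrix M') := by
  induction h with
  | refl => exact .refl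
  | left _ i j hij c' ih =>
    rw [map_mul, transvection_map, ← mul_smul_comm]
    exact ih.left i j hij _
  | right _ i j hij c' ih =>
    rw [map_mul, transvection_map, ← smul_mul_assoc]
    exact ih.right i j hij _

theorem ElemEquiv.det_eq (h : ElemEquiv M M') : M'.det = M.det := by
  induction h with
  | refl => rfl
  | left _ i j hij c ih => rw [det_mul, det_transvection_of_ne _ _ hij, one_mul, ih]
  | right _ i j hij c ih => rw [det_mul, det_transvection_of_ne _ _ hij, mul_one, ih]

/-- The product of three elementary matrices which exchanges two rows up to unit factors. -/
theorem ElemEquiv.exists_swap_rows {i j : n} (hij : i ≠ j) (u : Rˣ) (M : Matrix n n R) :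
    ∃ M', ElemEquiv M M' ∧ (∀ b, M' i b = u * M j b) ∧ (∀ b, M' j b = -((u⁻¹ : Rˣ) * M i b)) ∧
      ∀ k b, k ≠ i → k ≠ j → M' k b = M k b := by
  refine ⟨_, ((ElemEquiv.refl.left i j hij (u : R)).left j i hij.symm (-(u⁻¹ : Rˣ) : R)).left i j hij
    (u : R), fun b => ?_, fun b => ?_, fun k b hki hkj => ?_⟩
  · simp only [transvection_mul_apply_same, transvection_mul_apply_of_ne _ _ _ _ hij,
      transvection_mul_apply_of_ne _ _ _ _ hij.symm]
    linear_combination (-(M i b) - u * M j b) * u.mul_inv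
  · rw [transvection_mul_apply_of_ne _ _ _ _ hij.symm, transvection_mul_apply_same,
      transvection_mul_apply_same, transvection_mul_apply_of_ne _ _ _ _ hij.symm]
    linear_combination (-(M j b)) * u.inv_mul
  · rw [transvection_mul_apply_of_ne _ _ _ _ hki, transvection_mul_apply_of_ne _ _ _ _ hkj,
      transvection_mul_apply_of_ne _ _ _ _ hki]

/-- Multiplication of one row by a unit and of another one by its inverse is a product of elementary
operations (Whitehead's lemma). -/
theorem ElemEquiv.exists_scale_rows {i j : n} (hij : i ≠ j) (u : Rˣ) (M : Matrix n n R) :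
    ∃ M', ElemEquiv M M' ∧ (∀ b, M' i b = u * M i b) ∧ (∀ b, M' j b = (u⁻¹ : Rˣ) * M j b) ∧
      ∀ k b, k ≠ i → k ≠ j → M' k b = M k b := by
  obtain ⟨M₁, h₁, a₁, b₁, c₁⟩ := ElemEquiv.exists_swap_rows hij (-1) M
  obtain ⟨M₂, h₂, a₂, b₂, c₂⟩ := ElemEquiv.exists_swap_rows hij u M₁
  refine ⟨M₂, h₁.trans h₂, fun b => ?_, fun b => ?_, fun k b hki hkj => ?_⟩
  · rw [a₂, b₁]; simp
  · rw [b₂, a₁]; simp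
  · rw [c₂ k b hki hkj, c₁ k b hki hkj]

theorem ElemEquiv.diagonal_scale {i j : n} (hij : i ≠ j) (u : Rˣ) {d d' : n → R}
    (hi : d' i = u * d i) (hj : d' j = (u⁻¹ : Rˣ) * d j) (hk : ∀ k, k ≠ i → k ≠ j → d' k = d k) :
    ElemEquiv (diagonal d) (diagonal d') := by
  obtain ⟨M', h, a, b, c⟩ := ElemEquiv.exists_scale_rows hij u (diagonal d)
  have : M' = diagonal d' := by
    ext k l
    by_cases hki : k = i
    · subst hki
      rw [a]
      by_cases hl : k = l
      · subst hl; simp [hi]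
      · simp [diagonal_apply_ne _ hl]
    by_cases hkj : k = j
    · subst hkj
      rw [b]
      by_cases hl : k = l
      · subst hl; simp [hj]
      · simp [diagonal_apply_ne _ hl]
    rw [c k l hki hkj, diagonal_apply, diagonal_apply, hk k hki hkj]
  exact this ▸ h

theorem ElemEquiv.diagonal_swap {i j : n} (hij : i ≠ j) (d : n → R) :
    ElemEquiv (diagonal d) (diagonal (d ∘ Equiv.swap i j)) := by
  obtain ⟨M₁, h₁, a₁, b₁, c₁⟩ := ElemEquiv.exists_swap_rows hij 1 (diagonal d)
  obtain ⟨M₂, h₂, a₂, b₂, c₂⟩ := ElemEquiv.exists_swap_rows hij 1 M₁ᵀ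
  have h := h₁.trans (by simpa using h₂.transpose)
  have : M₂ᵀ = diagonal (d ∘ Equiv.swap i j) := by
    ext k l
    simp only [Units.val_one, one_mul, inv_one, transpose_apply] at a₁ b₁ a₂ b₂ c₁ c₂
    rw [transpose_apply]
    have hrow : ∀ k l, M₁ k l = if k = i then diagonal d j l else if k = j then -diagonal d i l
        else diagonal d k l := by
      intro k l
      split_ifs with h1 h2
      · rw [h1, a₁]
      · rw [h2, b₁]
      · exact c₁ k l h1 h2
    have hcol : M₂ l k = if l = i then M₁ k j else if l = j then -M₁ k i else M₁ k l := by
      split_ifs with h1 h2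
      · rw [h1, a₂]
      · rw [h2, b₂]
      · exact c₂ l k h1 h2
    rw [hcol]
    simp only [hrow, diagonal_apply, Function.comp_apply, Equiv.swap_apply_def]
    split_ifs <;> simp_all
  exact this ▸ h

theorem ElemEquiv.diagonal_perm (σ : Equiv.Perm n) (d : n → R) :
    ElemEquiv (diagonal d) (diagonal (d ∘ σ)) := by
  induction σ using Equiv.Perm.swap_induction_on' with
  | one => exact .refl
  | mul_swap f i j hij ih => exact ih.trans (by simpa using! ElemEquiv.diagonal_swap hij (d ∘ f))

/-- Units with product `1` can be attached to the entries of a diagonal matrix. -/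
theorem ElemEquiv.diagonal_units (v : n → Rˣ) (hv : ∏ i, v i = 1) (d : n → R) :
    ElemEquiv (diagonal d) (diagonal fun i => v i * d i) := by
  have key : ∀ (s : Finset n) (v : n → Rˣ) (d : n → R), (∀ i, i ∉ s → v i = 1) → ∏ i, v i = 1 →
      ElemEquiv (diagonal d) (diagonal fun i => v i * d i) := by
    intro s
    induction s using Finset.induction_on with
    | empty =>
      intro v d h _
      simp only [h _ (Finset.notMem_empty _), Units.val_one, one_mul]
      exact .refl
    | insert a s ha ih =>
      intro v d h hv
      rcases s.eq_empty_or_nonempty with rfl | ⟨b, hb⟩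
      · have hva : v a = 1 := by
          rw [Finset.prod_eq_single a] at hv
          · exact hv
          · intro i _ hi
            exact h i (by simpa using hi)
          · simp
        have : ∀ i, v i = 1 := fun i => by
          by_cases hi : i = a
          · rw [hi, hva]
          · exact h i (by simpa using hi)
        simp only [this, Units.val_one, one_mul]
        exact .refl
      · have hab : a ≠ b := by rintro rfl; exact ha hb
        -- move the unit `v a` from position `a` to position `b`
        set w : n → Rˣ := Function.update (Function.update v a 1) b (v b * v a) with hw
        have hwa : w a = 1 := by simp [hw, hab]
        have hwb : w b = v b * v a := by simp [hw]
        have hwk : ∀ k, k ≠ a → k ≠ b → w k = v k := fun k hka hkb => by simp [hw, hka, hkb]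
        have hprod : ∏ i, w i = 1 := by
          have h1 : ∏ i, w i = ∏ i, v i := by
            rw [← Finset.mul_prod_erase _ _ (Finset.mem_univ a),
              ← Finset.mul_prod_erase _ _ (Finset.mem_erase.mpr ⟨hab.symm, Finset.mem_univ b⟩),
              ← Finset.mul_prod_erase _ v (Finset.mem_univ a),
              ← Finset.mul_prod_erase _ v (Finset.mem_erase.mpr ⟨hab.symm, Finset.mem_univ b⟩),
              hwa, hwb]
            have : ∏ x ∈ (Finset.univ.erase a).erase b, w x
                = ∏ x ∈ (Finset.univ.erase a).erase b, v x :=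
              Finset.prod_congr rfl fun x hx => hwk x
                (Finset.ne_of_mem_erase (Finset.mem_of_mem_erase hx)) (Finset.ne_of_mem_erase hx)
            rw [this, one_mul, mul_comm (v b), mul_assoc]
          rw [h1, hv]
        have hs : ∀ i, i ∉ s → w i = 1 := by
          intro i hi
          by_cases hia : i = a
          · rw [hia, hwa]
          · have hib : i ≠ b := by rintro rfl; exact hi hb
            rw [hwk i hia hib]
            exact h i (by simp [hia, hi])
        refine (ih w d hs hprod).trans (ElemEquiv.diagonal_scale hab (v a) ?_ ?_ ?_)
        · simp [hwa]
        · rw [hwb, Units.val_mul]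
          linear_combination (-(v b * d b : R)) * (v a).inv_mul
        · intro k hka hkb
          rw [hwk k hka hkb]
  exact key Finset.univ v d (fun i hi => absurd (Finset.mem_univ i) hi) hv

end Elementary

/-! ### Diagonalization of matrices of Laurent polynomials -/

section Diagonalization
open Matrix

variable {n : Type*} [Fintype n] [DecidableEq n]

/-- Row and column `i` vanish outside the diagonal, for all `i ∈ s`. -/
def CleanOn {R : Type*} [Zero R] (s : Finset n) (M : Matrix n n R) : Prop :=
  ∀ i j, i ≠ j → (i ∈ s ∨ j ∈ s) → M i j = 0

theorem CleanOn.transpose {n R : Type*} [Zero R] {s : Finset n} {M : Matrix n n R}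
    (h : CleanOn s M) : CleanOn s Mᵀ := fun i j hij hs => h j i hij.symm hs.symm

theorem CleanOn.transvection_mul {R : Type*} [CommRing R] {s : Finset n} {M : Matrix n n R}
    (h : CleanOn s M) {i j : n} (hi : i ∉ s) (hj : j ∉ s) (c : R) :
    CleanOn s (transvection i j c * M) := by
  intro k l hkl hs
  by_cases hk : k = i
  · subst hk
    have hl := hs.resolve_left hi
    rw [transvection_mul_apply_same, h k l hkl hs, h j l (by rintro rfl; exact hj hl) (Or.inr hl)]
    simp
  · rw [transvection_mul_apply_of_ne _ _ _ _ hk, h k l hkl hs]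

variable {K : Type*} [Field K]

/-- The number of entries outside the diagonal which prevent row and column `a` from being clean. -/
noncomputable def offCount (a : n) (M : Matrix n n K[X]) : ℕ := by
  classical
  exact (Finset.univ.filter fun i => i ≠ a ∧ M i a ≠ 0).card +
    (Finset.univ.filter fun i => i ≠ a ∧ M a i ≠ 0).card

theorem offCount_transpose (a : n) (M : Matrix n n K[X]) : offCount a Mᵀ = offCount a M := by
  simp only [offCount, transpose_apply]
  exact add_comm _ _

/-- One step of the Euclidean algorithm: a division with remainder makes the pivot smaller or kills
an entry of its column. -/
theorem exists_reduction {s : Finset n} {a : n} (ha : a ∉ s) {M : Matrix n n K[X]}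
    (hM : CleanOn s M) (haa : M a a ≠ 0) {i : n} (hia : i ≠ a) (hne : M i a ≠ 0) :
    ∃ M', ElemEquiv M M' ∧ CleanOn s M' ∧ M' a a ≠ 0 ∧
      ((M' a a).natDegree < (M a a).natDegree ∨
        M' a a = M a a ∧ offCount a M' < offCount a M) := by
  classical
  have hi : i ∉ s := fun hi => hne (hM i a hia (Or.inl hi))
  set q := M i a / M a a with hq
  set r := M i a % M a a with hr
  have hdiv : M i a = M a a * q + r := (EuclideanDomain.div_add_mod _ _).symm
  set M₁ := transvection i a (-q) * M with hM₁
  have h₁ : ElemEquiv M M₁ := ElemEquiv.refl.left i a hia _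
  have hc₁ : CleanOn s M₁ := hM.transvection_mul hi ha _
  have e₁ : M₁ i a = r := by
    rw [hM₁, transvection_mul_apply_same]
    linear_combination hdiv
  have e₂ : ∀ k l, k ≠ i → M₁ k l = M k l := fun k l hk =>
    transvection_mul_apply_of_ne _ _ _ _ hk _ _
  by_cases hr0 : r = 0
  · refine ⟨M₁, h₁, hc₁, by rw [e₂ a a hia.symm]; exact haa, Or.inr ⟨e₂ a a hia.symm, ?_⟩⟩
    rw [offCount, offCount]
    refine add_lt_add_of_lt_of_le (Finset.card_lt_card ?_) (Finset.card_le_card ?_)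
    · rw [Finset.ssubset_iff_of_subset]
      · exact ⟨i, by simp [hia, hne], by simp [e₁, hr0]⟩
      · intro k hk
        simp only [Finset.mem_filter, Finset.mem_univ, true_and] at hk ⊢
        refine ⟨hk.1, ?_⟩
        have hki : k ≠ i := by
          rintro rfl
          exact hk.2 (e₁.trans hr0)
        rw [← e₂ k a hki]
        exact hk.2
    · intro k hk
      simp only [Finset.mem_filter, Finset.mem_univ, true_and] at hk ⊢
      rwa [e₂ a k hia.symm] at hk
  · -- the remainder is moved to the position of the pivot
    set M₂ : Matrix n n K[X] := transvection a i 1 * (transvection i a (-1) *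
      (transvection a i 1 * M₁)) with hM₂
    have e₃ : M₂ a a = r := by
      rw [hM₂]
      simp only [transvection_mul_apply_same, transvection_mul_apply_of_ne _ _ _ _ hia,
        transvection_mul_apply_of_ne _ _ _ _ hia.symm, e₁]
      ring
    refine ⟨M₂, ((h₁.left a i hia.symm _).left i a hia _).left a i hia.symm _,
      ((hc₁.transvection_mul ha hi _).transvection_mul hi ha _).transvection_mul ha hi _, ?_, ?_⟩
    · rwa [e₃]
    · rw [e₃]
      exact Or.inl (Polynomial.natDegree_lt_natDegree hr0 (EuclideanDomain.mod_lt _ haa))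

/-- The Euclidean algorithm clears one more row and column. -/
theorem exists_cleanOn_insert {s : Finset n} {a : n} (ha : a ∉ s) {M : Matrix n n K[X]}
    (hM : CleanOn s M) (haa : M a a ≠ 0) :
    ∃ M', ElemEquiv M M' ∧ CleanOn (insert a s) M' := by
  -- the pivot's degree and then the number of obstructing entries decrease
  have key : ∀ (x : ℕ ×ₗ ℕ) (M : Matrix n n K[X]), CleanOn s M → M a a ≠ 0 →
      toLex ((M a a).natDegree, offCount a M) = x →
      ∃ M', ElemEquiv M M' ∧ CleanOn (insert a s) M' := by
    intro x
    induction x using WellFoundedLT.induction with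
    | ind x ih =>
    intro M hM haa hx
    have hstep : ∀ M' : Matrix n n K[X], ElemEquiv M M' → CleanOn s M' → M' a a ≠ 0 →
        ((M' a a).natDegree < (M a a).natDegree ∨ M' a a = M a a ∧ offCount a M' < offCount a M) →
        ∃ M'', ElemEquiv M M'' ∧ CleanOn (insert a s) M'' := by
      intro M' h1 h2 h3 h4
      obtain ⟨M'', h5, h6⟩ := ih (toLex ((M' a a).natDegree, offCount a M')) (by
        rw [← hx, Prod.Lex.toLex_lt_toLex]
        rcases h4 with h4 | ⟨h4, h5⟩
        · exact Or.inl h4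
        · exact Or.inr ⟨by simp only [h4], h5⟩) M' h2 h3 rfl
      exact ⟨M'', h1.trans h5, h6⟩
    by_cases hcol : ∃ i, i ≠ a ∧ M i a ≠ 0
    · obtain ⟨i, hia, hne⟩ := hcol
      obtain ⟨M', h1, h2, h3, h4⟩ := exists_reduction ha hM haa hia hne
      exact hstep M' h1 h2 h3 h4
    by_cases hrow : ∃ i, i ≠ a ∧ M a i ≠ 0
    · obtain ⟨i, hia, hne⟩ := hrow
      obtain ⟨M', h1, h2, h3, h4⟩ := exists_reduction ha hM.transpose (by simpa using haa) hia
        (by simpa using hne)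
      refine hstep M'ᵀ (by simpa using h1.transpose) h2.transpose (by simpa using h3) ?_
      rw [offCount_transpose a M] at h4
      rw [offCount_transpose]
      exact h4
    · push Not at hcol hrow
      refine ⟨M, .refl, fun i j hij hs => ?_⟩
      simp only [Finset.mem_insert] at hs
      rcases hs with (rfl | hs) | (rfl | hs)
      · exact hrow j hij.symm
      · exact hM i j hij (Or.inl hs)
      · exact hcol i hij
      · exact hM i j hij (Or.inr hs)
  exact key _ M hM haa rfl

/-- A matrix of polynomials over a field is diagonalized by elementary row and column operations. -/
theorem exists_elemEquiv_diagonal (M : Matrix n n K[X]) :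
    ∃ d : n → K[X], ElemEquiv M (diagonal d) := by
  have key : ∀ s : Finset n, ∃ M', ElemEquiv M M' ∧ CleanOn s M' := by
    intro s
    induction s using Finset.induction_on with
    | empty => exact ⟨M, .refl, fun i j _ h => by simp at h⟩
    | insert a s ha ih =>
      obtain ⟨M', h, hM'⟩ := ih
      by_cases haa : M' a a ≠ 0
      · obtain ⟨M'', h1, h2⟩ := exists_cleanOn_insert ha hM' haa
        exact ⟨M'', h.trans h1, h2⟩
      rw [not_not] at haa
      -- a vanishing pivot is made nonzero, unless its row and column vanish anyway
      by_cases hcol : ∃ i, i ≠ a ∧ M' i a ≠ 0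
      · obtain ⟨i, hia, hne⟩ := hcol
        have hi : i ∉ s := fun hi => hne (hM' i a hia (Or.inl hi))
        obtain ⟨M'', h1, h2⟩ := exists_cleanOn_insert ha (hM'.transvection_mul ha hi 1)
          (by rw [transvection_mul_apply_same, haa]; simpa using hne)
        exact ⟨M'', (h.left a i hia.symm 1).trans h1, h2⟩
      by_cases hrow : ∃ i, i ≠ a ∧ M' a i ≠ 0
      · obtain ⟨i, hia, hne⟩ := hrow
        have hi : i ∉ s := fun hi => hne (hM' a i hia.symm (Or.inr hi))
        obtain ⟨M'', h1, h2⟩ := exists_cleanOn_insert ha (hM'.transpose.transvection_mul ha hi 1)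
          (by rw [transvection_mul_apply_same, transpose_apply, haa]; simpa using hne)
        have h3 := (ElemEquiv.refl.left a i hia.symm 1).trans h1
        exact ⟨M''ᵀ, h.trans (by simpa using h3.transpose), h2.transpose⟩
      · push Not at hcol hrow
        refine ⟨M', h, fun i j hij hs => ?_⟩
        simp only [Finset.mem_insert] at hs
        rcases hs with (rfl | hs) | (rfl | hs)
        · exact hrow j hij.symm
        · exact hM' i j hij (Or.inl hs)
        · exact hcol i hij
        · exact hM' i j hij (Or.inr hs)
  obtain ⟨M', h, hM'⟩ := key Finset.univ
  refine ⟨fun i => M' i i, ?_⟩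
  have : M' = diagonal fun i => M' i i := by
    ext i j
    by_cases hij : i = j
    · subst hij; simp
    · rw [diagonal_apply_ne _ hij, hM' i j hij (Or.inl (Finset.mem_univ i))]
  exact this ▸ h

/-- Matrices of Laurent polynomials have a common denominator. -/
theorem exists_eq_T_smul (M : Matrix n n ℝ[T;T⁻¹]) : ∃ (m : ℤ) (P : Matrix n n ℝ[X]),
    (LaurentPolynomial.T m : ℝ[T;T⁻¹]) • (Polynomial.toLaurent (R := ℝ)).mapMatrix P = M := by
  obtain ⟨m, hm⟩ := (Set.finite_range fun x : n × n => den (M x.1 x.2)).bddAbove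
  have hle : ∀ i j, den (M i j) ≤ m := fun i j => hm ⟨(i, j), rfl⟩
  refine ⟨-m, Matrix.of fun i j => numer (M i j) * .X ^ (m - den (M i j)), ?_⟩
  ext1 i j
  rw [Matrix.smul_apply, RingHom.mapMatrix_apply, map_apply, of_apply, map_mul, toLaurent_numer,
    Polynomial.toLaurent_X_pow, smul_eq_mul, mul_assoc, ← LaurentPolynomial.T_add, mul_left_comm,
    ← LaurentPolynomial.T_add]
  have := hle i j
  rw [show (-(m : ℤ) + ((den (M i j) : ℤ) + ((m - den (M i j) : ℕ) : ℤ))) = 0 by omega,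
    LaurentPolynomial.T_zero, mul_one]

/-- A matrix of Laurent polynomials is diagonalized by elementary operations: apply
`exists_elemEquiv_diagonal` after multiplication with a power of `z`. -/
theorem exists_elemEquiv_diagonal_laurent (M : Matrix n n ℝ[T;T⁻¹]) :
    ∃ d : n → ℝ[T;T⁻¹], ElemEquiv M (diagonal d) := by
  obtain ⟨m, P, rfl⟩ := exists_eq_T_smul M
  obtain ⟨d, hd⟩ := exists_elemEquiv_diagonal P
  have h := hd.map_smul (Polynomial.toLaurent (R := ℝ)) (LaurentPolynomial.T m)
  rw [RingHom.mapMatrix_apply _ (diagonal d), diagonal_map (map_zero _), ← diagonal_smul] at h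
  exact ⟨_, h⟩

end Diagonalization

/-! ### Elementary operations as paths of chains -/

section Connect
open Matrix

/-- A constant path of Laurent polynomials. -/
noncomputable def constPath : ℝ[T;T⁻¹] →+* C(unitInterval, ℝ)[T;T⁻¹] :=
  AddMonoidAlgebra.mapRingHom ℤ (algebraMap ℝ C(unitInterval, ℝ))

@[simp] theorem pathAt_constPath (s : unitInterval) (p : ℝ[T;T⁻¹]) :
    pathAt s (constPath p) = p := by
  ext α
  rw [coeff_pathAt, constPath, AddMonoidAlgebra.coeff_mapRingHom]
  rfl

theorem isCFT_ofMat_iff {N : ℕ} (hN : 0 < N) (M : Matrix (Fin N) (Fin N) ℝ[T;T⁻¹]) :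
    (ofMat hN M).IsCFT ↔ LinearGap (symbol M) := by
  rw [isCFT_iff, lmat_ofMat]
  rfl

theorem isPhasePath_ofMat {N : ℕ} (hN : 0 < N)
    (M : Matrix (Fin N) (Fin N) C(unitInterval, ℝ)[T;T⁻¹])
    (hgap : ∀ s, LinearGap (symbol (matAt s M)))
    (hcirc : ∀ s, circ (matAt s M).det = circ (matAt 0 M).det) :
    IsPhasePath fun s => ofMat hN (matAt s M) := by
  refine ⟨isLocalPath_ofMat hN M, fun s => ⟨(isCFT_ofMat_iff hN _).mpr (hgap s), ?_⟩⟩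
  rw [centralCharge_eq, centralCharge_eq, lmat_ofMat, lmat_ofMat]
  have := hcirc s
  congr 2

/-- The continuous function `s ↦ s`. -/
def timeMap : C(unitInterval, ℝ) := ⟨Subtype.val, continuous_subtype_val⟩

theorem isUnit_transvection {n R : Type*} [Fintype n] [DecidableEq n] [CommRing R] {i j : n}
    (hij : i ≠ j) (c : R) : IsUnit (transvection i j c) := by
  rw [isUnit_iff_isUnit_det, det_transvection_of_ne _ _ hij]
  exact isUnit_one

theorem mapMatrix_pathAt_constPath {N : ℕ} (s : unitInterval)
    (M : Matrix (Fin N) (Fin N) ℝ[T;T⁻¹]) : matAt s (constPath.mapMatrix M) = M := by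
  ext1 i j
  exact pathAt_constPath s (M i j)

/-- Elementary operations can be switched on continuously, without a bulk transition. -/
theorem ElemEquiv.connected {N : ℕ} (hN : 0 < N) {M M' : Matrix (Fin N) (Fin N) ℝ[T;T⁻¹]}
    (h : ElemEquiv M M') (hM : LinearGap (symbol M)) :
    LinearGap (symbol M') ∧ Connected (ofMat hN M) (ofMat hN M') := by
  have htime : ∀ (s : unitInterval) (c : ℝ[T;T⁻¹]),
      pathAt s (LaurentPolynomial.C timeMap * constPath c) = LaurentPolynomial.C (s : ℝ) * c := by
    intro s c
    rw [map_mul, pathAt_C, pathAt_constPath]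
    rfl
  induction h with
  | refl => exact ⟨hM, .of_hop_eq ((isCFT_ofMat_iff hN M).mpr hM) rfl⟩
  | @left M' h i j hij c ih =>
    obtain ⟨h1, h2⟩ := ih
    have hgap : ∀ c, LinearGap (symbol (transvection i j c * M')) := fun c => by
      simpa using h1.mul_isUnit (isUnit_transvection hij c) isUnit_one
    refine ⟨hgap c, h2.trans ?_⟩
    set Q := transvection i j (LaurentPolynomial.C timeMap * constPath c) *
      constPath.mapMatrix M' with hQ
    have hQs : ∀ s, matAt s Q = transvection i j (LaurentPolynomial.C (s : ℝ) * c) * M' := by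
      intro s
      rw [matAt, hQ, map_mul, transvection_map, htime]
      exact congrArg _ (mapMatrix_pathAt_constPath s M')
    refine ⟨_, isPhasePath_ofMat hN Q (fun s => ?_) (fun s => ?_), ?_, ?_⟩
    · rw [hQs]; exact hgap _
    · rw [hQs, hQs, det_mul, det_mul, det_transvection_of_ne _ _ hij, det_transvection_of_ne _ _ hij]
    · simp only [hQs]
      simp
    · simp only [hQs]
      simp
  | @right M' h i j hij c ih =>
    obtain ⟨h1, h2⟩ := ih
    have hgap : ∀ c, LinearGap (symbol (M' * transvection i j c)) := fun c => by
      simpa using h1.mul_isUnit isUnit_one (isUnit_transvection hij c)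
    refine ⟨hgap c, h2.trans ?_⟩
    set Q := constPath.mapMatrix M' *
      transvection i j (LaurentPolynomial.C timeMap * constPath c) with hQ
    have hQs : ∀ s, matAt s Q = M' * transvection i j (LaurentPolynomial.C (s : ℝ) * c) := by
      intro s
      rw [matAt, hQ, map_mul, transvection_map, htime]
      exact congrArg (· * _) (mapMatrix_pathAt_constPath s M')
    refine ⟨_, isPhasePath_ofMat hN Q (fun s => ?_) (fun s => ?_), ?_, ?_⟩
    · rw [hQs]; exact hgap _
    · rw [hQs, hQs, det_mul, det_mul, det_transvection_of_ne _ _ hij, det_transvection_of_ne _ _ hij]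
    · simp only [hQs]
      simp
    · simp only [hQs]
      simp

end Connect

/-! ### Factors without zeros on the unit circle -/

section NoCirc

/-- The Laurent polynomial has no zeros on the unit circle. -/
def NoCirc (u : ℝ[T;T⁻¹]) : Prop := ∀ z : ℂˣ, ‖(z : ℂ)‖ = 1 → lval z u ≠ 0

theorem NoCirc.mul {u v : ℝ[T;T⁻¹]} (hu : NoCirc u) (hv : NoCirc v) : NoCirc (u * v) :=
  fun z hz => by rw [map_mul]; exact mul_ne_zero (hu z hz) (hv z hz)

theorem noCirc_of_isUnit {u : ℝ[T;T⁻¹]} (hu : IsUnit u) : NoCirc u :=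
  fun z _ => (hu.map (lval z)).ne_zero

theorem isUnit_C {c : ℝ} (hc : c ≠ 0) : IsUnit (LaurentPolynomial.C c) :=
  (isUnit_iff_ne_zero.mpr hc).map LaurentPolynomial.C

theorem lval_toLaurent (z : ℂˣ) (P : ℝ[X]) :
    lval z (Polynomial.toLaurent P) = (P.map (algebraMap ℝ ℂ)).eval (z : ℂ) := by
  have := lval_mul_pow (p := Polynomial.toLaurent P) (P := P) (m := 0) (by simp) z
  simpa using this

variable {u p : ℝ[T;T⁻¹]}

theorem NoCirc.ne_zero (hu : NoCirc u) : u ≠ 0 := by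
  rintro rfl
  exact hu 1 (by simp) (map_zero _)

theorem NoCirc.not_isRoot (hu : NoCirc u) {z : ℂ} (hz : ‖z‖ = 1) :
    ¬ ((numer u).map (algebraMap ℝ ℂ)).IsRoot z := by
  have hz0 : z ≠ 0 := by rintro rfl; simp at hz
  rw [Polynomial.IsRoot, ← Units.val_mk0 hz0, ← lval_mul_pow (toLaurent_numer u)]
  exact mul_ne_zero (hu _ hz) (pow_ne_zero _ hz0)

theorem NoCirc.circ_eq_zero (hu : NoCirc u) : circ u = 0 := by
  rw [circ, circCount, Multiset.filter_eq_nil.mpr, Multiset.card_zero]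
  intro z hz hz1
  exact hu.not_isRoot hz1 (Polynomial.mem_roots'.mp hz).2

theorem NoCirc.circ_mul (hu : NoCirc u) : circ (u * p) = circ p := by
  by_cases hp : p = 0
  · rw [hp, mul_zero]
  · rw [BDIChain.circ_mul hu.ne_zero hp, hu.circ_eq_zero, zero_add]

theorem NoCirc.simpleCirc_mul (hu : NoCirc u) : SimpleCirc (u * p) ↔ SimpleCirc p := by
  by_cases hp : p = 0
  · rw [hp, mul_zero]
  rw [simpleCirc_iff (mul_ne_zero hu.ne_zero hp) (toLaurent_numer_mul u p),
    simpleCirc_iff hp (toLaurent_numer p)]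
  refine forall₂_congr fun z hz => ?_
  rw [Polynomial.map_mul, Polynomial.rootMultiplicity_mul
    (mul_ne_zero (map_numer_ne_zero hu.ne_zero) (map_numer_ne_zero hp)),
    Polynomial.rootMultiplicity_eq_zero (hu.not_isRoot hz), zero_add]

end NoCirc

/-! ### Real polynomials with zeros on the unit circle -/

section CirclePolynomials
open Polynomial

/-- The real polynomial with the zeros `x ± i √(1 - x²)` on the unit circle, for `|x| < 1`. -/
noncomputable def conjPair (x : ℝ) : ℝ[X] := X ^ 2 - C (2 * x) * X + 1

theorem conjPair_eq (x : ℝ) : conjPair x = (X - C x) ^ 2 + C (1 - x ^ 2) := by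
  simp only [conjPair, map_mul, map_sub, map_pow, map_one, map_ofNat]
  ring

theorem conjPair_eval_pos {x : ℝ} (hx : x ∈ Set.Ioo (-1 : ℝ) 1) (y : ℝ) :
    0 < (conjPair x).eval y := by
  rw [conjPair_eq]
  simp only [eval_add, eval_pow, eval_sub, eval_X, eval_C]
  nlinarith [sq_nonneg (y - x), hx.1, hx.2]

theorem exists_map_conjPair {x : ℝ} (hx : x ∈ Set.Ioo (-1 : ℝ) 1) : ∃ ζ : ℂ, ‖ζ‖ = 1 ∧
    (conjPair x).map (algebraMap ℝ ℂ) = (X - C ζ) * (X - C (starRingEnd ℂ ζ)) := by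
  have h1 : 0 ≤ 1 - x ^ 2 := by nlinarith [hx.1, hx.2]
  have hsq := Real.sq_sqrt h1
  set y := Real.sqrt (1 - x ^ 2)
  refine ⟨⟨x, y⟩, ?_, ?_⟩
  · rw [← sq_eq_sq₀ (norm_nonneg _) zero_le_one, Complex.sq_norm, Complex.normSq_mk]
    linarith
  · have hs : (⟨x, y⟩ : ℂ) + starRingEnd ℂ ⟨x, y⟩ = ((2 * x : ℝ) : ℂ) := by
      apply Complex.ext
      · simp
        ring
      · simp
    have hp : (⟨x, y⟩ : ℂ) * starRingEnd ℂ ⟨x, y⟩ = 1 := by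
      apply Complex.ext
      · simp
        linarith
      · simp
        ring
    have : (X - C (⟨x, y⟩ : ℂ)) * (X - C (starRingEnd ℂ ⟨x, y⟩))
        = X ^ 2 - C ((⟨x, y⟩ : ℂ) + starRingEnd ℂ ⟨x, y⟩) * X
          + C ((⟨x, y⟩ : ℂ) * starRingEnd ℂ ⟨x, y⟩) := by
      simp only [map_add, map_mul]
      ring
    rw [this, hs, hp, conjPair]
    simp

theorem conjPair_separable {x : ℝ} (hx : x ∈ Set.Ioo (-1 : ℝ) 1) : (conjPair x).Separable := by
  have h1 : 1 - x ^ 2 ≠ 0 := by nlinarith [hx.1, hx.2]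
  refine ⟨C (1 - x ^ 2)⁻¹, -C ((1 - x ^ 2)⁻¹ / 2) * (X - C x), ?_⟩
  have hd : (conjPair x).derivative = C 2 * (X - C x) := by
    rw [conjPair_eq]
    simp [derivative_pow]
  have e1 : C (1 - x ^ 2)⁻¹ * C (1 - x ^ 2) = (1 : ℝ[X]) := by
    rw [← C_mul, inv_mul_cancel₀ h1, C_1]
  have e2 : C ((1 - x ^ 2)⁻¹ / 2) * C 2 = (C (1 - x ^ 2)⁻¹ : ℝ[X]) := by
    rw [← C_mul, div_mul_cancel₀ _ two_ne_zero]
  rw [hd, conjPair_eq]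
  linear_combination e1 - (X - C x) ^ 2 * e2

theorem isCoprime_conjPair {x y : ℝ} (h : x ≠ y) : IsCoprime (conjPair x) (conjPair y) := by
  have h1 : IsCoprime (conjPair x) X := by
    refine ⟨1, C (2 * x) - X, ?_⟩
    rw [conjPair]
    ring
  have h2 : IsCoprime (conjPair x) (C (2 * (x - y))) := by
    refine ⟨0, C (2 * (x - y))⁻¹, ?_⟩
    rw [zero_mul, zero_add, ← C_mul,
      inv_mul_cancel₀ (mul_ne_zero two_ne_zero (sub_ne_zero.mpr h)), C_1]
  have h3 : conjPair y = C (2 * (x - y)) * X + 1 * conjPair x := by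
    simp only [conjPair, map_mul, map_sub]
    ring
  rw [h3]
  exact (h2.mul_right h1).add_mul_right_right 1

theorem isCoprime_X_sub_C_of_eval {P : ℝ[X]} {a : ℝ} (h : P.eval a ≠ 0) :
    IsCoprime (X - C a) P :=
  (irreducible_X_sub_C a).coprime_iff_not_dvd.mpr fun hd => h (dvd_iff_isRoot.mp hd)

/-- The real polynomial with zeros of multiplicity `a` at `1` and `b` at `-1` and pairs of conjugate
zeros on the unit circle with real parts `x ∈ L`. -/
noncomputable def circleFactor (a b : ℕ) (L : Multiset ℝ) : ℝ[X] :=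
  (X - C 1) ^ a * (X - C (-1)) ^ b * (L.map conjPair).prod

theorem prod_conjPair_eval_pos {L : Multiset ℝ} (hL : ∀ x ∈ L, x ∈ Set.Ioo (-1 : ℝ) 1) (y : ℝ) :
    0 < (L.map conjPair).prod.eval y := by
  induction L using Multiset.induction_on with
  | empty => simp
  | cons x L ih =>
    rw [Multiset.map_cons, Multiset.prod_cons, eval_mul]
    exact mul_pos (conjPair_eval_pos (hL x (Multiset.mem_cons_self x L)) y)
      (ih fun z hz => hL z (Multiset.mem_cons_of_mem hz))

variable {a b : ℕ} {L : Multiset ℝ}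

theorem circleFactor_ne_zero (hL : ∀ x ∈ L, x ∈ Set.Ioo (-1 : ℝ) 1) : circleFactor a b L ≠ 0 := by
  refine mul_ne_zero (mul_ne_zero (pow_ne_zero _ (X_sub_C_ne_zero _))
    (pow_ne_zero _ (X_sub_C_ne_zero _))) fun h => ?_
  have := prod_conjPair_eval_pos hL 0
  rw [h, eval_zero] at this
  exact this.false

theorem map_circleFactor_ne_zero (hL : ∀ x ∈ L, x ∈ Set.Ioo (-1 : ℝ) 1) :
    (circleFactor a b L).map (algebraMap ℝ ℂ) ≠ 0 := by
  rw [Polynomial.map_ne_zero_iff (algebraMap ℝ ℂ).injective]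
  exact circleFactor_ne_zero hL

theorem rootCount_pow (p : ℝ → Prop) [DecidablePred p] {P : ℂ[X]} (hP : P ≠ 0) (n : ℕ) :
    rootCount p (P ^ n) = n * rootCount p P := by
  induction n with
  | zero => simp [rootCount]
  | succ n ih => rw [pow_succ, rootCount_mul p (pow_ne_zero _ hP) hP, ih]; ring

theorem rootCount_circleFactor (p : ℝ → Prop) [DecidablePred p]
    (hL : ∀ x ∈ L, x ∈ Set.Ioo (-1 : ℝ) 1) :
    rootCount p ((circleFactor a b L).map (algebraMap ℝ ℂ))
      = if p 1 then a + b + 2 * L.card else 0 := by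
  have hprod : rootCount p ((L.map conjPair).prod.map (algebraMap ℝ ℂ))
      = if p 1 then 2 * L.card else 0 := by
    induction L using Multiset.induction_on with
    | empty => simp [rootCount]
    | cons x L ih =>
      have hL' : ∀ z ∈ L, z ∈ Set.Ioo (-1 : ℝ) 1 := fun z hz => hL z (Multiset.mem_cons_of_mem hz)
      have hne : (L.map conjPair).prod.map (algebraMap ℝ ℂ) ≠ 0 := by
        simpa [circleFactor] using map_circleFactor_ne_zero (a := 0) (b := 0) hL'
      obtain ⟨ζ, hζ, hx⟩ := exists_map_conjPair (hL x (Multiset.mem_cons_self x L))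
      rw [Multiset.map_cons, Multiset.prod_cons, Polynomial.map_mul, hx,
        rootCount_mul p (mul_ne_zero (X_sub_C_ne_zero _) (X_sub_C_ne_zero _)) hne, ih hL',
        rootCount_mul p (X_sub_C_ne_zero _) (X_sub_C_ne_zero _), rootCount_X_sub_C,
        rootCount_X_sub_C, RCLike.norm_conj, hζ, Multiset.card_cons]
      split_ifs <;> ring
  have hne : (L.map conjPair).prod.map (algebraMap ℝ ℂ) ≠ 0 := by
    simpa [circleFactor] using map_circleFactor_ne_zero (a := 0) (b := 0) hL
  rw [circleFactor, Polynomial.map_mul, Polynomial.map_mul, Polynomial.map_pow, Polynomial.map_pow,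
    Polynomial.map_sub, Polynomial.map_sub, Polynomial.map_X, Polynomial.map_C, Polynomial.map_C,
    rootCount_mul p (mul_ne_zero (pow_ne_zero _ (X_sub_C_ne_zero _))
      (pow_ne_zero _ (X_sub_C_ne_zero _))) hne, hprod,
    rootCount_mul p (pow_ne_zero _ (X_sub_C_ne_zero _)) (pow_ne_zero _ (X_sub_C_ne_zero _)),
    rootCount_pow p (X_sub_C_ne_zero _), rootCount_pow p (X_sub_C_ne_zero _), rootCount_X_sub_C,
    rootCount_X_sub_C]
  simp only [map_one, map_neg, norm_neg, norm_one]
  split_ifs <;> ring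

theorem polySigns_C_mul_circleFactor {c : ℝ} (hc : c ≠ 0) (ha : a ≤ 1)
    (hL : ∀ x ∈ L, x ∈ Set.Ioo (-1 : ℝ) 1) :
    polySigns (C c * circleFactor a b L) = (unitSign c, (-1) ^ a) := by
  set R : ℝ[X] := (X - C (-1)) ^ b * (L.map conjPair).prod with hR
  have hpos : 0 < R.eval 1 := by
    rw [hR, eval_mul]
    refine mul_pos ?_ (prod_conjPair_eval_pos hL 1)
    norm_num
  have he : C c * circleFactor a b L = C c * ((X - C 1) ^ a * R) := by
    rw [hR, circleFactor, mul_assoc]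
  rw [he]
  interval_cases a
  · have h1 : (C c * ((X - C 1) ^ 0 * R)).eval 1 = R.eval 1 * c := by simp [mul_comm]
    rw [polySigns, h1, if_neg (mul_ne_zero hpos.ne' hc), unitSign_mul_of_pos hpos, pow_zero]
  · have h1 : (C c * ((X - C 1) ^ 1 * R)).eval 1 = 0 := by simp
    have h2 : (C c * ((X - C 1) ^ 1 * R)).derivative.eval 1 = R.eval 1 * c := by
      simp [mul_comm]
    rw [polySigns, if_pos h1, h2, unitSign_mul_of_pos hpos, pow_one]

theorem circleFactor_separable (ha : a ≤ 1) (hb : b ≤ 1) (hL : ∀ x ∈ L, x ∈ Set.Ioo (-1 : ℝ) 1)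
    (hnd : L.Nodup) : (circleFactor a b L).Separable := by
  have hprod : (L.map conjPair).prod.Separable := by
    classical
    have h1 : (L.map conjPair).prod = ∏ x ∈ L.toFinset, conjPair x := by
      rw [Finset.prod_eq_multiset_prod, Multiset.toFinset_val, hnd.dedup]
    rw [h1]
    exact separable_prod' (fun x _ y _ h => isCoprime_conjPair h)
      fun x hx => conjPair_separable (hL x (Multiset.mem_toFinset.mp hx))
  have hcop : ∀ y, IsCoprime (X - C y) (L.map conjPair).prod := fun y =>
    isCoprime_X_sub_C_of_eval (prod_conjPair_eval_pos hL y).ne'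
  have h1 : IsCoprime (X - C (1 : ℝ)) (X - C (-1)) := isCoprime_X_sub_C_of_eval (by norm_num)
  have hsep : ∀ (y : ℝ) (n : ℕ), n ≤ 1 → ((X - C y) ^ n).Separable := by
    intro y n hn
    interval_cases n
    · rw [pow_zero]; exact separable_one
    · rw [pow_one]; exact separable_X_sub_C
  refine Separable.mul (Separable.mul (hsep 1 a ha) (hsep (-1) b hb) h1.pow) hprod ?_
  exact (hcop 1).pow_left.mul_left (hcop (-1)).pow_left

/-- The zeros of `circleFactor` on the unit circle are simple iff its factors are distinct. -/
theorem simpleCirc_circleFactor (hL : ∀ x ∈ L, x ∈ Set.Ioo (-1 : ℝ) 1) :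
    SimpleCirc (toLaurent (circleFactor a b L)) ↔ a ≤ 1 ∧ b ≤ 1 ∧ L.Nodup := by
  rw [simpleCirc_iff (m := 0) (P := circleFactor a b L)
    (by simpa using circleFactor_ne_zero hL) (by simp)]
  constructor
  · intro h
    have hpow : ∀ (z : ℂ) (n : ℕ), ‖z‖ = 1 →
        (X - C z) ^ n ∣ (circleFactor a b L).map (algebraMap ℝ ℂ) → n ≤ 1 := fun z n hz hd =>
      ((le_rootMultiplicity_iff (map_circleFactor_ne_zero hL)).mpr hd).trans (h z hz)
    refine ⟨hpow 1 a (by simp) ?_, hpow (-1) b (by simp) ?_, ?_⟩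
    · have : (X - C 1) ^ a ∣ circleFactor a b L := Dvd.intro _ (mul_assoc _ _ _).symm
      simpa using Polynomial.map_dvd (algebraMap ℝ ℂ) this
    · have : (X - C (-1)) ^ b ∣ circleFactor a b L := Dvd.intro_left _ (mul_right_comm _ _ _)
      simpa using Polynomial.map_dvd (algebraMap ℝ ℂ) this
    · rw [Multiset.nodup_iff_ne_cons_cons]
      rintro x t rfl
      obtain ⟨ζ, hζ, hx⟩ := exists_map_conjPair (hL x (Multiset.mem_cons_self x _))
      have hd : conjPair x ^ 2 ∣ circleFactor a b (x ::ₘ x ::ₘ t) := by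
        refine Dvd.dvd.mul_left ?_ _
        rw [Multiset.map_cons, Multiset.prod_cons, Multiset.map_cons, Multiset.prod_cons,
          ← mul_assoc, ← sq]
        exact dvd_mul_right _ _
      have hd' := Polynomial.map_dvd (algebraMap ℝ ℂ) hd
      rw [Polynomial.map_pow, hx, mul_pow] at hd'
      have := hpow ζ 2 hζ ((dvd_mul_right _ _).trans hd')
      omega
  · rintro ⟨ha, hb, hnd⟩ z -
    exact rootMultiplicity_le_one_of_separable (circleFactor_separable ha hb hL hnd).map z

/-- Induction over the factorization of a nonzero real polynomial into linear factors and quadratic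
factors with a pair of conjugate zeros. -/
theorem induction_real_factors {motive : ℝ[X] → Prop} (P : ℝ[X]) (hP : P ≠ 0)
    (hC : ∀ c, c ≠ 0 → motive (C c))
    (hX : ∀ x P, P ≠ 0 → motive P → motive ((X - C x) * P))
    (hZ : ∀ (z : ℂ) P, z.im ≠ 0 → P ≠ 0 → motive P →
      motive ((X ^ 2 - C (2 * z.re) * X + C (‖z‖ ^ 2)) * P)) : motive P := by
  induction hn : P.natDegree using Nat.strong_induction_on generalizing P with
  | h n ih =>
  subst hn
  by_cases h0 : P.natDegree = 0
  · obtain ⟨c, rfl⟩ := natDegree_eq_zero.mp h0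
    exact hC c (by simpa using hP)
  have hdeg : (P.map (algebraMap ℝ ℂ)).degree ≠ 0 := by
    rw [degree_map]
    intro h
    exact h0 (natDegree_eq_of_degree_eq_some h)
  obtain ⟨z, hz⟩ := IsAlgClosed.exists_root _ hdeg
  have hz' : aeval z P = 0 := by rwa [IsRoot, eval_map_algebraMap] at hz
  by_cases him : z.im = 0
  · have hre : P.IsRoot z.re := by
      have : z = algebraMap ℝ ℂ z.re := Complex.ext rfl (by simpa using him)
      rw [this, aeval_algebraMap_apply, Complex.coe_algebraMap, Complex.ofReal_eq_zero] at hz'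
      simpa [IsRoot] using hz'
    obtain ⟨Q, rfl⟩ := dvd_iff_isRoot.mpr hre
    have hQ := right_ne_zero_of_mul hP
    refine hX _ _ hQ (ih _ ?_ Q hQ rfl)
    rw [natDegree_mul (X_sub_C_ne_zero _) hQ, natDegree_X_sub_C]
    omega
  · obtain ⟨Q, rfl⟩ := P.quadratic_dvd_of_aeval_eq_zero_im_ne_zero hz' him
    have hQ := right_ne_zero_of_mul hP
    refine hZ _ _ him hQ (ih _ ?_ Q hQ rfl)
    have h2 : (X ^ 2 - C (2 * z.re) * X + C (‖z‖ ^ 2)).natDegree = 2 := by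
      compute_degree!
    rw [natDegree_mul (left_ne_zero_of_mul hP) hQ, h2]
    omega

end CirclePolynomials

/-! ### Moving zeros off the unit circle to the origin and to infinity -/

section MoveRoots
open Polynomial

/-- The continuous function `s ↦ 1 - s`. -/
def reverseTime : C(unitInterval, ℝ) := 1 - timeMap

theorem reverseTime_apply (s : unitInterval) : reverseTime s = 1 - (s : ℝ) := rfl

theorem norm_reverseTime_mul_le (s : unitInterval) (z : ℂ) : ‖((reverseTime s : ℝ) : ℂ) * z‖ ≤ ‖z‖ := by
  rw [norm_mul, Complex.norm_real, reverseTime_apply, Real.norm_of_nonneg (by linarith [s.2.2])]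
  exact mul_le_of_le_one_left (norm_nonneg z) (by linarith [s.2.1])

theorem sub_mul_sub_conj (w z : ℂ) :
    (w - z) * (w - starRingEnd ℂ z) = w ^ 2 - ((2 * z.re : ℝ) : ℂ) * w + ((‖z‖ ^ 2 : ℝ) : ℂ) := by
  have h1 := Complex.add_conj z
  have h2 := Complex.mul_conj z
  rw [← Complex.sq_norm] at h2
  linear_combination (-w) * h1 + h2

theorem circleFactor_succ_left (a b : ℕ) (L : Multiset ℝ) :
    circleFactor (a + 1) b L = (X - C 1) * circleFactor a b L := by
  rw [circleFactor, circleFactor]; ring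

theorem circleFactor_succ_right (a b : ℕ) (L : Multiset ℝ) :
    circleFactor a (b + 1) L = (X - C (-1)) * circleFactor a b L := by
  rw [circleFactor, circleFactor]; ring

theorem circleFactor_cons (a b : ℕ) (x : ℝ) (L : Multiset ℝ) :
    circleFactor a b (x ::ₘ L) = conjPair x * circleFactor a b L := by
  rw [circleFactor, circleFactor, Multiset.map_cons, Multiset.prod_cons]; ring

/-- The zeros of a real polynomial inside the unit disk can be moved to the origin and those outside
to infinity, without moving the zeros on the unit circle. -/
theorem exists_move_roots (P : ℝ[X]) (hP : P ≠ 0) :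
    ∃ (Φ : C(unitInterval, ℝ)[X]) (a b : ℕ) (L : Multiset ℝ) (c : ℝ) (d : ℕ),
      (∀ x ∈ L, x ∈ Set.Ioo (-1 : ℝ) 1) ∧ (∀ s, NoCirc (toLaurent (Φ.map (atTime s)))) ∧
      P = Φ.map (atTime 0) * circleFactor a b L ∧ Φ.map (atTime 1) = C c * X ^ d := by
  have hno : ∀ {A B : ℝ[X]}, (∀ w : ℂ, ‖w‖ = 1 → (A.map (algebraMap ℝ ℂ)).eval w ≠ 0) →
      NoCirc (toLaurent B) → NoCirc (toLaurent (A * B)) := by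
    intro A B hA hB
    rw [map_mul]
    refine NoCirc.mul (fun z hz => ?_) hB
    rw [lval_toLaurent]
    exact hA z hz
  refine induction_real_factors (motive := fun P => ∃ (Φ : C(unitInterval, ℝ)[X]) (a b : ℕ)
      (L : Multiset ℝ) (c : ℝ) (d : ℕ), (∀ x ∈ L, x ∈ Set.Ioo (-1 : ℝ) 1) ∧
      (∀ s, NoCirc (toLaurent (Φ.map (atTime s)))) ∧
      P = Φ.map (atTime 0) * circleFactor a b L ∧ Φ.map (atTime 1) = C c * X ^ d) P hP ?_ ?_ ?_
  · intro c hc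
    refine ⟨C (algebraMap ℝ C(unitInterval, ℝ) c), 0, 0, 0, c, 0, by simp, fun s => ?_, ?_, ?_⟩
    · rw [Polynomial.map_C, toLaurent_C]
      exact noCirc_of_isUnit (isUnit_C hc)
    · rw [Polynomial.map_C, circleFactor]
      simp
    · rw [Polynomial.map_C]
      simp
  -- a real zero inside the disk is scaled to the origin, one outside has its inverse scaled to the origin
  · rintro x P - ⟨Φ, a, b, L, c, d, hL, hΦ, h0, h1⟩
    rcases lt_trichotomy |x| 1 with hx | hx | hx
    · refine ⟨(X - C (reverseTime * algebraMap ℝ C(unitInterval, ℝ) x)) * Φ, a, b, L, c, d + 1, hL,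
        fun s => ?_, ?_, ?_⟩
      · rw [Polynomial.map_mul]
        refine hno (fun w hw h => ?_) (hΦ s)
        have he : w = ((reverseTime s : ℝ) : ℂ) * x := by
          simpa [sub_eq_zero] using h
        have := norm_reverseTime_mul_le s x
        rw [← he, hw, Complex.norm_real, Real.norm_eq_abs] at this
        linarith
      · rw [h0, Polynomial.map_mul]
        simp [reverseTime_apply, mul_assoc]
      · rw [Polynomial.map_mul, h1]
        simp [reverseTime_apply]
        ring
    · rcases abs_eq zero_le_one |>.mp hx with rfl | rfl
      · refine ⟨Φ, a + 1, b, L, c, d, hL, hΦ, ?_, h1⟩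
        rw [circleFactor_succ_left, h0]
        ring
      · refine ⟨Φ, a, b + 1, L, c, d, hL, hΦ, ?_, h1⟩
        rw [circleFactor_succ_right, h0]
        ring
    · refine ⟨(C reverseTime * X - C (algebraMap ℝ C(unitInterval, ℝ) x)) * Φ, a, b, L, -x * c, d, hL,
        fun s => ?_, ?_, ?_⟩
      · rw [Polynomial.map_mul]
        refine hno (fun w hw h => ?_) (hΦ s)
        have he : ((reverseTime s : ℝ) : ℂ) * w = x := by
          simpa [sub_eq_zero] using h
        have := norm_reverseTime_mul_le s w
        rw [he, hw, Complex.norm_real, Real.norm_eq_abs] at this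
        linarith
      · rw [h0, Polynomial.map_mul]
        simp [reverseTime_apply, mul_assoc]
      · rw [Polynomial.map_mul, h1]
        simp [reverseTime_apply]
        ring
  -- a pair of conjugate zeros is moved in the same way
  · rintro z P hz - ⟨Φ, a, b, L, c, d, hL, hΦ, h0, h1⟩
    rcases lt_trichotomy ‖z‖ 1 with hx | hx | hx
    · refine ⟨(X ^ 2 - C (reverseTime * algebraMap ℝ C(unitInterval, ℝ) (2 * z.re)) * X +
        C (reverseTime ^ 2 * algebraMap ℝ C(unitInterval, ℝ) (‖z‖ ^ 2))) * Φ, a, b, L, c, d + 2, hL,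
        fun s => ?_, ?_, ?_⟩
      · rw [Polynomial.map_mul]
        refine hno (fun w hw h => ?_) (hΦ s)
        set u : ℂ := ((reverseTime s : ℝ) : ℂ) * z with hu
        have hlt : ‖u‖ < 1 := (norm_reverseTime_mul_le s z).trans_lt hx
        have he : (w - u) * (w - starRingEnd ℂ u) = 0 := by
          rw [sub_mul_sub_conj, ← h, hu, norm_mul, mul_pow, Complex.norm_real, Real.norm_eq_abs,
            sq_abs, Complex.re_ofReal_mul]
          simp
          exact Or.inl (by ring)
        rcases mul_eq_zero.mp he with he | he
        · rw [← sub_eq_zero.mp he, hw] at hlt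
          exact hlt.false
        · rw [← RCLike.norm_conj, ← sub_eq_zero.mp he, hw] at hlt
          exact hlt.false
      · rw [h0, Polynomial.map_mul]
        simp [reverseTime_apply, mul_assoc]
      · rw [Polynomial.map_mul, h1]
        simp [reverseTime_apply]
        ring
    · refine ⟨Φ, a, b, z.re ::ₘ L, c, d, ?_, hΦ, ?_, h1⟩
      · intro x hxL
        rcases Multiset.mem_cons.mp hxL with rfl | hxL
        · have h2 := Complex.sq_norm z
          rw [Complex.normSq_apply, hx] at h2
          have h3 : 0 < z.im * z.im := mul_self_pos.mpr hz
          constructor <;> nlinarith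
        · exact hL x hxL
      · rw [circleFactor_cons, h0, hx, conjPair]
        simp
        ring
    · refine ⟨(C (reverseTime ^ 2) * X ^ 2 -
        C (reverseTime * algebraMap ℝ C(unitInterval, ℝ) (2 * z.re)) * X +
        C (algebraMap ℝ C(unitInterval, ℝ) (‖z‖ ^ 2))) * Φ, a, b, L, ‖z‖ ^ 2 * c, d, hL,
        fun s => ?_, ?_, ?_⟩
      · rw [Polynomial.map_mul]
        refine hno (fun w hw h => ?_) (hΦ s)
        set u : ℂ := ((reverseTime s : ℝ) : ℂ) * w with hu
        have hle : ‖u‖ ≤ 1 := (norm_reverseTime_mul_le s w).trans_eq hw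
        have he : (u - z) * (u - starRingEnd ℂ z) = 0 := by
          rw [sub_mul_sub_conj, ← h, hu]
          simp
          ring
        rcases mul_eq_zero.mp he with he | he
        · rw [sub_eq_zero.mp he] at hle
          linarith
        · rw [sub_eq_zero.mp he, RCLike.norm_conj] at hle
          linarith
      · rw [h0, Polynomial.map_mul]
        simp [reverseTime_apply, mul_assoc]
      · rw [Polynomial.map_mul, h1]
        simp [reverseTime_apply]
        ring

end MoveRoots

/-! ### Deformation classes of Laurent polynomials -/

section Deform
open Polynomial

/-- Two Laurent polynomials are the ends of a path of Laurent polynomials with simple zeros on the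
unit circle, in constant number. -/
def Deform (p q : ℝ[T;T⁻¹]) : Prop :=
  ∃ P : C(unitInterval, ℝ)[T;T⁻¹], pathAt 0 P = p ∧ pathAt 1 P = q ∧
    (∀ s, SimpleCirc (pathAt s P)) ∧ ∀ s, circ (pathAt s P) = circ p

/-- The Laurent polynomial `c z^ω` times a polynomial whose zeros are simple and on the unit
circle. -/
noncomputable def normalForm (c : ℝ) (ω : ℤ) (a b : ℕ) (L : Multiset ℝ) : ℝ[T;T⁻¹] :=
  LaurentPolynomial.C c * LaurentPolynomial.T ω * toLaurent (circleFactor a b L)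

variable {c : ℝ} {ω : ℤ} {a b : ℕ} {L : Multiset ℝ}

theorem isUnit_C_mul_T (hc : c ≠ 0) (ω : ℤ) :
    IsUnit (LaurentPolynomial.C c * LaurentPolynomial.T ω : ℝ[T;T⁻¹]) :=
  (isUnit_C hc).mul (LaurentPolynomial.isUnit_T ω)

theorem simpleCirc_normalForm (hc : c ≠ 0) (hL : ∀ x ∈ L, x ∈ Set.Ioo (-1 : ℝ) 1) :
    SimpleCirc (normalForm c ω a b L) ↔ a ≤ 1 ∧ b ≤ 1 ∧ L.Nodup := by
  rw [normalForm, (noCirc_of_isUnit (isUnit_C_mul_T hc ω)).simpleCirc_mul,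
    simpleCirc_circleFactor hL]

theorem circ_normalForm (hc : c ≠ 0) (hL : ∀ x ∈ L, x ∈ Set.Ioo (-1 : ℝ) 1) :
    circ (normalForm c ω a b L) = a + b + 2 * L.card := by
  rw [normalForm, (noCirc_of_isUnit (isUnit_C_mul_T hc ω)).circ_mul,
    circ_toLaurent (circleFactor_ne_zero hL)]
  exact (rootCount_circleFactor (· = 1) hL).trans (if_pos rfl)

theorem ind_normalForm (hc : c ≠ 0) (hL : ∀ x ∈ L, x ∈ Set.Ioo (-1 : ℝ) 1) :
    ind (normalForm c ω a b L) = ω := by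
  rw [normalForm, ind_mul (isUnit_C_mul_T hc ω).ne_zero (by simpa using circleFactor_ne_zero hL),
    ind_mul (isUnit_C hc).ne_zero (T_ne_zero ω), ind_C hc, ind_T,
    ind_toLaurent (circleFactor_ne_zero hL)]
  have := rootCount_circleFactor (a := a) (b := b) (· < 1) hL
  rw [if_neg (lt_irrefl _)] at this
  change (0 + ω) + ((rootCount (· < 1) _ : ℕ) : ℤ) = ω
  rw [this]
  simp

theorem signs_mul_T (p : ℝ[T;T⁻¹]) (n : ℤ) : signs (p * LaurentPolynomial.T n) = signs p := by
  have key : ∀ (p : ℝ[T;T⁻¹]) (n : ℕ), signs (p * LaurentPolynomial.T n) = signs p := by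
    intro p n
    rw [signs_eq (p := p * LaurentPolynomial.T n) (P := numer p * X ^ n) (m := den p),
      polySigns_mul_X_pow]
    · rfl
    · rw [map_mul, toLaurent_numer, toLaurent_X_pow]
      ring
  obtain ⟨k, rfl | rfl⟩ := n.eq_nat_or_neg
  · exact key p k
  · rw [← key _ k, mul_assoc, ← LaurentPolynomial.T_add, neg_add_cancel, LaurentPolynomial.T_zero,
      mul_one]

theorem signs_toLaurent (P : ℝ[X]) : signs (toLaurent P) = polySigns P :=
  signs_eq (m := 0) (by simp)

theorem signs_normalForm (hc : c ≠ 0) (ha : a ≤ 1) (hL : ∀ x ∈ L, x ∈ Set.Ioo (-1 : ℝ) 1) :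
    signs (normalForm c ω a b L) = (unitSign c, (-1) ^ a) := by
  have : normalForm c ω a b L
      = toLaurent (C c * circleFactor a b L) * LaurentPolynomial.T ω := by
    rw [normalForm, map_mul, toLaurent_C]
    ring
  rw [this, signs_mul_T, signs_toLaurent, polySigns_C_mul_circleFactor hc ha hL]

/-- The discrete data of a Laurent polynomial which do not change in a deformation. -/
theorem Deform.invariants {p q : ℝ[T;T⁻¹]} (h : Deform p q) :
    SimpleCirc p ∧ SimpleCirc q ∧ circ p = circ q ∧ ind p = ind q ∧ signs p = signs q := by
  obtain ⟨P, rfl, rfl, hs, hc⟩ := h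
  exact ⟨hs 0, hs 1, (hc 1).symm, (ind_pathAt (fun s => (hs s).1) hc 1).symm,
    (signs_pathAt hs hc 1).symm⟩

/-- Every Laurent polynomial with simple zeros on the unit circle is deformed to a normal form by moving
its other zeros to the origin and to infinity. -/
theorem deform_normalForm {p : ℝ[T;T⁻¹]} (hp : SimpleCirc p) :
    ∃ (c : ℝ) (ω : ℤ) (a b : ℕ) (L : Multiset ℝ), c ≠ 0 ∧ a ≤ 1 ∧ b ≤ 1 ∧ L.Nodup ∧
      (∀ x ∈ L, x ∈ Set.Ioo (-1 : ℝ) 1) ∧ Deform p (normalForm c ω a b L) := by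
  have hne : numer p ≠ 0 := fun h => map_numer_ne_zero hp.1 (by rw [h, Polynomial.map_zero])
  obtain ⟨Φ, a, b, L, c, d, hL, hΦ, h0, h1⟩ := exists_move_roots (numer p) hne
  set m := den p with hm
  set q : ℝ[T;T⁻¹] := LaurentPolynomial.T (-m : ℤ) * toLaurent (circleFactor a b L) with hq
  have hpath : ∀ s, pathAt s (toLaurent Φ * constPath q) = toLaurent (Φ.map (atTime s)) * q := by
    intro s
    rw [map_mul, pathAt_toLaurent, pathAt_constPath]
  have hp0 : toLaurent (Φ.map (atTime 0)) * q = p := by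
    have : p = toLaurent (numer p) * LaurentPolynomial.T (-m : ℤ) := by
      rw [toLaurent_numer, mul_assoc, ← LaurentPolynomial.T_add, hm, add_neg_cancel,
        LaurentPolynomial.T_zero, mul_one]
    conv_rhs => rw [this, h0, map_mul]
    rw [hq]
    ring
  have hc : c ≠ 0 := by
    rintro rfl
    refine (hΦ 1).ne_zero ?_
    rw [h1, C_0, zero_mul, map_zero]
  have hp1 : toLaurent (Φ.map (atTime 1)) * q = normalForm c (d - m) a b L := by
    rw [h1, hq, normalForm, map_mul, toLaurent_C, toLaurent_X_pow, sub_eq_add_neg,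
      LaurentPolynomial.T_add]
    ring
  have hdef : Deform p (normalForm c (d - m) a b L) := by
    refine ⟨toLaurent Φ * constPath q, by rw [hpath, hp0], by rw [hpath, hp1], fun s => ?_,
      fun s => ?_⟩
    · rw [hpath, (hΦ s).simpleCirc_mul, ← (hΦ 0).simpleCirc_mul, hp0]
      exact hp
    · rw [hpath, (hΦ s).circ_mul, ← (hΦ 0).circ_mul, hp0]
  -- the normal form has simple zeros on the circle like `p`, which bounds `a` and `b` and makes `L`
  -- duplicate-free
  obtain ⟨ha, hb, hnd⟩ := (simpleCirc_normalForm hc hL).mp hdef.invariants.2.1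
  exact ⟨c, _, a, b, L, hc, ha, hb, hnd, hL, hdef⟩

/-- The linear path from `x` to `y`. -/
def linePath (x y : ℝ) : C(unitInterval, ℝ) :=
  reverseTime * algebraMap ℝ C(unitInterval, ℝ) x + timeMap * algebraMap ℝ C(unitInterval, ℝ) y

theorem linePath_apply (x y : ℝ) (s : unitInterval) :
    linePath x y s = (1 - (s : ℝ)) * x + s * y := rfl

theorem convex_comb_pos {x y : ℝ} (hx : 0 < x) (hy : 0 < y) (s : unitInterval) :
    0 < (1 - (s : ℝ)) * x + s * y := by
  have h0 := s.2.1
  have h1 := s.2.2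
  rcases eq_or_lt_of_le h0 with h | h
  · rw [← h]
    simpa using hx
  · have : 0 < (s : ℝ) * y := mul_pos h hy
    have : 0 ≤ (1 - (s : ℝ)) * x := mul_nonneg (by linarith) hx.le
    linarith

theorem exists_strictMono_of_nodup {L : Multiset ℝ} (h : L.Nodup) {m : ℕ} (hm : L.card = m) :
    ∃ f : Fin m → ℝ, StrictMono f ∧ Finset.univ.val.map f = L := by
  classical
  have hcard : L.toFinset.card = m := (Multiset.toFinset_card_of_nodup h).trans hm
  refine ⟨L.toFinset.orderEmbOfFin hcard, OrderEmbedding.strictMono _, ?_⟩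
  have := congrArg Finset.val (L.toFinset.map_orderEmbOfFin_univ hcard)
  rw [Finset.map_val, Multiset.toFinset_val, h.dedup] at this
  exact this

/-- Two normal forms with the same discrete data are connected by moving the zeros along the unit
circle, keeping their order. -/
theorem deform_normalForm_normalForm {c c' : ℝ} {L L' : Multiset ℝ} (hc : c ≠ 0) (hc' : c' ≠ 0)
    (hcc : unitSign c = unitSign c') (ha : a ≤ 1) (hb : b ≤ 1) (hnd : L.Nodup) (hnd' : L'.Nodup)
    (hcard : L.card = L'.card) (hL : ∀ x ∈ L, x ∈ Set.Ioo (-1 : ℝ) 1)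
    (hL' : ∀ x ∈ L', x ∈ Set.Ioo (-1 : ℝ) 1) :
    Deform (normalForm c ω a b L) (normalForm c' ω a b L') := by
  obtain ⟨f, hf, hfL⟩ := exists_strictMono_of_nodup hnd hcard
  obtain ⟨f', hf', hfL'⟩ := exists_strictMono_of_nodup hnd' rfl
  have hfI : ∀ i, f i ∈ Set.Ioo (-1 : ℝ) 1 := fun i =>
    hL _ (hfL ▸ Multiset.mem_map_of_mem f (Finset.mem_univ_val i))
  have hfI' : ∀ i, f' i ∈ Set.Ioo (-1 : ℝ) 1 := fun i =>
    hL' _ (hfL' ▸ Multiset.mem_map_of_mem f' (Finset.mem_univ_val i))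
  -- the real parts of the zeros, in increasing order, move linearly; they remain distinct because linear
  -- interpolation is monotone
  set g : unitInterval → Fin L'.card → ℝ := fun s i => linePath (f i) (f' i) s with hg
  have hgI : ∀ s, ∀ x ∈ Finset.univ.val.map (g s), x ∈ Set.Ioo (-1 : ℝ) 1 := by
    intro s x hx
    obtain ⟨i, -, rfl⟩ := Multiset.mem_map.mp hx
    have h1 := convex_comb_pos (x := f i + 1) (y := f' i + 1) (by linarith [(hfI i).1])
      (by linarith [(hfI' i).1]) s
    have h2 := convex_comb_pos (x := 1 - f i) (y := 1 - f' i) (by linarith [(hfI i).2])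
      (by linarith [(hfI' i).2]) s
    simp only [hg, linePath_apply]
    constructor <;> nlinarith
  have hgnd : ∀ s, (Finset.univ.val.map (g s)).Nodup := by
    intro s
    have hmono : StrictMono (g s) := fun i j hij => by
      have := convex_comb_pos (x := f j - f i) (y := f' j - f' i) (sub_pos.mpr (hf hij))
        (sub_pos.mpr (hf' hij)) s
      simp only [hg, linePath_apply]
      linarith
    exact Multiset.Nodup.map hmono.injective Finset.univ.nodup
  have hcs : ∀ s, linePath c c' s ≠ 0 := by
    intro s
    rw [linePath_apply]
    rcases lt_or_gt_of_ne hc with h | h <;> rcases lt_or_gt_of_ne hc' with h' | h'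
    · have := convex_comb_pos (neg_pos.mpr h) (neg_pos.mpr h') s
      intro h0
      linarith
    · simp [unitSign, h.not_gt, h'] at hcc
    · simp [unitSign, h'.not_gt, h] at hcc
    · exact (convex_comb_pos h h' s).ne'
  have hpath : ∀ s, pathAt s (LaurentPolynomial.C (linePath c c') * LaurentPolynomial.T ω *
      toLaurent ((X - C 1) ^ a * (X - C (-1)) ^ b *
        ∏ i, (X ^ 2 - C (2 * linePath (f i) (f' i)) * X + 1)))
      = normalForm (linePath c c' s) ω a b (Finset.univ.val.map (g s)) := by
    intro s
    rw [map_mul, map_mul, pathAt_C, pathAt_T, pathAt_toLaurent, normalForm, circleFactor,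
      Multiset.map_map, ← Finset.prod_eq_multiset_prod, Polynomial.map_mul, Polynomial.map_mul,
      Polynomial.map_prod]
    have htwo : (2 : C(unitInterval, ℝ)) s = 2 := rfl
    simp [conjPair, hg, htwo]
  have h0 : g 0 = f := funext fun i => by simp [hg, linePath_apply]
  have h1 : g 1 = f' := funext fun i => by simp [hg, linePath_apply]
  refine ⟨_, (hpath 0).trans ?_, (hpath 1).trans ?_, fun s => ?_, fun s => ?_⟩
  · rw [h0, hfL, linePath_apply]
    simp
  · rw [h1, hfL', linePath_apply]
    simp
  · rw [hpath, simpleCirc_normalForm (hcs s) (hgI s)]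
    exact ⟨ha, hb, hgnd s⟩
  · rw [hpath, circ_normalForm (hcs s) (hgI s), circ_normalForm hc hL]
    simp [hcard]

/-- Laurent polynomials with simple zeros on the unit circle are classified, up to deformation, by
the number of these zeros, the index and the two signs. -/
theorem exists_deform {p q : ℝ[T;T⁻¹]} (hp : SimpleCirc p) (hq : SimpleCirc q)
    (hcirc : circ p = circ q) (hind : ind p = ind q) (hsigns : signs p = signs q) :
    ∃ p' q', Deform p p' ∧ Deform p' q' ∧ Deform q q' := by
  obtain ⟨c, ω, a, b, L, hc, ha, hb, hnd, hL, h⟩ := deform_normalForm hp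
  obtain ⟨c', ω', a', b', L', hc', ha', hb', hnd', hL', h'⟩ := deform_normalForm hq
  refine ⟨_, _, h, ?_, h'⟩
  obtain ⟨-, -, e1, e2, e3⟩ := h.invariants
  obtain ⟨-, -, e1', e2', e3'⟩ := h'.invariants
  rw [circ_normalForm hc hL] at e1
  rw [circ_normalForm hc' hL'] at e1'
  rw [ind_normalForm hc hL] at e2
  rw [ind_normalForm hc' hL'] at e2'
  rw [signs_normalForm hc ha hL] at e3
  rw [signs_normalForm hc' ha' hL'] at e3'
  obtain ⟨e4, e5⟩ := Prod.ext_iff.mp (e3.symm.trans (hsigns.trans e3'))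
  have haa : a = a' := by
    interval_cases a <;> interval_cases a' <;> simp_all
  subst haa
  have hbb : b = b' := by omega
  subst hbb
  obtain rfl : ω = ω' := by omega
  exact deform_normalForm_normalForm hc hc' e4 ha hb hnd hnd' (by omega) hL hL'

end Deform

/-! ### Canonical Laurent polynomials -/

section Canonical
open Polynomial

theorem circ_prod {ι : Type*} (s : Finset ι) {d : ι → ℝ[T;T⁻¹]} (h : ∀ i ∈ s, d i ≠ 0) :
    circ (∏ i ∈ s, d i) = ∑ i ∈ s, circ (d i) := by
  classical
  induction s using Finset.induction_on with
  | empty => simp [circ_one]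
  | insert a s ha ih =>
    rw [Finset.prod_insert ha, Finset.sum_insert ha, circ_mul (h a (Finset.mem_insert_self a s))
      (Finset.prod_ne_zero_iff.mpr fun i hi => h i (Finset.mem_insert_of_mem hi)),
      ih fun i hi => h i (Finset.mem_insert_of_mem hi)]

theorem ind_prod {ι : Type*} (s : Finset ι) {d : ι → ℝ[T;T⁻¹]} (h : ∀ i ∈ s, d i ≠ 0) :
    ind (∏ i ∈ s, d i) = ∑ i ∈ s, ind (d i) := by
  classical
  induction s using Finset.induction_on with
  | empty => simp [ind_one]
  | insert a s ha ih =>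
    rw [Finset.prod_insert ha, Finset.sum_insert ha, ind_mul (h a (Finset.mem_insert_self a s))
      (Finset.prod_ne_zero_iff.mpr fun i hi => h i (Finset.mem_insert_of_mem hi)),
      ih fun i hi => h i (Finset.mem_insert_of_mem hi)]

theorem isRoot_numer_iff {p : ℝ[T;T⁻¹]} (z : ℂˣ) :
    ((numer p).map (algebraMap ℝ ℂ)).IsRoot (z : ℂ) ↔ lval z p = 0 := by
  rw [IsRoot, ← lval_mul_pow (toLaurent_numer p)]
  simp

/-- The real number `±1`. -/
noncomputable def signVal (σ : ℤˣ) : ℝ := ((σ : ℤ) : ℝ)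

theorem signVal_ne_zero (σ : ℤˣ) : signVal σ ≠ 0 := by
  rcases Int.units_eq_one_or σ with rfl | rfl <;> simp [signVal]

/-- The polynomial `± (z ^ n ± 1) z ^ ω`. -/
noncomputable def critPoly (n : ℕ) (ω : ℤ) (σ : ℤˣ × ℤˣ) : ℝ[T;T⁻¹] :=
  toLaurent (C (signVal σ.1) * (X ^ n + C (signVal σ.2))) * LaurentPolynomial.T ω

variable {n : ℕ}

theorem pow_add_ne_zero (hn : 0 < n) (σ : ℤˣ) : (X ^ n + C (signVal σ) : ℝ[X]) ≠ 0 :=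
  X_pow_add_C_ne_zero hn _

theorem separable_pow_add (hn : 0 < n) (σ : ℤˣ) : (X ^ n + C (signVal σ) : ℝ[X]).Separable := by
  have := separable_X_pow_sub_C (-signVal σ) (by exact_mod_cast hn.ne' : (n : ℝ) ≠ 0)
    (neg_ne_zero.mpr (signVal_ne_zero σ))
  rwa [C_neg, sub_neg_eq_add] at this

theorem rootCount_pow_add (p : ℝ → Prop) [DecidablePred p] (hn : 0 < n) (σ : ℤˣ) :
    rootCount p ((X ^ n + C (signVal σ) : ℝ[X]).map (algebraMap ℝ ℂ)) = if p 1 then n else 0 := by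
  rw [rootCount_of_forall p (r := 1), natDegree_map, natDegree_X_pow_add_C]
  intro z hz
  have h : z ^ n = -((signVal σ : ℝ) : ℂ) := by
    simpa [IsRoot, add_eq_zero_iff_eq_neg] using hz
  have h2 := congrArg norm h
  rw [norm_pow, norm_neg, Complex.norm_real] at h2
  have h3 : ‖signVal σ‖ = 1 := by
    rcases Int.units_eq_one_or σ with rfl | rfl <;> simp [signVal]
  rw [h3] at h2
  exact (pow_eq_one_iff_of_nonneg (norm_nonneg z) hn.ne').mp h2

theorem noCirc_sign (σ : ℤˣ) : NoCirc (toLaurent (C (signVal σ))) := by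
  rw [toLaurent_C]
  exact noCirc_of_isUnit (isUnit_C (signVal_ne_zero σ))

theorem critPoly_eq (n : ℕ) (ω : ℤ) (σ : ℤˣ × ℤˣ) : critPoly n ω σ =
    (toLaurent (C (signVal σ.1)) * LaurentPolynomial.T ω) *
      toLaurent (X ^ n + C (signVal σ.2)) := by
  rw [critPoly, map_mul]; ring

theorem simpleCirc_critPoly (hn : 0 < n) (ω : ℤ) (σ : ℤˣ × ℤˣ) : SimpleCirc (critPoly n ω σ) := by
  rw [critPoly_eq, ((noCirc_sign σ.1).mul
    (noCirc_of_isUnit (LaurentPolynomial.isUnit_T ω))).simpleCirc_mul,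
    simpleCirc_iff (m := 0) (P := X ^ n + C (signVal σ.2))
      (by simpa only [ne_eq, toLaurent_eq_zero] using pow_add_ne_zero hn σ.2) (by simp)]
  exact fun z _ => rootMultiplicity_le_one_of_separable (separable_pow_add hn σ.2).map z

theorem circ_critPoly (hn : 0 < n) (ω : ℤ) (σ : ℤˣ × ℤˣ) : circ (critPoly n ω σ) = n := by
  rw [critPoly_eq, ((noCirc_sign σ.1).mul
    (noCirc_of_isUnit (LaurentPolynomial.isUnit_T ω))).circ_mul,
    circ_toLaurent (pow_add_ne_zero hn σ.2)]
  exact (rootCount_pow_add (· = 1) hn σ.2).trans (if_pos rfl)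

theorem ind_critPoly (hn : 0 < n) (ω : ℤ) (σ : ℤˣ × ℤˣ) : ind (critPoly n ω σ) = ω := by
  rw [critPoly_eq, toLaurent_C, ind_mul (isUnit_C_mul_T (signVal_ne_zero σ.1) ω).ne_zero
    (by simpa only [ne_eq, toLaurent_eq_zero] using pow_add_ne_zero hn σ.2),
    ind_mul (isUnit_C (signVal_ne_zero σ.1)).ne_zero (T_ne_zero ω), ind_C (signVal_ne_zero σ.1),
    ind_T, ind_toLaurent (pow_add_ne_zero hn σ.2)]
  have := rootCount_pow_add (· < 1) hn σ.2
  rw [if_neg (lt_irrefl _)] at this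
  change (0 + ω) + ((rootCount (· < 1) _ : ℕ) : ℤ) = ω
  rw [this]
  simp

theorem signs_critPoly (hn : 0 < n) (ω : ℤ) (σ : ℤˣ × ℤˣ) : signs (critPoly n ω σ) = σ := by
  rw [critPoly, signs_mul_T, signs_toLaurent, polySigns]
  obtain ⟨σ, τ⟩ := σ
  have hn' : (0 : ℝ) < n := by exact_mod_cast hn
  rcases Int.units_eq_one_or τ with rfl | rfl
  · have h1 : (C (signVal σ) * (X ^ n + C (signVal 1))).eval 1 = 2 * signVal σ := by
      simp [signVal]; ring
    rw [h1, if_neg (mul_ne_zero two_ne_zero (signVal_ne_zero σ)),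
      unitSign_mul_of_pos two_pos, signVal, unitSign_units]
  · have h1 : (C (signVal σ) * (X ^ n + C (signVal (-1)))).eval 1 = 0 := by
      simp [signVal]
    have h2 : (C (signVal σ) * (X ^ n + C (signVal (-1)))).derivative.eval 1 = n * signVal σ := by
      simp [derivative_X_pow, mul_comm]
    rw [h1, if_pos rfl, h2, unitSign_mul_of_pos hn', signVal, unitSign_units]

/-- The Laurent polynomial `± z ^ ω (z - 1) ^ n`. -/
noncomputable def basicPoly (σ : ℤˣ) (ω : ℤ) (n : ℕ) : ℝ[T;T⁻¹] := normalForm (signVal σ) ω n 0 0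

theorem simpleCirc_basicPoly (σ : ℤˣ) (ω : ℤ) (hn : n ≤ 1) : SimpleCirc (basicPoly σ ω n) :=
  (simpleCirc_normalForm (signVal_ne_zero σ) (by simp)).mpr ⟨hn, zero_le_one, Multiset.nodup_zero⟩

theorem circ_basicPoly (σ : ℤˣ) (ω : ℤ) (n : ℕ) : circ (basicPoly σ ω n) = n := by
  simpa [basicPoly] using circ_normalForm (ω := ω) (a := n) (b := 0) (signVal_ne_zero σ) (L := 0) (by simp)

theorem ind_basicPoly (σ : ℤˣ) (ω : ℤ) (n : ℕ) : ind (basicPoly σ ω n) = ω :=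
  ind_normalForm (signVal_ne_zero σ) (by simp)

theorem signs_basicPoly (σ : ℤˣ) (ω : ℤ) (hn : n ≤ 1) :
    signs (basicPoly σ ω n) = (σ, (-1) ^ n) := by
  rw [basicPoly, signs_normalForm (signVal_ne_zero σ) hn (by simp), signVal, unitSign_units]

theorem SimpleCirc.signs_of_circ_eq_zero {p : ℝ[T;T⁻¹]} (hp : SimpleCirc p) (h : circ p = 0) :
    (signs p).2 = 1 := by
  rw [signs, polySigns]
  have : (numer p).eval 1 ≠ 0 := by
    intro h1
    rw [← isRoot_map_one_iff] at h1
    rw [circ, circCount, Multiset.card_eq_zero, Multiset.filter_eq_nil] at h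
    exact h 1 ((mem_roots (map_numer_ne_zero hp.1)).mpr h1) (by simp)
  rw [if_neg this]

/-- A Laurent polynomial with simple zeros on the unit circle, none of them different from `1`. -/
theorem SimpleCirc.circ_le_one {p : ℝ[T;T⁻¹]} (hp : SimpleCirc p)
    (h : ∀ z : ℂˣ, ‖(z : ℂ)‖ = 1 → lval z p = 0 → z = 1) :
    circ p ≤ 1 ∧ (signs p).2 = (-1) ^ circ p := by
  have hroot : ∀ z ∈ ((numer p).map (algebraMap ℝ ℂ)).roots.filter (‖·‖ = 1), z = 1 := by
    intro z hz
    obtain ⟨hz, hz1⟩ := Multiset.mem_filter.mp hz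
    have hz0 : z ≠ 0 := by rintro rfl; simp at hz1
    have := h (Units.mk0 z hz0) hz1 ((isRoot_numer_iff _).mp (mem_roots'.mp hz).2)
    exact congrArg Units.val this
  have hrep := Multiset.eq_replicate_card.mpr hroot
  have hle : circ p ≤ 1 := by
    classical
    have h1 : (((numer p).map (algebraMap ℝ ℂ)).roots.filter (‖·‖ = 1)).count 1 = circ p := by
      rw [hrep, Multiset.count_replicate_self]
      rfl
    rw [← h1, Multiset.count_filter_of_pos (by simp), count_roots]
    exact hp.2 1 (by simp)
  refine ⟨hle, ?_⟩
  rcases Nat.le_one_iff_eq_zero_or_eq_one.mp hle with h0 | h0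
  · rw [hp.signs_of_circ_eq_zero h0, h0, pow_zero]
  · have hmem : (1 : ℂ) ∈ ((numer p).map (algebraMap ℝ ℂ)).roots := by
      have : (1 : ℂ) ∈ ((numer p).map (algebraMap ℝ ℂ)).roots.filter (‖·‖ = 1) := by
        rw [hrep]
        exact Multiset.mem_replicate.mpr ⟨by
          change circ p ≠ 0
          omega, rfl⟩
      exact (Multiset.mem_filter.mp this).1
    rw [signs, polySigns, if_pos ((isRoot_map_one_iff _).mp (mem_roots'.mp hmem).2), h0, pow_one]

end Canonical

/-! ### Decoupled chains -/

section Diagonal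
open Matrix

variable {N : ℕ} (hN : 0 < N)

/-- The diagonal entries of a decoupled chain can be deformed simultaneously. -/
theorem exists_path_diagonal {d d' : Fin N → ℝ[T;T⁻¹]} (h : ∀ i, Deform (d i) (d' i)) :
    ∃ γ, IsPhasePath γ ∧ (∀ s, (γ s).cell = N) ∧ γ 0 = ofMat hN (diagonal d) ∧
      γ 1 = ofMat hN (diagonal d') := by
  choose P h0 h1 hs hc using h
  have hdiag : ∀ s, matAt s (diagonal P) = diagonal fun i => pathAt s (P i) := fun s => by
    rw [matAt, RingHom.mapMatrix_apply, diagonal_map (map_zero _)]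
  refine ⟨_, isPhasePath_ofMat hN (diagonal P) (fun s => ?_) (fun s => ?_), fun s => rfl, ?_, ?_⟩
  · rw [hdiag, linearGap_diagonal]
    exact fun i => hs i s
  · rw [hdiag, hdiag, det_diagonal, det_diagonal, circ_prod _ fun i _ => (hs i s).1,
      circ_prod _ fun i _ => (hs i 0).1]
    exact Finset.sum_congr rfl fun i _ => by rw [hc, hc]
  · simp only [hdiag, h0]
  · simp only [hdiag, h1]

theorem connected_diagonal {d d' : Fin N → ℝ[T;T⁻¹]} (h : ∀ i, SimpleCirc (d i))
    (h' : ∀ i, SimpleCirc (d' i)) (hc : ∀ i, circ (d i) = circ (d' i))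
    (hi : ∀ i, ind (d i) = ind (d' i)) (hs : ∀ i, signs (d i) = signs (d' i)) :
    Connected (ofMat hN (diagonal d)) (ofMat hN (diagonal d')) := by
  choose e e' h1 h2 h3 using fun i => exists_deform (h i) (h' i) (hc i) (hi i) (hs i)
  have key : ∀ {d d' : Fin N → ℝ[T;T⁻¹]}, (∀ i, Deform (d i) (d' i)) →
      Connected (ofMat hN (diagonal d)) (ofMat hN (diagonal d')) := fun h => by
    obtain ⟨γ, hγ, -, e0, e1⟩ := exists_path_diagonal hN h
    exact ⟨γ, hγ, by rw [e0], by rw [e1]⟩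
  exact (key h1).trans ((key h2).trans (key h3).symm)

/-- A chain with a CFT bulk is connected to a decoupled one. -/
theorem IsCFT.exists_connected_diagonal {X : BDIChain} (h : X.IsCFT) :
    ∃ d : Fin X.cell → ℝ[T;T⁻¹], (∀ i, SimpleCirc (d i)) ∧ ∏ i, d i = X.lmat.det ∧
      Connected X (ofMat X.cell_pos (diagonal d)) := by
  obtain ⟨d, hd⟩ := exists_elemEquiv_diagonal_laurent X.lmat
  have hgap : LinearGap (symbol X.lmat) := (isCFT_iff X).mp h
  obtain ⟨h1, h2⟩ := hd.connected X.cell_pos hgap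
  rw [ofMat_lmat] at h2
  exact ⟨d, (linearGap_diagonal d).mp h1, by rw [← hd.det_eq, det_diagonal], h2⟩

/-- Every chain with CFT bulk is connected to a diagonal one with entries `± z ^ ω (z ^ n ± 1)` and
`± z ^ ω`, so that its zeros on the unit circle are roots of unity. -/
theorem IsCFT.exists_connected_rootsOfUnity {X : BDIChain} (h : X.IsCFT) :
    ∃ q : Fin X.cell → ℝ[T;T⁻¹], Connected X (ofMat X.cell_pos (diagonal q)) ∧
      ∀ (i : Fin X.cell) (z : ℂˣ), lval z (q i) = 0 → z ^ (2 * (circ X.lmat.det).factorial) = 1 := by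
  obtain ⟨d, hd, hdet, hcon⟩ := h.exists_connected_diagonal
  refine ⟨fun i => if circ (d i) = 0 then basicPoly (signs (d i)).1 (ind (d i)) 0
    else critPoly (circ (d i)) (ind (d i)) (signs (d i)), hcon.trans
      (connected_diagonal _ hd (fun i => ?_) (fun i => ?_) (fun i => ?_) fun i => ?_), ?_⟩
  · split_ifs with h0
    · exact simpleCirc_basicPoly _ _ zero_le_one
    · exact simpleCirc_critPoly (Nat.pos_of_ne_zero h0) _ _
  · split_ifs with h0
    · rw [circ_basicPoly, h0]
    · rw [circ_critPoly (Nat.pos_of_ne_zero h0)]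
  · split_ifs with h0
    · rw [ind_basicPoly]
    · rw [ind_critPoly (Nat.pos_of_ne_zero h0)]
  · split_ifs with h0
    · rw [signs_basicPoly _ _ zero_le_one, pow_zero, ← (hd i).signs_of_circ_eq_zero h0]
    · rw [signs_critPoly (Nat.pos_of_ne_zero h0)]
  · intro i z hz
    by_cases h0 : circ (d i) = 0
    · simp only [if_pos h0] at hz
      exact absurd hz (by
        have := (isUnit_C_mul_T (signVal_ne_zero (signs (d i)).1) (ind (d i))).map (lval z)
        simpa [basicPoly, normalForm, circleFactor] using this.ne_zero)
    · simp only [if_neg h0] at hz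
      -- `circ (d i)` is at most the number of all zeros on the circle, so it divides the factorial
      have hdvd : circ (d i) ∣ (circ X.lmat.det).factorial := by
        refine Nat.dvd_factorial (Nat.pos_of_ne_zero h0) ?_
        rw [← hdet, circ_prod _ fun i _ => (hd i).1]
        exact Finset.single_le_sum (f := fun i => circ (d i)) (fun _ _ => Nat.zero_le _)
          (Finset.mem_univ i)
      have hz' : (z : ℂ) ^ circ (d i) = -((signVal (signs (d i)).2 : ℝ) : ℂ) := by
        rw [critPoly_eq, Polynomial.toLaurent_C, map_mul, mul_eq_zero] at hz
        have := hz.resolve_left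
          ((isUnit_C_mul_T (signVal_ne_zero (signs (d i)).1) (ind (d i))).map (lval z)).ne_zero
        rw [lval_toLaurent] at this
        simpa [add_eq_zero_iff_eq_neg] using this
      have hz2 : (z : ℂ) ^ (2 * circ (d i)) = 1 := by
        rw [mul_comm, pow_mul, hz']
        rcases Int.units_eq_one_or (signs (d i)).2 with h | h <;> rw [h] <;> simp [signVal]
      obtain ⟨r, hr⟩ := hdvd
      rw [hr, ← mul_assoc, pow_mul]
      have : z ^ (2 * circ (d i)) = 1 := Units.ext (by simpa using hz2)
      rw [this, one_pow]

/-- If the unit cell is enlarged suitably, then all zeros on the unit circle move to `1`; hence the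
chain is connected to a decoupled stack of chains with `f(z) = ± z ^ ω` or `f(z) = ± z ^ ω (z - 1)`. -/
theorem IsCFT.exists_connected_basic {X : BDIChain} (h : X.IsCFT) {k : ℕ} (hk : 0 < k)
    (hdvd : 2 * (circ X.lmat.det).factorial ∣ k) {K : ℕ} (hK : 0 < K) (hKX : K = k * X.cell) :
    ∃ (σ : Fin K → ℤˣ) (ω : Fin K → ℤ) (n : Fin K → ℕ), (∀ i, n i ≤ 1) ∧
      Connected X (ofMat hK (diagonal fun i => basicPoly (σ i) (ω i) (n i))) := by
  subst hKX
  obtain ⟨q, hcon, hq⟩ := h.exists_connected_rootsOfUnity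
  set Y := ofMat X.cell_pos (diagonal q) with hY
  have hYCFT : Y.IsCFT := hcon.invariants.2.1
  have hdetY : Y.lmat.det = ∏ i, q i := by
    rw [hY, lmat_ofMat]
    exact det_diagonal
  have hrec : (Y.recell k hk).IsCFT := (isCFT_recell Y hk).mpr hYCFT
  obtain ⟨e, he, hedet, hecon⟩ := hrec.exists_connected_diagonal
  have hone : ∀ i (z : ℂˣ), ‖(z : ℂ)‖ = 1 → lval z (e i) = 0 → z = 1 := by
    intro i z hz hzero
    -- `z` is the `k`-th power of a zero for the original unit cell
    obtain ⟨w, rfl⟩ : ∃ w : ℂˣ, w ^ k = z := by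
      obtain ⟨w, hw⟩ := IsAlgClosed.exists_pow_nat_eq (z : ℂ) hk
      have hw0 : w ≠ 0 := by
        rintro rfl
        rw [zero_pow hk.ne'] at hw
        exact z.ne_zero hw.symm
      exact ⟨Units.mk0 w hw0, Units.ext (by simpa using hw)⟩
    have h0 : lval (w ^ k) (Y.recell k hk).lmat.det = 0 := by
      rw [← hedet, map_prod]
      exact Finset.prod_eq_zero (Finset.mem_univ i) hzero
    rw [lval_det_recell, Finset.prod_eq_zero_iff] at h0
    obtain ⟨j, -, hj⟩ := h0
    rw [hdetY, map_prod, Finset.prod_eq_zero_iff] at hj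
    obtain ⟨l, -, hl⟩ := hj
    rw [← node_pow hk w j]
    obtain ⟨r, rfl⟩ := hdvd
    rw [pow_mul, hq l _ hl, one_pow]
  refine ⟨fun i => (signs (e i)).1, fun i => ind (e i), fun i => circ (e i),
    fun i => ((he i).circ_le_one (hone i)).1, (hcon.trans
      (Connected.of_hop_eq hYCFT rfl : Connected Y (Y.recell k hk))).trans (hecon.trans
      (connected_diagonal (N := (Y.recell k hk).cell) _ he (fun i => ?_) (fun i => ?_) (fun i => ?_)
        fun i => ?_))⟩
  · exact simpleCirc_basicPoly _ _ ((he i).circ_le_one (hone i)).1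
  · exact (circ_basicPoly _ _ _).symm
  · exact (ind_basicPoly _ _ _).symm
  · rw [signs_basicPoly _ _ ((he i).circ_le_one (hone i)).1, ← ((he i).circ_le_one (hone i)).2]

end Diagonal

/-! ### Changing signs by doubling the unit cell -/

section SignFlip
open Matrix

variable {N : ℕ} (hN : 0 < N)

/-- A product of elementary matrices acts by elementary operations. -/
theorem ElemEquiv.mul_of_one {n R : Type*} [Fintype n] [DecidableEq n] [CommRing R]
    {E : Matrix n n R} (h : ElemEquiv 1 E) (M : Matrix n n R) : ElemEquiv M (E * M) := by
  induction h generalizing M with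
  | refl => rw [one_mul]; exact .refl
  | left _ i j hij c ih => rw [mul_assoc]; exact (ih M).left i j hij c
  | right _ i j hij c ih =>
    rw [mul_assoc]
    exact (ElemEquiv.refl.left i j hij c).trans (ih _)

theorem ElemEquiv.diagonal_mul {n R : Type*} [Fintype n] [DecidableEq n] [CommRing R]
    {v : n → Rˣ} (hv : ∏ i, v i = 1) (M : Matrix n n R) :
    ElemEquiv M (diagonal (fun i => (v i : R)) * M) := by
  refine ElemEquiv.mul_of_one ?_ M
  simpa using ElemEquiv.diagonal_units v hv fun _ => 1

/-- The unit `±1` of the ring of Laurent polynomials. -/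
noncomputable def signUnit : ℤˣ →* ℝ[T;T⁻¹]ˣ := Units.map (Int.castRingHom ℝ[T;T⁻¹]).toMonoidHom

theorem signUnit_val (σ : ℤˣ) : ((signUnit σ : ℝ[T;T⁻¹]ˣ) : ℝ[T;T⁻¹]) = ((σ : ℤ) : ℝ[T;T⁻¹]) := rfl

theorem coeff_signUnit_mul (σ : ℤˣ) (p : ℝ[T;T⁻¹]) (α : ℤ) :
    ((signUnit σ : ℝ[T;T⁻¹]) * p).coeff α = ((σ : ℤ) : ℝ) * p.coeff α := by
  rcases Int.units_eq_one_or σ with rfl | rfl <;> simp [signUnit_val]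

/-- Signs can be attached to the rows of the coupling matrix: this is a product of elementary
operations if the unit cell is doubled, because the product of the signs is then `1`. -/
theorem connected_sign_mul (ε : Fin N → ℤˣ) {M : Matrix (Fin N) (Fin N) ℝ[T;T⁻¹]}
    (hM : LinearGap (symbol M)) :
    Connected (ofMat hN M) (ofMat hN (diagonal (fun i => (signUnit (ε i) : ℝ[T;T⁻¹])) * M)) := by
  set X := ofMat hN M with hX
  set Y := ofMat hN (diagonal (fun i => (signUnit (ε i) : ℝ[T;T⁻¹])) * M) with hY
  have hXCFT : X.IsCFT := (isCFT_ofMat_iff hN M).mpr hM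
  have hhop : ∀ i j, Y.hop i j = ((ε (site hN i) : ℤ) : ℝ) * X.hop i j := fun i j => by
    change ((diagonal _ * M : Matrix _ _ _) _ _).coeff _ = _
    rw [Matrix.diagonal_mul, coeff_signUnit_mul]
    rfl
  set ε' : Fin (2 * N) → ℤˣ := fun a => ε (site hN ((a : ℕ) : ℤ)) with hε'
  set M₂ : Matrix (Fin (2 * N)) (Fin (2 * N)) ℝ[T;T⁻¹] := (X.recell 2 two_pos).lmat with hM₂
  -- each sign occurs twice in the doubled unit cell
  have hprod : ∏ a, ε' a = 1 := by
    rw [← finProdFinEquiv.prod_comp, Fintype.prod_prod_type]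
    have : ∀ x y, ε' (finProdFinEquiv (x, y)) = ε y := fun x y => by
      simp only [hε', finProdFinEquiv_apply_val]
      push_cast
      rw [site_add_mul, site_coe]
    simp only [this, Fin.prod_univ_two]
    exact Int.units_mul_self _
  have hprod' : ∏ a, signUnit (ε' a) = 1 := by rw [← map_prod, hprod, map_one]
  have hA : ∀ a b α, ((diagonal (fun a => (signUnit (ε' a) : ℝ[T;T⁻¹])) * M₂) a b).coeff α =
      ((ε' a : ℤ) : ℝ) * (M₂ a b).coeff α := fun a b α => by
    rw [Matrix.diagonal_mul, coeff_signUnit_mul]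
  have hY₂ : (Y.recell 2 two_pos).lmat =
      diagonal (fun a => (signUnit (ε' a) : ℝ[T;T⁻¹])) * M₂ := by
    funext a b
    ext α
    refine (coeff_lmat (Y.recell 2 two_pos) a b α).trans ?_
    exact (hhop _ _).trans (hA a b α).symm
  have hgap : LinearGap (symbol M₂) :=
    (isCFT_iff (X.recell 2 two_pos)).mp ((isCFT_recell X two_pos).mpr hXCFT)
  obtain ⟨hgap', hcon⟩ := (ElemEquiv.diagonal_mul hprod' M₂).connected
    (X.recell 2 two_pos).cell_pos hgap
  have e1 : ofMat (X.recell 2 two_pos).cell_pos M₂ = X.recell 2 two_pos := ofMat_lmat _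
  have e2 : ofMat (Y.recell 2 two_pos).cell_pos
      (diagonal (fun a => (signUnit (ε' a) : ℝ[T;T⁻¹])) * M₂) = Y.recell 2 two_pos := by
    rw [← hY₂]
    exact ofMat_lmat _
  rw [e1] at hcon
  refine (Connected.of_hop_eq hXCFT rfl : Connected X (X.recell 2 two_pos)).trans (hcon.trans ?_)
  have e3 := congrArg BDIChain.hop e2
  exact Connected.of_hop_eq ((isCFT_ofMat_iff _ _).mpr hgap') e3

end SignFlip

/-! ### Classification of chains with a CFT bulk -/

section Classification
open Matrix

theorem exists_perm_of_sum_eq {K : ℕ} {n n' : Fin K → ℕ} (h : ∀ i, n i ≤ 1) (h' : ∀ i, n' i ≤ 1)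
    (hs : ∑ i, n i = ∑ i, n' i) : ∃ π : Equiv.Perm (Fin K), ∀ i, n' (π i) = n i := by
  have hcard : ∀ m : Fin K → ℕ, (∀ i, m i ≤ 1) → Fintype.card {i // m i = 1} = ∑ i, m i := by
    intro m hm
    rw [Fintype.card_subtype, Finset.card_filter]
    refine Finset.sum_congr rfl fun i _ => ?_
    have := hm i
    split_ifs with h <;> omega
  have e : {i // n i = 1} ≃ {i // n' i = 1} :=
    Fintype.equivOfCardEq (by rw [hcard n h, hcard n' h', hs])
  refine ⟨e.extendSubtype, fun i => ?_⟩
  by_cases hi : n i = 1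
  · rw [e.extendSubtype_mem i hi, hi]
  · have h1 := e.extendSubtype_not_mem i hi
    have h2 := h' (e.extendSubtype i)
    have h3 := h i
    omega

theorem basicPoly_eq (σ : ℤˣ) (ω : ℤ) (n : ℕ) : basicPoly σ ω n =
    (signUnit σ : ℝ[T;T⁻¹]) * LaurentPolynomial.T ω * basicPoly 1 0 n := by
  have h1 : ∀ σ : ℤˣ, (LaurentPolynomial.C (signVal σ) : ℝ[T;T⁻¹]) = signUnit σ := fun σ => by
    rw [signVal, signUnit_val, map_intCast]
  rw [basicPoly, basicPoly, normalForm, normalForm, h1, h1, map_one, LaurentPolynomial.T_zero,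
    Units.val_one, one_mul, one_mul]

theorem prod_T {ι : Type*} (s : Finset ι) (ω : ι → ℤ) :
    ∏ i ∈ s, (LaurentPolynomial.T (ω i) : ℝ[T;T⁻¹]) = LaurentPolynomial.T (∑ i ∈ s, ω i) := by
  classical
  induction s using Finset.induction_on with
  | empty => simp
  | insert a s ha ih =>
    rw [Finset.prod_insert ha, Finset.sum_insert ha, ih, LaurentPolynomial.T_add]

/-- Among the decoupled chains with entries `± z ^ ω (z - 1) ^ n`, `n ≤ 1`, only the sums of the `n` and
of the `ω` matter: permute the entries, then shift powers of `z` and signs between them. -/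
theorem connected_basic {K : ℕ} (hK : 0 < K) {σ σ' : Fin K → ℤˣ} {ω ω' : Fin K → ℤ}
    {n n' : Fin K → ℕ} (hn : ∀ i, n i ≤ 1) (hn' : ∀ i, n' i ≤ 1) (hs : ∑ i, n i = ∑ i, n' i)
    (hω : ∑ i, ω i = ∑ i, ω' i) :
    Connected (ofMat hK (diagonal fun i => basicPoly (σ i) (ω i) (n i)))
      (ofMat hK (diagonal fun i => basicPoly (σ' i) (ω' i) (n' i))) := by
  obtain ⟨π, hπ⟩ := exists_perm_of_sum_eq hn hn' hs
  -- the zeros on the unit circle are brought to the same places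
  have h1 := (ElemEquiv.diagonal_perm π fun i => basicPoly (σ' i) (ω' i) (n' i)).connected hK
    ((linearGap_diagonal _).mpr fun i => simpleCirc_basicPoly _ _ (hn' i))
  -- the signs are made equal
  have h2 := connected_sign_mul hK (fun i => σ' (π i) * σ i)
    ((linearGap_diagonal fun i => basicPoly (σ i) (ω i) (n i)).mpr
      fun i => simpleCirc_basicPoly _ _ (hn i))
  have e2 : diagonal (fun i => (signUnit (σ' (π i) * σ i) : ℝ[T;T⁻¹])) *
      diagonal (fun i => basicPoly (σ i) (ω i) (n i))
      = diagonal fun i => basicPoly (σ' (π i)) (ω i) (n i) := by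
    rw [diagonal_mul_diagonal]
    congr 1
    funext i
    rw [basicPoly_eq (σ i), basicPoly_eq (σ' (π i)), ← mul_assoc, ← mul_assoc, ← Units.val_mul,
      ← map_mul, mul_assoc (σ' (π i)), Int.units_mul_self, mul_one]
  rw [e2] at h2
  -- the powers of `z` are moved from one site to another
  set v : Fin K → ℝ[T;T⁻¹]ˣ := fun i =>
    (LaurentPolynomial.isUnit_T (R := ℝ) (ω' (π i) - ω i)).unit with hv
  have hprod : ∏ i, v i = 1 := by
    ext1
    rw [Units.coe_prod, Units.val_one]
    simp only [hv, IsUnit.unit_spec]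
    rw [prod_T, Finset.sum_sub_distrib, hω, Equiv.sum_comp π ω', sub_self, LaurentPolynomial.T_zero]
  have h3 := (ElemEquiv.diagonal_units v hprod fun i =>
    basicPoly (σ' (π i)) (ω i) (n i)).connected hK
      ((linearGap_diagonal _).mpr fun i => simpleCirc_basicPoly _ _ (hn i))
  have e3 : (diagonal fun i => (v i : ℝ[T;T⁻¹]) * basicPoly (σ' (π i)) (ω i) (n i))
      = diagonal ((fun i => basicPoly (σ' i) (ω' i) (n' i)) ∘ π) := by
    congr 1
    funext i
    rw [Function.comp_apply, hπ, basicPoly_eq _ (ω i), basicPoly_eq _ (ω' (π i)), hv,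
      IsUnit.unit_spec, ← sub_add_cancel (ω' (π i)) (ω i), LaurentPolynomial.T_add,
      sub_add_cancel]
    ring
  rw [e3] at h3
  exact h2.trans (h3.2.trans h1.2.symm)

/-- The classification: chains with CFT bulk are connected iff they have the same central charge and
the same topological invariant. -/
theorem connected_iff {X Y : BDIChain} (hX : X.IsCFT) (hY : Y.IsCFT) :
    Connected X Y ↔ X.centralCharge = Y.centralCharge ∧ X.omega = Y.omega := by
  refine ⟨fun h => h.invariants.2.2, fun ⟨hc, hω⟩ => ?_⟩
  have hcirc : circ X.lmat.det = circ Y.lmat.det := by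
    rw [centralCharge_eq, centralCharge_eq] at hc
    have : (circ X.lmat.det : ℚ) = circ Y.lmat.det := by linarith
    exact_mod_cast this
  set m := 2 * (circ X.lmat.det).factorial with hm
  have hm0 : 0 < m := by positivity
  -- the cells are enlarged by suitable factors to a common size
  obtain ⟨σ, ω, n, hn, h⟩ := hX.exists_connected_basic (k := m * Y.cell)
    (Nat.mul_pos hm0 Y.cell_pos) (Dvd.intro _ rfl)
    (K := m * Y.cell * X.cell) (Nat.mul_pos (Nat.mul_pos hm0 Y.cell_pos) X.cell_pos) rfl
  obtain ⟨σ', ω', n', hn', h'⟩ := hY.exists_connected_basic (k := m * X.cell)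
    (Nat.mul_pos hm0 X.cell_pos) (by rw [← hcirc]; exact Dvd.intro _ rfl)
    (K := m * Y.cell * X.cell) (Nat.mul_pos (Nat.mul_pos hm0 Y.cell_pos) X.cell_pos) (by ring)
  have hval : ∀ {K : ℕ} (hK : 0 < K) {σ : Fin K → ℤˣ} {ω : Fin K → ℤ} {n : Fin K → ℕ} {Z : BDIChain},
      (∀ i, n i ≤ 1) → Connected Z (ofMat hK (diagonal fun i => basicPoly (σ i) (ω i) (n i))) →
      Z.centralCharge = ((∑ i, n i : ℕ) : ℚ) / 2 ∧ Z.omega = ∑ i, ω i := by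
    intro K hK σ ω n Z hn hZ
    obtain ⟨-, -, h1, h2⟩ := hZ.invariants
    have hne : ∀ i ∈ Finset.univ, basicPoly (σ i) (ω i) (n i) ≠ 0 := fun i _ =>
      (simpleCirc_basicPoly _ _ (hn i)).1
    have hdet : (ofMat hK (diagonal fun i => basicPoly (σ i) (ω i) (n i))).lmat.det
        = ∏ i, basicPoly (σ i) (ω i) (n i) := by
      rw [lmat_ofMat]
      exact det_diagonal
    rw [h1, h2, centralCharge_eq, omega_eq, hdet, circ_prod _ hne, ind_prod _ hne]
    simp only [circ_basicPoly, ind_basicPoly, and_self]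
  obtain ⟨c1, w1⟩ := hval _ hn h
  obtain ⟨c2, w2⟩ := hval _ hn' h'
  have hs : ∑ i, n i = ∑ i, n' i := by
    rw [c1, c2] at hc
    have : ((∑ i, n i : ℕ) : ℚ) = (∑ i, n' i : ℕ) := by linarith
    exact_mod_cast this
  exact h.trans ((connected_basic _ hn hn' hs (by rw [← w1, ← w2, hω])).trans h'.symm)

end Classification

/-! ### Stacking -/

section Stack
open Matrix

theorem stack_hop_eq (X Y : BDIChain) {a b : ℕ} (α : ℤ) (ha : a < X.cell + Y.cell)
    (hb : b < X.cell + Y.cell) :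
    (stack X Y).hop a (b + ((X.cell + Y.cell : ℕ) : ℤ) * α) =
      if a < X.cell ∧ b < X.cell then X.hop a (b + X.cell * α)
      else if X.cell ≤ a ∧ X.cell ≤ b then
        Y.hop ((a - X.cell : ℕ) : ℤ) ((b - X.cell : ℕ) + Y.cell * α)
      else 0 := by
  have hL : ((X.cell : ℤ) + Y.cell) ≠ 0 := by omega
  have ha0 : (0 : ℤ) ≤ a := by positivity
  have hb0 : (0 : ℤ) ≤ b := by positivity
  have ha1 : (a : ℤ) < (X.cell : ℤ) + Y.cell := by exact_mod_cast ha
  have hb1 : (b : ℤ) < (X.cell : ℤ) + Y.cell := by exact_mod_cast hb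
  simp only [stack, Nat.cast_add, Int.add_mul_emod_self_left, Int.add_mul_ediv_left _ _ hL,
    Int.emod_eq_of_lt ha0 ha1, Int.emod_eq_of_lt hb0 hb1, Int.ediv_eq_zero_of_lt ha0 ha1,
    Int.ediv_eq_zero_of_lt hb0 hb1, Nat.cast_lt, Nat.cast_le]
  split_ifs with h1 h2
  · congr 1 <;> ring
  · rw [Nat.cast_sub h2.1, Nat.cast_sub h2.2]
    congr 1 <;> ring
  · rfl

/-- The sites in the unit cell of a stack. -/
def stackEquiv (X Y : BDIChain) : Fin X.cell ⊕ Fin Y.cell ≃ Fin (stack X Y).cell := finSumFinEquiv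

theorem lmat_stack_submatrix (X Y : BDIChain) :
    (stack X Y).lmat.submatrix (stackEquiv X Y) (stackEquiv X Y)
      = fromBlocks X.lmat 0 0 Y.lmat := by
  funext x y
  ext α
  refine (stack_hop_eq X Y α (finSumFinEquiv x).2 (finSumFinEquiv y).2).trans ?_
  rcases x with a | a <;> rcases y with b | b
  · simp [coeff_lmat]
  · simp
  · simp
  · simp [coeff_lmat]

theorem det_lmat_stack (X Y : BDIChain) :
    (stack X Y).lmat.det = X.lmat.det * Y.lmat.det := by
  rw [← det_submatrix_equiv_self (stackEquiv X Y), lmat_stack_submatrix, det_fromBlocks_zero₂₁]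

theorem IsCFT.stack {X Y : BDIChain} (hX : X.IsCFT) (hY : Y.IsCFT) : (stack X Y).IsCFT := by
  rw [isCFT_iff] at hX hY ⊢
  have h := (linearGap_fromBlocks hX hY).reindex (stackEquiv X Y)
  have e : ∀ k, reindex (stackEquiv X Y) (stackEquiv X Y)
      (fromBlocks ((lval (expU k)).mapMatrix X.lmat) 0 0 ((lval (expU k)).mapMatrix Y.lmat))
      = (lval (expU k)).mapMatrix (BDIChain.stack X Y).lmat := by
    intro k
    have h1 : fromBlocks ((lval (expU k)).mapMatrix X.lmat) 0 0
        ((lval (expU k)).mapMatrix Y.lmat) = (fromBlocks X.lmat 0 0 Y.lmat).map (lval (expU k)) := by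
      rw [fromBlocks_map]
      simp [Matrix.map_zero]
    rw [h1, ← lmat_stack_submatrix]
    ext i j
    simp
  simpa only [e] using h

theorem invariants_stack {X Y : BDIChain} (hX : X.IsCFT) (hY : Y.IsCFT) :
    (BDIChain.stack X Y).centralCharge = X.centralCharge + Y.centralCharge ∧
      (BDIChain.stack X Y).omega = X.omega + Y.omega := by
  simp only [centralCharge_eq, omega_eq, det_lmat_stack, circ_mul hX.det_ne_zero hY.det_ne_zero,
    ind_mul hX.det_ne_zero hY.det_ne_zero]
  refine ⟨?_, trivial⟩
  push_cast
  ring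

end Stack

/-! ### Translation invariant chains -/

section TranslationInvariant
open Matrix

/-- The translation invariant chain with a given Laurent polynomial as associated function. -/
noncomputable def tiChain (p : ℝ[T;T⁻¹]) : BDIChain := ofMat one_pos (diagonal fun _ => p)

theorem tiChain_hop (p : ℝ[T;T⁻¹]) (i j : ℤ) : (tiChain p).hop i j = p.coeff (j - i) := by
  change ((diagonal (fun _ => p) : Matrix (Fin 1) (Fin 1) _) _ _).coeff _ = _
  rw [Subsingleton.elim (site one_pos i) 0, Subsingleton.elim (site one_pos j) 0,
    diagonal_apply_eq]
  simp

theorem det_tiChain (p : ℝ[T;T⁻¹]) : (tiChain p).lmat.det = p := by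
  rw [tiChain, lmat_ofMat]
  refine det_diagonal.trans ?_
  exact (Fintype.prod_unique fun _ : Fin 1 => p)

theorem isCFT_tiChain (p : ℝ[T;T⁻¹]) : (tiChain p).IsCFT ↔ SimpleCirc p := by
  rw [tiChain, isCFT_ofMat_iff, linearGap_diagonal]
  simp

theorem centralCharge_tiChain (p : ℝ[T;T⁻¹]) : (tiChain p).centralCharge = (circ p : ℚ) / 2 := by
  rw [centralCharge_eq, det_tiChain]

theorem omega_tiChain (p : ℝ[T;T⁻¹]) : (tiChain p).omega = ind p := by
  rw [omega_eq, det_tiChain]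

theorem ofCoeff_eq_tiChain (t : ℤ →₀ ℝ) : ofCoeff t = tiChain (.ofCoeff t) :=
  ext_cell_hop rfl (by funext i j; rw [tiChain_hop]; rfl)

theorem translationInvariant_ofCoeff (t : ℤ →₀ ℝ) : (ofCoeff t).TranslationInvariant := by
  intro i j
  change t (j + 1 - (i + 1)) = t (j - i)
  congr 1
  ring

theorem hop_zero_finite (X : BDIChain) : (Function.support fun α => X.hop 0 α).Finite := by
  obtain ⟨R, hR⟩ := X.finite_range
  refine (Set.finite_Icc (-R) R).subset fun α hα => ?_
  by_contra hc
  refine hα (hR 0 α ?_)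
  rw [Set.mem_Icc, not_and_or, not_le, not_le] at hc
  rw [zero_sub, abs_neg]
  rcases hc with hc | hc
  · exact lt_abs.mpr (Or.inr (by linarith))
  · exact lt_abs.mpr (Or.inl hc)

/-- The function `f` of a translation invariant chain, as a Laurent polynomial. (For other chains
this is of no significance.) -/
noncomputable def tiPoly (X : BDIChain) : ℝ[T;T⁻¹] :=
  .ofCoeff (Finsupp.ofSupportFinite (fun α => X.hop 0 α) X.hop_zero_finite)

theorem coeff_tiPoly (X : BDIChain) (α : ℤ) : X.tiPoly.coeff α = X.hop 0 α := rfl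

theorem tiPoly_congr {X Y : BDIChain} (h : X.hop = Y.hop) : X.tiPoly = Y.tiPoly := by
  ext α
  rw [coeff_tiPoly, coeff_tiPoly, h]

theorem tiPoly_tiChain (p : ℝ[T;T⁻¹]) : (tiChain p).tiPoly = p := by
  ext α
  rw [coeff_tiPoly, tiChain_hop, sub_zero]

theorem TranslationInvariant.hop_eq {X : BDIChain} (h : X.TranslationInvariant) :
    X.hop = (tiChain X.tiPoly).hop := by
  have key : ∀ k i j : ℤ, X.hop (i + k) (j + k) = X.hop i j := by
    intro k
    induction k using Int.induction_on with
    | zero => simp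
    | succ k ih => intro i j; rw [← ih i j, ← h (i + k)]; congr 1 <;> ring
    | pred k ih => intro i j; rw [← ih i j, ← h (i + (-k - 1))]; congr 1 <;> ring
  funext i j
  rw [tiChain_hop, coeff_tiPoly, ← key i 0 (j - i)]
  congr 1 <;> ring

theorem cell_one_eq_tiChain {X : BDIChain} (h : X.cell = 1) : X = tiChain X.tiPoly := by
  refine ext_cell_hop h (TranslationInvariant.hop_eq fun i j => ?_)
  have := X.periodic i j
  rwa [h, Nat.cast_one] at this

theorem tiConnected_tiChain_of_deform {p q : ℝ[T;T⁻¹]} (h : Deform p q) :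
    TIConnected (tiChain p) (tiChain q) := by
  obtain ⟨γ, hγ, hcell, h0, h1⟩ := exists_path_diagonal one_pos fun _ => h
  exact ⟨γ, hγ, hcell, by rw [h0]; rfl, by rw [h1]; rfl⟩

/-- The two signs do not change along translation invariant paths. -/
theorem signs_eq_of_tiConnected {X Y : BDIChain} (h : TIConnected X Y) :
    signs X.tiPoly = signs Y.tiPoly := by
  obtain ⟨γ, hγ, hcell, h0, h1⟩ := h
  obtain ⟨M, hM⟩ := hγ.1.exists_matrix
  have hti : ∀ s, (γ s).tiPoly = pathAt s M.det := fun s => by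
    have e1 : (γ s).lmat.det = (γ s).tiPoly := by
      conv_lhs => rw [cell_one_eq_tiChain (hcell s)]
      exact det_tiChain _
    have e2 : (γ s).lmat.det = pathAt s M.det := by
      rw [hM s, ← det_matAt]
      exact congrArg det (lmat_ofMat _ _)
    rw [← e1, e2]
  have hs : ∀ s, SimpleCirc (pathAt s M.det) := fun s => by
    rw [← hti, ← isCFT_tiChain, ← cell_one_eq_tiChain (hcell s)]
    exact (hγ.2 s).1
  have hc : ∀ s, circ (pathAt s M.det) = circ (pathAt 0 M.det) := fun s => by
    have := (hγ.2 s).2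
    rw [cell_one_eq_tiChain (hcell s), cell_one_eq_tiChain (hcell 0), centralCharge_tiChain,
      centralCharge_tiChain, hti, hti] at this
    have h2 : (circ (pathAt s M.det) : ℚ) = circ (pathAt 0 M.det) := by linarith
    exact_mod_cast h2
  rw [← tiPoly_congr h0, ← tiPoly_congr h1, hti, hti]
  exact (signs_pathAt hs hc 1).symm

/-- The classification with strict translation invariance. -/
theorem tiConnected_iff {X Y : BDIChain} (hXT : X.TranslationInvariant)
    (hYT : Y.TranslationInvariant) (hX : X.IsCFT) (hY : Y.IsCFT) :
    TIConnected X Y ↔ X.centralCharge = Y.centralCharge ∧ X.omega = Y.omega ∧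
      signs X.tiPoly = signs Y.tiPoly := by
  constructor
  · intro h
    have h' := h
    obtain ⟨γ, hγ, -, h0, h1⟩ := h'
    obtain ⟨-, -, hc, hω⟩ := Connected.invariants ⟨γ, hγ, h0, h1⟩
    exact ⟨hc, hω, signs_eq_of_tiConnected h⟩
  · rintro ⟨hc, hω, hs⟩
    obtain ⟨iX, cX, wX⟩ := invariants_of_hop_eq hXT.hop_eq
    obtain ⟨iY, cY, wY⟩ := invariants_of_hop_eq hYT.hop_eq
    have hXs : SimpleCirc X.tiPoly := (isCFT_tiChain _).mp (iX.mp hX)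
    have hYs : SimpleCirc Y.tiPoly := (isCFT_tiChain _).mp (iY.mp hY)
    rw [cX, cY, centralCharge_tiChain, centralCharge_tiChain] at hc
    rw [wX, wY, omega_tiChain, omega_tiChain] at hω
    have hc' : (circ X.tiPoly : ℚ) = circ Y.tiPoly := by linarith
    obtain ⟨p, q, h1, h2, h3⟩ := exists_deform hXs hYs (by exact_mod_cast hc') hω hs
    have h4 := (tiConnected_tiChain_of_deform h1).trans ((tiConnected_tiChain_of_deform h2).trans
      (tiConnected_tiChain_of_deform h3).symm)
    obtain ⟨γ, hγ, hcell, e0, e1⟩ := h4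
    exact ⟨γ, hγ, hcell, e0.trans hXT.hop_eq.symm, e1.trans hYT.hop_eq.symm⟩

end TranslationInvariant

/-! ### Canonical chains -/

section CanonicalChains
open Matrix

theorem ofCoeff_single (ω : ℤ) (c : ℝ) : (AddMonoidAlgebra.ofCoeff (Finsupp.single ω c) : ℝ[T;T⁻¹])
    = LaurentPolynomial.C c * LaurentPolynomial.T ω := by
  rw [← LaurentPolynomial.single_eq_C_mul_T]
  rfl

theorem gappedCanonical_eq (ω : ℤ) (σ : ℤˣ) : gappedCanonical ω σ = tiChain (basicPoly σ ω 0) := by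
  rw [gappedCanonical, ofCoeff_eq_tiChain, ofCoeff_single, basicPoly, normalForm, circleFactor]
  simp [signVal]

theorem alphaChain_eq (ω : ℤ) : alphaChain ω = gappedCanonical ω 1 := by
  rw [alphaChain, gappedCanonical]
  simp

theorem criticalCanonical_eq (n : ℕ) (ω : ℤ) (σ : ℤˣ × ℤˣ) :
    criticalCanonical n ω σ = tiChain (critPoly n ω σ) := by
  rw [criticalCanonical, ofCoeff_eq_tiChain, AddMonoidAlgebra.ofCoeff_add, ofCoeff_single,
    ofCoeff_single, critPoly, LaurentPolynomial.T_add]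
  congr 1
  simp only [map_mul, map_add, Polynomial.toLaurent_C, Polynomial.toLaurent_X_pow, signVal]
  ring

theorem majoranaChain_eq : majoranaChain = criticalCanonical 1 0 (1, 1) := by
  rw [majoranaChain, criticalCanonical, add_comm]
  simp

theorem gappedCanonical_spec (ω : ℤ) (σ : ℤˣ) :
    (gappedCanonical ω σ).IsCFT ∧ (gappedCanonical ω σ).centralCharge = 0 ∧
      (gappedCanonical ω σ).omega = ω ∧ signs (gappedCanonical ω σ).tiPoly = (σ, 1) := by
  rw [gappedCanonical_eq, isCFT_tiChain, centralCharge_tiChain, omega_tiChain, tiPoly_tiChain,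
    circ_basicPoly, ind_basicPoly, signs_basicPoly _ _ zero_le_one]
  exact ⟨simpleCirc_basicPoly _ _ zero_le_one, by simp, rfl, rfl⟩

theorem criticalCanonical_spec {n : ℕ} (hn : 0 < n) (ω : ℤ) (σ : ℤˣ × ℤˣ) :
    (criticalCanonical n ω σ).IsCFT ∧ (criticalCanonical n ω σ).centralCharge = (n : ℚ) / 2 ∧
      (criticalCanonical n ω σ).omega = ω ∧ signs (criticalCanonical n ω σ).tiPoly = σ := by
  rw [criticalCanonical_eq, isCFT_tiChain, centralCharge_tiChain, omega_tiChain, tiPoly_tiChain,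
    circ_critPoly hn, ind_critPoly hn, signs_critPoly hn]
  exact ⟨simpleCirc_critPoly hn _ _, rfl, rfl, rfl⟩

theorem standardStack_spec (ω : ℤ) (n : ℕ) :
    IsStackOfTI (standardStack ω n) ∧ (standardStack ω n).IsCFT ∧
      (standardStack ω n).centralCharge = (n : ℚ) / 2 ∧ (standardStack ω n).omega = ω := by
  induction n with
  | zero =>
    obtain ⟨h1, h2, h3, -⟩ := gappedCanonical_spec ω 1
    rw [← alphaChain_eq] at h1 h2 h3
    exact ⟨.single _ (translationInvariant_ofCoeff _), h1, by rw [standardStack, h2]; simp, h3⟩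
  | succ n ih =>
    obtain ⟨h0, h1, h2, h3⟩ := ih
    obtain ⟨a1, a2, a3, -⟩ := criticalCanonical_spec one_pos 0 (1, 1)
    rw [← majoranaChain_eq] at a1 a2 a3
    obtain ⟨b1, b2⟩ := invariants_stack h1 a1
    refine ⟨.stack _ _ h0 (.single _ (translationInvariant_ofCoeff _)), h1.stack a1, ?_, ?_⟩
    · rw [standardStack, b1, h2, a2]
      push_cast
      ring
    · rw [standardStack, b2, h3, a3, add_zero]

theorem IsCFT.connected_standardStack {X : BDIChain} (h : X.IsCFT) {n : ℕ}
    (hn : X.centralCharge = (n : ℚ) / 2) : Connected X (standardStack X.omega n) := by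
  obtain ⟨-, h1, h2, h3⟩ := standardStack_spec X.omega n
  exact (connected_iff h h1).mpr ⟨hn.trans h2.symm, h3.symm⟩

/-- Every chain with CFT bulk can be deformed to a stack of translation invariant chains. -/
theorem IsCFT.inClass {X : BDIChain} (h : X.IsCFT) : InClass X :=
  ⟨h, _, (standardStack_spec X.omega _).1, (h.connected_standardStack (centralCharge_eq X)).symm⟩

theorem trivialChain_spec :
    trivialChain.IsCFT ∧ trivialChain.centralCharge = 0 ∧ trivialChain.omega = 0 := by
  obtain ⟨h1, h2, h3, -⟩ := gappedCanonical_spec 0 1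
  rw [← alphaChain_eq] at h1 h2 h3
  exact ⟨h1, h2, h3⟩

theorem UpToTrivial.invariants {X X' : BDIChain} (h : UpToTrivial X X') (hX : X.IsCFT) :
    X'.centralCharge = X.centralCharge ∧ X'.omega = X.omega := by
  rcases h with rfl | rfl
  · exact ⟨rfl, rfl⟩
  · obtain ⟨h1, h2, h3⟩ := trivialChain_spec
    obtain ⟨e1, e2⟩ := invariants_stack hX h1
    rw [e1, e2, h2, h3, add_zero, add_zero]
    exact ⟨rfl, rfl⟩

theorem samePhase_iff {X Y : BDIChain} (hX : X.IsCFT) (hY : Y.IsCFT) :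
    SamePhase X Y ↔ X.centralCharge = Y.centralCharge ∧ X.omega = Y.omega := by
  constructor
  · rintro ⟨X', Y', hX', hY', h⟩
    obtain ⟨a1, a2⟩ := hX'.invariants hX
    obtain ⟨b1, b2⟩ := hY'.invariants hY
    obtain ⟨-, -, h1, h2⟩ := h.invariants
    exact ⟨by rw [← a1, ← b1, h1], by rw [← a2, ← b2, h2]⟩
  · intro h
    exact ⟨X, Y, Or.inl rfl, Or.inl rfl, (connected_iff hX hY).mpr h⟩

end CanonicalChains

end BDIChain

open BDIChain in
theorem theorem2 :
    -- the CFT property, `c` and `ω` do not depend on the unit cell chosen to describe a chain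
    (∀ X Y : BDIChain, X.hop = Y.hop →
      (X.IsCFT ↔ Y.IsCFT) ∧ X.centralCharge = Y.centralCharge ∧ X.omega = Y.omega) ∧
    -- `ω` cannot change along a path of local Hamiltonians without a bulk transition: as long as
    -- the number of zeros of `f` on the unit circle is finite and constant, `ω` is constant
    (∀ γ : unitInterval → BDIChain, IsLocalPath γ →
      (∀ s, ∃ z : ℂ, ‖z‖ = 1 ∧ (γ s).f z ≠ 0) →
      (∀ s, (γ s).centralCharge = (γ 0).centralCharge) →
      ∀ s, (γ s).omega = (γ 0).omega) ∧
    -- the phases are labeled by `c ∈ ½ℕ` and `ω ∈ ℤ`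
    (∀ X, InClass X → ∃ n : ℕ, X.centralCharge = (n : ℚ) / 2) ∧
    (∀ (n : ℕ) (ω : ℤ), ∃ X, InClass X ∧ X.centralCharge = (n : ℚ) / 2 ∧ X.omega = ω) ∧
    (∀ X Y, InClass X → InClass Y →
      (SamePhase X Y ↔ X.centralCharge = Y.centralCharge ∧ X.omega = Y.omega)) ∧
    -- stacking the phases corresponds to addition of the labels
    (∀ X Y, InClass X → InClass Y →
      InClass (stack X Y) ∧
      (stack X Y).centralCharge = X.centralCharge + Y.centralCharge ∧
      (stack X Y).omega = X.omega + Y.omega) ∧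
    -- up to a trivial chain, each system is connected to `H_ω` stacked with `2c` Majorana chains
    (∀ X, InClass X → ∀ n : ℕ, X.centralCharge = (n : ℚ) / 2 →
      ∃ X', UpToTrivial X X' ∧ Connected X' (standardStack X.omega n)) ∧
    -- between translation invariant chains no trivial chain is needed
    (∀ X Y : BDIChain, X.TranslationInvariant → Y.TranslationInvariant → X.IsCFT → Y.IsCFT →
      (Connected X Y ↔ X.centralCharge = Y.centralCharge ∧ X.omega = Y.omega)) ∧
    -- with strict translation invariance there is one more `ℤ₂` invariant if `c = 0` ...
    (∃ sign : BDIChain → ℤˣ,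
      (∀ X Y : BDIChain, X.TranslationInvariant → Y.TranslationInvariant → X.IsCFT → Y.IsCFT →
        X.centralCharge = 0 → Y.centralCharge = 0 →
        (TIConnected X Y ↔ X.omega = Y.omega ∧ sign X = sign Y)) ∧
      ∀ (ω : ℤ) (σ : ℤˣ),
        (gappedCanonical ω σ).IsCFT ∧ (gappedCanonical ω σ).centralCharge = 0 ∧
        (gappedCanonical ω σ).omega = ω ∧ sign (gappedCanonical ω σ) = σ) ∧
    -- ... and there is one more `ℤ₂ × ℤ₂` invariant if `c ≠ 0`
    (∃ signs : BDIChain → ℤˣ × ℤˣ,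
      (∀ X Y : BDIChain, X.TranslationInvariant → Y.TranslationInvariant → X.IsCFT → Y.IsCFT →
        X.centralCharge ≠ 0 → Y.centralCharge ≠ 0 →
        (TIConnected X Y ↔ X.centralCharge = Y.centralCharge ∧ X.omega = Y.omega ∧
          signs X = signs Y)) ∧
      ∀ (n : ℕ) (ω : ℤ) (σ : ℤˣ × ℤˣ), 0 < n →
        (criticalCanonical n ω σ).IsCFT ∧ (criticalCanonical n ω σ).centralCharge = (n : ℚ) / 2 ∧
        (criticalCanonical n ω σ).omega = ω ∧ signs (criticalCanonical n ω σ) = σ) := by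
  refine ⟨fun X Y => invariants_of_hop_eq,
    fun γ hγ hf hc => hγ.omega_eq (fun s => det_ne_zero_of_f_ne_zero (hf s)) hc,
    fun X _ => ⟨_, centralCharge_eq X⟩, fun n ω => ?_, fun X Y hX hY => samePhase_iff hX.1 hY.1,
    fun X Y hX hY => ⟨(hX.1.stack hY.1).inClass, invariants_stack hX.1 hY.1⟩,
    fun X hX n hn => ⟨X, Or.inl rfl, hX.1.connected_standardStack hn⟩,
    fun X Y _ _ hX hY => connected_iff hX hY,
    ⟨fun X => (signs X.tiPoly).1, fun X Y hXT hYT hX hY hcX hcY => ?_, fun ω σ => ?_⟩,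
    ⟨fun X => signs X.tiPoly, fun X Y hXT hYT hX hY _ _ => tiConnected_iff hXT hYT hX hY,
      fun n ω σ hn => criticalCanonical_spec hn ω σ⟩⟩
  · obtain ⟨-, h1, h2, h3⟩ := standardStack_spec ω n
    exact ⟨_, h1.inClass, h2, h3⟩
  · -- without zeros on the unit circle the second sign is `1`
    have hsnd : ∀ Z : BDIChain, Z.TranslationInvariant → Z.IsCFT → Z.centralCharge = 0 →
        (signs Z.tiPoly).2 = 1 := by
      intro Z hZT hZ hcZ
      obtain ⟨iZ, cZ, -⟩ := invariants_of_hop_eq hZT.hop_eq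
      refine ((isCFT_tiChain _).mp (iZ.mp hZ)).signs_of_circ_eq_zero ?_
      rw [cZ, centralCharge_tiChain] at hcZ
      have : (circ Z.tiPoly : ℚ) = 0 := by linarith
      exact_mod_cast this
    rw [tiConnected_iff hXT hYT hX hY, hcX, hcY, Prod.ext_iff, hsnd X hXT hX hcX,
      hsnd Y hYT hY hcY]
    simp
  · obtain ⟨h1, h2, h3, h4⟩ := gappedCanonical_spec ω σ
    exact ⟨h1, h2, h3, congrArg Prod.fst h4⟩
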